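/- \textbf{Setting.} Let $\mathcal X$ be the set of locally finite subsets $X\subset\mathbb R^2$, with the $\sigma$-algebra $\mathcal F$ generated by the counting variables $X\mapsto \#(X\cap\Lambda')$, $\Lambda'\subset\mathbb R^2$ Borel. Let $\mathcal X^h=\{X\in\mathcal X:\ |x-y|_2>1 \text{ for all distinct } x,y\in X\}$ be the set of hard-core configurations, $e_1=(1,0)$, and $\Lambda_r=[-r,r]^2$ for $r\ge 0$. For $Y\in\mathcal X$ and bounded Borel $\Lambda\subset\mathbb R^2$ let $\nu_\Lambda(\cdot|Y)$ be the law of the Poisson point process of intensity $1$ in $\Lambda$ completed by $Y\setminus\Lambda$ outside $\Lambda$, i.e. $$\int f\,d\nu_\Lambda(\cdot|Y)=e^{-|\Lambda|}\sum_{k\ge0}\frac1{k!}\int_{\Lambda^k}f\big(\{x_1,\dots,x_k\}\cup(Y\setminus\Lambda)\big)\,dx_1\cdots dx_k$$ for measurable $f\ge 0$. For $z>0$ and $Y\in\mathcal X^h$ the hard-disk Gibbs distribution in $\Lambda_n$ is the probability measure $$\mu_n^z(dX|Y)=\frac1{Z_n^z(Y)}\,1_{\mathcal X^h}(X)\,z^{\#(X\cap\Lambda_n)}\,\nu_{\Lambda_n}(dX|Y),$$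 where $Z_n^z(Y)$ is the normalizing constant. \textbf{Theorem.} Let $z>0$, $\epsilon=\min\{\frac1{48z},\frac14\}$, $\delta\in(0,\frac12]$, and let $n\ge200$ be an integer. There are functions $t_{n,X}:\mathbb R^2\to[0,\infty)$ ($X\in\mathcal X$), a set $G_n\in\mathcal F$ and measurable functions $\varphi_n,\bar\varphi_n:\mathcal X\to[0,\infty)$ such that $$\mathfrak T_n(X)=\{x+t_{n,X}(x)e_1: x\in X\},\qquad \bar{\mathfrak T}_n(X)=\{x-t_{n,X}(x)e_1: x\in X\}$$ define measurable maps $\mathfrak T_n,\bar{\mathfrak T}_n:\mathcal X\to\mathcal X$ and the following hold. \begin{enumerate} \item[(1)] $t_{n,X}(x)=0$ for all $X\in\mathcal X$ and $x\notin\Lambda_n$. \item[(2)] $t_{n,X}(x)=\delta\epsilon\sqrt{\log n}$ for all $X\in G_n$ and $x\in X\cap\Lambda_{\sqrt n}$. \item[(3)] $|t_{n,X}(x)-t_{n,X}(y)|\le\delta|x-y|_2$ for all $X\in\mathcal X$ and $x,y\in X$. \item[(4)] $\mu_n^z(G_n^c|Y)\le\frac1n$ for all $Y\in\mathcal X^h$.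 \item[(5)] $\mathfrak T_n$ and $\bar{\mathfrak T}_n$ are bijections of $\mathcal X$, and $\mathfrak T_n(\mathcal X^h)=\mathcal X^h=\bar{\mathfrak T}_n(\mathcal X^h)$. \item[(6)] For every $Y\in\mathcal X^h$, $\mu_n^z(\cdot|Y)$ has a density $g_n$ with respect to $\mu_n^z(\cdot|Y)\circ\mathfrak T_n^{-1}$ and a density $\bar g_n$ with respect to $\mu_n^z(\cdot|Y)\circ\bar{\mathfrak T}_n^{-1}$, where $g_n,\bar g_n:\mathcal X\to[0,\infty)$ are measurable and $\varphi_n=g_n\circ\mathfrak T_n$, $\bar\varphi_n=\bar g_n\circ\bar{\mathfrak T}_n$. In particular $\int f(\mathfrak T_n(X))\,\varphi_n(X)\,\mu_n^z(dX|Y)=\int f(X)\,\mu_n^z(dX|Y)$ for all measurable $f\ge0$, and likewise for $\bar{\mathfrak T}_n,\bar\varphi_n$. \item[(7)] For every $Y\in\mathcal X^h$, $\varphi_n\bar\varphi_n>0$ holds $\mu_n^z(\cdot|Y)$-almost surely and $$\int\big|\log\big(\varphi_n(X)\,\bar\varphi_n(X)\big)\big|\,\mu_n^z(dX|Y)\le120\,\delta^2.$$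 \end{enumerate} -/

import Mathlib

open MeasureTheory Set
open scoped ENNReal

noncomputable section

namespace HardDisk

/-- The plane with the Euclidean norm; its `volume` is Lebesgue measure. -/
abbrev Plane : Type := EuclideanSpace ℝ (Fin 2)

/-- The unit vector `(1, 0)`. -/
def e₁ : Plane := EuclideanSpace.single 0 1

/-- The square `[-r, r]²`. -/
def box (r : ℝ) : Set Plane := {x | ∀ i, |x i| ≤ r}

/-- Particle configurations: locally finite subsets of the plane. -/
@[ext]
structure Config where
  carrier : Set Plane
  finite_inter : ∀ Λ : Set Plane, Bornology.IsBounded Λ → (carrier ∩ Λ).Finite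

/-- The number of particles of `X` in `Λ`. -/
def Config.count (Λ : Set Plane) (X : Config) : ℕ∞ := (X.carrier ∩ Λ).encard

/-- The σ-algebra generated by the counting variables of Borel sets. -/
instance : MeasurableSpace Config :=
  ⨆ (Λ : Set Plane) (_ : MeasurableSet Λ), MeasurableSpace.comap (Config.count Λ) ⊤

/-- The configuration with particles `x i` together with the particles of `Y` outside `Λ`. -/
def Config.glue (Λ : Set Plane) (Y : Config) {k : ℕ} (x : Fin k → Plane) : Config where
  carrier := range x ∪ (Y.carrier \ Λ)
  finite_inter := fun Λ' h => by
    rw [union_inter_distrib_right]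
    exact ((finite_range x).inter_of_left _).union
      ((Y.finite_inter Λ' h).subset (inter_subset_inter_left _ sdiff_subset))

/-- The law of the Poisson point process of intensity one in `Λ`, together with the
deterministic configuration `Y` outside `Λ`. -/
def poisson (Λ : Set Plane) (Y : Config) : Measure Config :=
  ENNReal.ofReal (Real.exp (-(volume Λ).toReal)) •
    Measure.sum fun k : ℕ =>
      ((k.factorial : ℝ≥0∞)⁻¹) •
        (Measure.pi fun _ : Fin k => (volume : Measure Plane).restrict Λ).map (Config.glue Λ Y)

/-- Hard-core configurations (disks of diameter one). -/
def hardCore : Set Config :=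
  {X | ∀ x ∈ X.carrier, ∀ y ∈ X.carrier, x ≠ y → 1 < dist x y}

/-- The unnormalized weight `1_{hard core}(X) z ^ #(X ∩ Λ)`. -/
def weight (z : ℝ) (Λ : Set Plane) : Config → ℝ≥0∞ :=
  hardCore.indicator fun X => ENNReal.ofReal z ^ (X.carrier ∩ Λ).ncard

/-- The partition function. -/
def partitionFn (z : ℝ) (Λ : Set Plane) (Y : Config) : ℝ≥0∞ :=
  ∫⁻ X, weight z Λ X ∂(poisson Λ Y)

/-- The finite-volume Gibbs distribution of the hard-disk model in `Λ` with activity `z` and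
boundary configuration `Y`. -/
def gibbs (z : ℝ) (Λ : Set Plane) (Y : Config) : Measure Config :=
  (partitionFn z Λ Y)⁻¹ • (poisson Λ Y).withDensity (weight z Λ)

/-- `μ` has the density `g` with respect to the image measure `μ ∘ T⁻¹`, and `φ` is this density
evaluated at the transformed configuration, `φ = g ∘ T`. Consequently
`∫ f (T X) φ(X) μ(dX) = ∫ f dμ` for measurable `f ≥ 0`. -/
def IsImageDensity (μ : Measure Config) (T : Config → Config) (φ : Config → ℝ) : Prop :=
  ∃ g : Config → ℝ, Measurable g ∧ (∀ X, 0 ≤ g X) ∧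
    μ = (μ.map T).withDensity (fun X => ENNReal.ofReal (g X)) ∧ ∀ X, φ X = g (T X)

end HardDisk

end

noncomputable section

namespace HardDisk

section Freeze

variable {E : Type*} (τ : E → ℝ) (Φ : E → ℝ → E → ℝ) (S : Set E)

/-- Iterates of the relaxation step `t x ↦ min (t x) (min_{y ∈ S} Φ y (t y) x)`,
started from `τ`. -/
def relax : ℕ → E → ℝ
  | 0 => τ
  | m + 1 => fun x => sInf (insert (relax m x) ((fun y => Φ y (relax m y) x) '' S))

/-- The limit of the relaxation iterates; it is reached after `S.ncard` steps. -/
def freeze (x : E) : ℝ := relax τ Φ S S.ncard x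

variable {τ Φ S}

theorem relax_succ_eq (hS : S.Finite) (m : ℕ) (x : E) :
    relax τ Φ S (m + 1) x = relax τ Φ S m x ∨
      ∃ y ∈ S, relax τ Φ S (m + 1) x = Φ y (relax τ Φ S m y) x := by
  have h : sInf (insert (relax τ Φ S m x) ((fun y => Φ y (relax τ Φ S m y) x) '' S)) ∈
      insert (relax τ Φ S m x) ((fun y => Φ y (relax τ Φ S m y) x) '' S) :=
    (insert_nonempty _ _).csInf_mem ((hS.image _).insert _)
  rcases h with h | ⟨y, hy, h⟩
  · exact Or.inl h
  · exact Or.inr ⟨y, hy, h.symm⟩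

theorem relax_succ_le (hS : S.Finite) (m : ℕ) (x : E) :
    relax τ Φ S (m + 1) x ≤ relax τ Φ S m x :=
  csInf_le ((hS.image _).insert _).bddBelow (mem_insert _ _)

theorem relax_succ_le_of_mem (hS : S.Finite) (m : ℕ) (x : E) {y : E} (hy : y ∈ S) :
    relax τ Φ S (m + 1) x ≤ Φ y (relax τ Φ S m y) x :=
  csInf_le ((hS.image _).insert _).bddBelow (mem_insert_of_mem _ ⟨y, hy, rfl⟩)

theorem relax_succ_lt_iff (hS : S.Finite) (m : ℕ) (x : E) (q : ℝ) :
    relax τ Φ S (m + 1) x < q ↔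
      relax τ Φ S m x < q ∨ ∃ y ∈ S, Φ y (relax τ Φ S m y) x < q := by
  constructor
  · intro h
    rcases relax_succ_eq hS m x with h' | ⟨y, hy, h'⟩
    · exact Or.inl (h' ▸ h)
    · exact Or.inr ⟨y, hy, h' ▸ h⟩
  · rintro (h | ⟨y, hy, h⟩)
    · exact (relax_succ_le hS m x).trans_lt h
    · exact (relax_succ_le_of_mem hS m x hy).trans_lt h

theorem relax_antitone (hS : S.Finite) (x : E) : Antitone fun m => relax τ Φ S m x :=
  antitone_nat_of_succ_le fun m => relax_succ_le hS m x

theorem exists_finset_of_relax_lt (hS : S.Finite) (hΦ : ∀ y t x, t ≤ Φ y t x) (m : ℕ) :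
    ∀ x, relax τ Φ S (m + 1) x < relax τ Φ S m x →
      ∃ A : Finset E, (A : Set E) ⊆ S ∧ A.card = m + 1 ∧ x ∉ A ∧
        ∀ y ∈ A, relax τ Φ S m y ≤ relax τ Φ S (m + 1) x := by
  classical
  induction m with
  | zero =>
    intro x hx
    rcases relax_succ_eq hS 0 x with h | ⟨y, hy, h⟩
    · exact absurd h hx.ne
    · have hyx := h ▸ hΦ y (relax τ Φ S 0 y) x
      refine ⟨{y}, by simpa using hy, by simp, ?_, by simpa using hyx⟩
      intro hxy
      rw [Finset.mem_singleton] at hxy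
      subst hxy
      exact absurd hyx (not_le.2 hx)
  | succ m ih =>
    intro x hx
    rcases relax_succ_eq hS (m + 1) x with h | ⟨y, hy, h⟩
    · exact absurd h hx.ne
    have hyx := h ▸ hΦ y (relax τ Φ S (m + 1) y) x
    have hlt : relax τ Φ S (m + 1) y < relax τ Φ S m y := by
      refine lt_of_le_of_ne (relax_succ_le hS m y) fun heq => ?_
      rw [heq] at h
      exact absurd (relax_succ_le_of_mem hS m x hy) (not_le.2 (h ▸ hx))
    obtain ⟨A, hAS, hcard, hyA, hA⟩ := ih y hlt
    have hall : ∀ v ∈ insert y A, relax τ Φ S (m + 1) v ≤ relax τ Φ S (m + 1 + 1) x := by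
      intro v hv
      rcases Finset.mem_insert.1 hv with rfl | hv
      · exact hyx
      · exact ((relax_succ_le hS m v).trans (hA v hv)).trans hyx
    refine ⟨insert y A, ?_, by rw [Finset.card_insert_of_notMem hyA, hcard], ?_, hall⟩
    · rw [Finset.coe_insert]
      exact insert_subset hy hAS
    · intro hxA
      exact absurd (hall x hxA) (not_le.2 hx)

theorem relax_succ_of_ncard_le (hS : S.Finite) (hΦ : ∀ y t x, t ≤ Φ y t x) {m : ℕ}
    (hm : S.ncard ≤ m) (x : E) : relax τ Φ S (m + 1) x = relax τ Φ S m x := by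
  by_contra hne
  obtain ⟨A, hAS, hcard, -⟩ := exists_finset_of_relax_lt hS hΦ m x
    (lt_of_le_of_ne (relax_succ_le hS _ x) hne)
  have := ncard_le_ncard hAS hS
  rw [ncard_coe_finset] at this
  omega

theorem relax_eq_freeze (hS : S.Finite) (hΦ : ∀ y t x, t ≤ Φ y t x) {m : ℕ}
    (hm : S.ncard ≤ m) (x : E) : relax τ Φ S m x = freeze τ Φ S x := by
  induction m, hm using Nat.le_induction with
  | base => rfl
  | succ m hm ih => rw [relax_succ_of_ncard_le hS hΦ hm, ih]

theorem freeze_le (hS : S.Finite) (x : E) : freeze τ Φ S x ≤ τ x :=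
  relax_antitone hS x (Nat.zero_le _)

theorem freeze_le_of_mem (hS : S.Finite) (hΦ : ∀ y t x, t ≤ Φ y t x) (x : E) {y : E}
    (hy : y ∈ S) : freeze τ Φ S x ≤ Φ y (freeze τ Φ S y) x := by
  rw [← relax_eq_freeze hS hΦ (Nat.le_succ _) x]
  exact relax_succ_le_of_mem hS _ x hy

theorem le_relax_of_le (hS : S.Finite) (hΦ : ∀ y t x, t ≤ Φ y t x) {b : ℝ}
    (hb : ∀ x, b ≤ τ x) (m : ℕ) : ∀ x, b ≤ relax τ Φ S m x := by
  induction m with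
  | zero => exact hb
  | succ m ih =>
    intro x
    rcases relax_succ_eq hS m x with h | ⟨y, hy, h⟩
    · exact h ▸ ih x
    · exact h ▸ (ih y).trans (hΦ _ _ _)

theorem freeze_induction (hS : S.Finite) (hΦ : ∀ y t x, t ≤ Φ y t x)
    (hmono : ∀ y x, StrictMono fun t => Φ y t x) {P : E → Prop}
    (h0 : ∀ x, freeze τ Φ S x = τ x → P x)
    (h1 : ∀ x, ∀ y ∈ S, P y → freeze τ Φ S x = Φ y (freeze τ Φ S y) x → P x) (x : E) : P x := by
  suffices H : ∀ m ≤ S.ncard, ∀ x, relax τ Φ S m x = freeze τ Φ S x → P x from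
    H _ le_rfl x rfl
  intro m
  induction m with
  | zero => exact fun _ x hx => h0 x hx.symm
  | succ m ih =>
    intro hm x hx
    rcases relax_succ_eq hS m x with h | ⟨y, hy, h⟩
    · exact ih (by omega) x (h ▸ hx)
    · have hle : freeze τ Φ S y ≤ relax τ Φ S m y := relax_antitone hS y (by omega)
      have heq : Φ y (freeze τ Φ S y) x = Φ y (relax τ Φ S m y) x :=
        le_antisymm ((hmono y x).monotone hle)
          (h ▸ hx ▸ freeze_le_of_mem hS hΦ x hy)
      refine h1 x y hy (ih (by omega) y ((hmono y x).injective heq).symm) ?_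
      rw [heq, ← h, hx]

theorem freeze_eq_or (hS : S.Finite) (hΦ : ∀ y t x, t ≤ Φ y t x)
    (hmono : ∀ y x, StrictMono fun t => Φ y t x) (x : E) :
    freeze τ Φ S x = τ x ∨ ∃ y ∈ S, y ≠ x ∧ freeze τ Φ S x = Φ y (freeze τ Φ S y) x := by
  refine freeze_induction (P := fun x => freeze τ Φ S x = τ x ∨
    ∃ y ∈ S, y ≠ x ∧ freeze τ Φ S x = Φ y (freeze τ Φ S y) x) hS hΦ hmono
    (fun x h => Or.inl h) (fun x y hy hP h => ?_) x
  by_cases hyx : y = x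
  · exact hyx ▸ hP
  · exact Or.inr ⟨y, hy, hyx, h⟩

end Freeze

section Duality

variable {E : Type*} [AddCommGroup E] [Module ℝ E]

/-- The data `(τ', Φ')` describe the inverse of the shift in direction `e` given by `(τ, Φ)`. -/
structure IsDualShift (e : E) (τ : E → ℝ) (Φ : E → ℝ → E → ℝ) (τ' : E → ℝ)
    (Φ' : E → ℝ → E → ℝ) : Prop where
  le_base : ∀ s x, s ≤ τ x ↔ s ≤ τ' (x + s • e)
  base_le : ∀ s x, τ x ≤ s ↔ τ' (x + s • e) ≤ s
  le_step : ∀ y t s x, s ≤ Φ y t x ↔ s ≤ Φ' (y + t • e) t (x + s • e)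
  step_le : ∀ y t s x, Φ y t x ≤ s ↔ Φ' (y + t • e) t (x + s • e) ≤ s

theorem IsDualShift.symm {e : E} {τ τ' : E → ℝ} {Φ Φ' : E → ℝ → E → ℝ}
    (h : IsDualShift e τ Φ τ' Φ') : IsDualShift (-e) τ' Φ' τ Φ where
  le_base s x := by simpa using (h.le_base s (x + s • -e)).symm
  base_le s x := by simpa using (h.base_le s (x + s • -e)).symm
  le_step y t s x := by simpa using (h.le_step (y + t • -e) t s (x + s • -e)).symm
  step_le y t s x := by simpa using (h.step_le (y + t • -e) t s (x + s • -e)).symm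

theorem IsDualShift.freeze_image {e : E} {τ τ' : E → ℝ} {Φ Φ' : E → ℝ → E → ℝ}
    (h : IsDualShift e τ Φ τ' Φ') {S : Set E} (hS : S.Finite)
    (hΦ : ∀ y t x, t ≤ Φ y t x) (hmono : ∀ y x, StrictMono fun t => Φ y t x)
    (hΦ' : ∀ y t x, t ≤ Φ' y t x) (hmono' : ∀ y x, StrictMono fun t => Φ' y t x)
    {x : E} (hx : x ∈ S) :
    freeze τ' Φ' ((fun x => x + freeze τ Φ S x • e) '' S) (x + freeze τ Φ S x • e) =
      freeze τ Φ S x := by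
  set T : E → E := fun x => x + freeze τ Φ S x • e with hT
  have hTS : (T '' S).Finite := hS.image T
  have hlow : ∀ m, ∀ x ∈ S, freeze τ Φ S x ≤ relax τ' Φ' (T '' S) m (T x) := by
    intro m
    induction m with
    | zero => exact fun x hx => (h.le_base _ x).1 (freeze_le hS x)
    | succ m ih =>
      intro x hx
      rcases relax_succ_eq (τ := τ') (Φ := Φ') hTS m (T x) with h1 | ⟨_, ⟨y, hy, rfl⟩, h1⟩
      · exact h1 ▸ ih x hx
      · rw [h1]
        exact ((h.le_step y _ _ x).1 (freeze_le_of_mem hS hΦ x hy)).trans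
          ((hmono' _ _).monotone (ih y hy))
  refine le_antisymm ?_ (hlow _ x hx)
  refine freeze_induction (τ := τ) (Φ := Φ) (S := S)
    (P := fun x => freeze τ' Φ' (T '' S) (T x) ≤ freeze τ Φ S x)
    hS hΦ hmono (fun x hx => ?_) (fun x y hy hP hx => ?_) x
  · exact (freeze_le hTS _).trans ((h.base_le _ x).1 hx.ge)
  · exact ((freeze_le_of_mem hTS hΦ' _ (mem_image_of_mem T hy)).trans
      ((hmono' _ _).monotone hP)).trans ((h.step_le y _ _ x).1 hx.ge)

end Duality

section Root

/-- A fixed point of `f`, the only one if `f` is a contraction. -/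
def fixPt (f : ℝ → ℝ) : ℝ := sSup {s | s ≤ f s}

theorem exists_fixPt {f : ℝ → ℝ} {ρ : ℝ} (hρ : ρ < 1)
    (hf : ∀ s s', |f s - f s'| ≤ ρ * |s - s'|) : f (fixPt f) = fixPt f := by
  have hρ0 : 0 ≤ ρ := by simpa using (abs_nonneg _).trans (hf 1 0)
  have hc : ContractingWith ⟨ρ, hρ0⟩ f :=
    ⟨by exact_mod_cast hρ, LipschitzWith.of_dist_le_mul fun x y => by
      rw [Real.dist_eq, Real.dist_eq]; exact hf x y⟩
  obtain ⟨r, hr⟩ : ∃ r, f r = r := ⟨_, hc.fixedPoint_isFixedPt⟩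
  have : {s | s ≤ f s} = Iic r := by
    ext s
    simp only [mem_ofPred_eq, mem_Iic]
    have h1 := abs_le.1 (hf s r)
    constructor <;> intro h <;> by_contra! hlt
    · rw [abs_of_pos (by linarith)] at h1
      nlinarith
    · rw [abs_of_nonpos (by linarith)] at h1
      nlinarith
  rw [fixPt, this, csSup_Iic, hr]

theorem le_fixPt_iff {f : ℝ → ℝ} {ρ : ℝ} (hρ : ρ < 1)
    (hf : ∀ s s', |f s - f s'| ≤ ρ * |s - s'|) (s : ℝ) : s ≤ fixPt f ↔ s ≤ f s := by
  have hr := exists_fixPt hρ hf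
  have h1 := abs_le.1 (hf s (fixPt f))
  constructor <;> intro h <;> by_contra! hlt
  · rw [abs_of_nonpos (by linarith)] at h1
    nlinarith
  · rw [abs_of_pos (by linarith)] at h1
    nlinarith

theorem fixPt_le_iff {f : ℝ → ℝ} {ρ : ℝ} (hρ : ρ < 1)
    (hf : ∀ s s', |f s - f s'| ≤ ρ * |s - s'|) (s : ℝ) : fixPt f ≤ s ↔ f s ≤ s := by
  have hr := exists_fixPt hρ hf
  have h1 := abs_le.1 (hf s (fixPt f))
  constructor <;> intro h <;> by_contra! hlt
  · rw [abs_of_nonneg (by linarith)] at h1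
    nlinarith
  · rw [abs_of_neg (by linarith)] at h1
    nlinarith

theorem measurable_fixPt {α : Type*} [MeasurableSpace α] {f : α → ℝ → ℝ} {ρ : ℝ} (hρ : ρ < 1)
    (hf : ∀ a s s', |f a s - f a s'| ≤ ρ * |s - s'|) (hm : ∀ s, Measurable fun a => f a s) :
    Measurable fun a => fixPt (f a) := by
  refine measurable_of_Iic fun s => ?_
  have : (fun a => fixPt (f a)) ⁻¹' Iic s = {a | f a s ≤ s} := by
    ext a
    exact fixPt_le_iff hρ (hf a) s
  rw [this]
  exact measurableSet_le (hm s) measurable_const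

end Root

end HardDisk

end

noncomputable section

namespace HardDisk

open ProbabilityTheory

theorem measurable_count {B : Set Plane} (hB : MeasurableSet B) : Measurable (Config.count B) := by
  refine Measurable.mono (comap_measurable _) ?_ le_rfl
  exact le_iSup₂_of_le B hB le_rfl

theorem measurable_config_of_count {α : Type*} [MeasurableSpace α] {f : α → Config}
    (h : ∀ B, MeasurableSet B → Measurable fun a => (f a).count B) : Measurable f := by
  rw [measurable_iff_comap_le]
  simp only [instMeasurableSpaceConfig, MeasurableSpace.comap_iSup, MeasurableSpace.comap_comp]
  exact iSup₂_le fun B hB => (h B hB).comap_le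

theorem measurable_of_toENNReal {α : Type*} [MeasurableSpace α] {f : α → ℕ∞}
    (h : Measurable fun a => ((f a : ℕ∞) : ℝ≥0∞)) : Measurable f := by
  rw [ENat.measurable_iff]
  intro n
  have : f ⁻¹' {(n : ℕ∞)} = (fun a => ((f a : ℕ∞) : ℝ≥0∞)) ⁻¹' {(n : ℝ≥0∞)} := by
    ext a
    simp only [mem_preimage, mem_singleton_iff]
    rw [← ENat.toENNReal_coe, ENat.toENNReal_inj]
  rw [this]
  exact h (measurableSet_singleton _)

theorem box_eq (r : ℝ) : box r = ⋂ i, {x : Plane | |x i| ≤ r} := by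
  ext x
  simp only [box, mem_iInter]
  rfl

theorem measurableSet_box (r : ℝ) : MeasurableSet (box r) := by
  rw [box_eq]
  exact MeasurableSet.iInter fun i => measurableSet_le (by fun_prop) measurable_const

theorem abs_apply_le_norm (x : Plane) (i : Fin 2) : |x i| ≤ ‖x‖ := by
  simpa using PiLp.norm_apply_le x i

theorem norm_sq_eq (x : Plane) : ‖x‖ ^ 2 = x 0 ^ 2 + x 1 ^ 2 := by
  rw [EuclideanSpace.norm_sq_eq]
  simp

theorem norm_le_of_mem_box {r : ℝ} {x : Plane} (hx : x ∈ box r) : ‖x‖ ≤ Real.sqrt 2 * r := by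
  have hr : 0 ≤ r := (abs_nonneg _).trans (hx 0)
  have h0 : x 0 ^ 2 ≤ r ^ 2 := sq_le_sq' (abs_le.1 (hx 0)).1 (abs_le.1 (hx 0)).2
  have h1 : x 1 ^ 2 ≤ r ^ 2 := sq_le_sq' (abs_le.1 (hx 1)).1 (abs_le.1 (hx 1)).2
  refine le_of_sq_le_sq ?_ (by positivity)
  rw [norm_sq_eq, mul_pow, Real.sq_sqrt (by norm_num)]
  linarith

theorem mem_box_of_norm_le {r : ℝ} {x : Plane} (hx : ‖x‖ ≤ r) : x ∈ box r :=
  fun i => (abs_apply_le_norm x i).trans hx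

theorem isBounded_box (r : ℝ) : Bornology.IsBounded (box r) :=
  isBounded_iff_forall_norm_le.2 ⟨_, fun _ hx => norm_le_of_mem_box hx⟩

theorem iUnion_box : ⋃ n : ℕ, box n = univ := by
  refine eq_univ_of_forall fun x => ?_
  obtain ⟨n, hn⟩ := exists_nat_ge ‖x‖
  exact mem_iUnion.2 ⟨n, mem_box_of_norm_le hn⟩

theorem Config.countable (X : Config) : X.carrier.Countable := by
  have : X.carrier = ⋃ n : ℕ, X.carrier ∩ box n := by
    rw [← inter_iUnion, iUnion_box, inter_univ]
  rw [this]
  exact countable_iUnion fun n => (X.finite_inter _ (isBounded_box n)).countable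

theorem Config.measurableSet (X : Config) : MeasurableSet X.carrier := X.countable.measurableSet

/-- The counting measure on the points of a configuration, as a kernel. -/
def pts : Kernel Config Plane where
  toFun X := Measure.count.restrict X.carrier
  measurable' := by
    refine Measure.measurable_of_measurable_coe _ fun B hB => ?_
    have : (fun X : Config => (Measure.count.restrict X.carrier) B) =
        fun X => ((X.count B : ℕ∞) : ℝ≥0∞) := by
      ext X
      rw [Measure.restrict_apply hB, Measure.count_apply (hB.inter X.measurableSet), inter_comm]
      rfl
    rw [this]
    exact measurable_from_top.comp (measurable_count hB)

theorem pts_apply (X : Config) : pts X = Measure.count.restrict X.carrier := rfl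

theorem pts_apply_apply (X : Config) {B : Set Plane} (hB : MeasurableSet B) :
    pts X B = ((X.count B : ℕ∞) : ℝ≥0∞) := by
  rw [pts_apply, Measure.restrict_apply hB, Measure.count_apply (hB.inter X.measurableSet),
    inter_comm]
  rfl

theorem isSFiniteKernel_pts_restrict {B : Set Plane} (hB : MeasurableSet B)
    (hb : Bornology.IsBounded B) : IsSFiniteKernel (pts.restrict hB) := by
  classical
  have hm : ∀ k : ℕ, MeasurableSet {X : Config | X.count B = k} := fun k =>
    measurable_count hB (measurableSet_singleton (k : ℕ∞))
  have hfin : ∀ k : ℕ, IsFiniteKernel (Kernel.piecewise (hm k) (pts.restrict hB) 0) := by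
    refine fun k => ⟨⟨k, by simp, fun X => ?_⟩⟩
    rw [Kernel.piecewise_apply]
    split_ifs with h
    · rw [Kernel.restrict_apply, Measure.restrict_apply_univ, pts_apply_apply X hB]
      rw [show X.count B = k from h]
      simp
    · simp
  have hsum : pts.restrict hB =
      Kernel.sum fun k : ℕ => Kernel.piecewise (hm k) (pts.restrict hB) 0 := by
    ext X A hA
    rw [Kernel.sum_apply' _ _ hA]
    obtain ⟨k, hk⟩ : ∃ k : ℕ, X.count B = k :=
      ⟨_, ((X.finite_inter B hb).cast_ncard_eq).symm⟩
    rw [tsum_eq_single k]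
    · rw [Kernel.piecewise_apply, if_pos (show X ∈ {X : Config | X.count B = k} from hk)]
    · intro j hj
      rw [Kernel.piecewise_apply, if_neg]
      · simp
      · intro h
        exact hj (by exact_mod_cast h.symm.trans hk)
  rw [hsum]
  infer_instance

instance : IsSFiniteKernel pts := by
  have hm : ∀ j : ℕ, MeasurableSet (disjointed (fun j : ℕ => box j) j) :=
    fun j => MeasurableSet.disjointed (fun j => measurableSet_box j) j
  have hsum : pts = Kernel.sum fun j : ℕ => pts.restrict (hm j) := by
    ext X A hA
    rw [Kernel.sum_apply]
    simp only [Kernel.restrict_apply]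
    rw [← Measure.restrict_iUnion (disjoint_disjointed _) hm, iUnion_disjointed, iUnion_box,
      Measure.restrict_univ]
  have hs : ∀ j, IsSFiniteKernel (pts.restrict (hm j)) := fun j =>
    isSFiniteKernel_pts_restrict (hm j) ((isBounded_box j).subset (disjointed_subset _ _))
  rw [hsum]
  infer_instance

section

variable {α : Type*} [MeasurableSpace α]

theorem measurableSet_exists_mem {X : α → Config} (hX : Measurable X) {P : α → Plane → Prop}
    (hP : MeasurableSet {p : α × Plane | P p.1 p.2}) :
    MeasurableSet {a | ∃ y ∈ (X a).carrier, P a y} := by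
  have h := Kernel.measurable_kernel_prodMk_left (κ := pts.comap X hX) hP
  have : {a | ∃ y ∈ (X a).carrier, P a y} =
      {a | (pts.comap X hX a) (Prod.mk a ⁻¹' {p : α × Plane | P p.1 p.2}) = 0}ᶜ := by
    ext a
    have hm : MeasurableSet (Prod.mk a ⁻¹' {p : α × Plane | P p.1 p.2}) := measurable_prodMk_left hP
    rw [mem_compl_iff]
    change _ ↔ ¬ ((pts.comap X hX a) _ = 0)
    rw [Kernel.comap_apply, pts_apply_apply _ hm, ENat.toENNReal_eq_zero, Config.count,
      encard_eq_zero, ← ne_eq, ← nonempty_iff_ne_empty]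
    rfl
  rw [this]
  exact (h (measurableSet_singleton 0)).compl

theorem measurableSet_forall_mem {X : α → Config} (hX : Measurable X) {P : α → Plane → Prop}
    (hP : MeasurableSet {p : α × Plane | P p.1 p.2}) :
    MeasurableSet {a | ∀ y ∈ (X a).carrier, P a y} := by
  have : {a | ∀ y ∈ (X a).carrier, P a y} = {a | ∃ y ∈ (X a).carrier, ¬ P a y}ᶜ := by
    ext a
    simp only [mem_compl_iff, mem_ofPred_eq]
    push Not
    rfl
  rw [this]
  exact (measurableSet_exists_mem hX hP.compl).compl

theorem measurableSet_mem : MeasurableSet {p : Config × Plane | p.2 ∈ p.1.carrier} := by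
  have : {p : Config × Plane | p.2 ∈ p.1.carrier} = {p | ∃ y ∈ p.1.carrier, y = p.2} := by
    ext p
    simp
  rw [this]
  exact measurableSet_exists_mem measurable_fst
    (measurableSet_eq_fun measurable_snd (measurable_snd.comp measurable_fst))

theorem measurableSet_hardCore : MeasurableSet hardCore := by
  refine measurableSet_forall_mem measurable_id (P := fun X x => ∀ y ∈ X.carrier, x ≠ y → 1 < dist x y) ?_
  refine measurableSet_forall_mem (X := fun p : Config × Plane => p.1) measurable_fst
    (P := fun p y => p.2 ≠ y → 1 < dist p.2 y) ?_
  have h1 : Measurable fun p : (Config × Plane) × Plane => p.1.2 := measurable_snd.comp measurable_fst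
  have h2 : MeasurableSet {p : (Config × Plane) × Plane | p.1.2 = p.2} :=
    measurableSet_eq_fun h1 measurable_snd
  have h3 : MeasurableSet {p : (Config × Plane) × Plane | 1 < dist p.1.2 p.2} :=
    measurableSet_lt measurable_const (h1.dist measurable_snd)
  convert h2.union h3 using 1
  ext p
  simp only [mem_ofPred_eq, mem_union, ne_eq, Classical.or_iff_not_imp_left]

/-- The configuration `X` with the point `p` added. -/
def Config.cons (X : Config) (p : Plane) : Config where
  carrier := insert p X.carrier
  finite_inter Λ h := ((X.finite_inter Λ h).insert p).subset fun x hx => by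
    rcases hx.1 with rfl | h'
    · exact mem_insert _ _
    · exact mem_insert_of_mem _ ⟨h', hx.2⟩

theorem measurable_cons : Measurable fun p : Config × Plane => p.1.cons p.2 := by
  classical
  refine measurable_config_of_count fun B hB => ?_
  have : (fun p : Config × Plane => (p.1.cons p.2).count B) =
      fun p => p.1.count B + if p.2 ∈ B ∧ p.2 ∉ p.1.carrier then 1 else 0 := by
    ext ⟨X, p⟩
    simp only [Config.count, Config.cons]
    split_ifs with h
    · rw [insert_inter_of_mem h.1, encard_insert_of_notMem fun h' => h.2 h'.1]
    · rw [add_zero]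
      congr 1
      ext x
      simp only [mem_inter_iff, mem_insert_iff]
      constructor
      · rintro ⟨rfl | hx, hxB⟩
        · exact ⟨by_contra fun hn => h ⟨hxB, hn⟩, hxB⟩
        · exact ⟨hx, hxB⟩
      · exact fun hx => ⟨Or.inr hx.1, hx.2⟩
  rw [this]
  exact ((measurable_count hB).comp measurable_fst).add
    (Measurable.ite ((measurable_snd hB).inter measurableSet_mem.compl)
      measurable_const measurable_const)

theorem measurable_glue (Λ : Set Plane) (Y : Config) (k : ℕ) :
    Measurable (Config.glue Λ Y (k := k)) := by
  induction k with
  | zero =>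
    have : Config.glue Λ Y (k := 0) = fun _ => Config.glue Λ Y Fin.elim0 := by
      ext x
      rw [Subsingleton.elim x Fin.elim0]
    rw [this]
    exact measurable_const
  | succ k ih =>
    have : Config.glue Λ Y (k := k + 1) =
        fun x => (Config.glue Λ Y (Fin.tail x)).cons (x 0) := by
      ext x p
      simp only [Config.glue, Config.cons, mem_union, mem_insert_iff, mem_range, Fin.exists_fin_succ,
        Fin.tail, eq_comm (a := p)]
      tauto
    rw [this]
    have h1 : Measurable fun x : Fin (k + 1) → Plane => Fin.tail x :=
      measurable_pi_lambda _ fun i => measurable_pi_apply _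
    exact measurable_cons.comp ((ih.comp h1).prodMk (measurable_pi_apply 0))

theorem measurable_ncard_inter {B : Set Plane} (hB : MeasurableSet B) :
    Measurable fun X : Config => (X.carrier ∩ B).ncard :=
  (measurable_from_top (f := ENat.toNat)).comp (measurable_count hB)

theorem measurable_relax {Λ : Set Plane} (hΛ : MeasurableSet Λ) (hb : Bornology.IsBounded Λ)
    {τ : Plane → ℝ} {Φ : Plane → ℝ → Plane → ℝ} (hτ : Measurable τ)
    (hΦ : Measurable fun p : Plane × ℝ × Plane => Φ p.1 p.2.1 p.2.2) (m : ℕ) :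
    Measurable fun p : Config × Plane => relax τ Φ (p.1.carrier ∩ Λ) m p.2 := by
  induction m with
  | zero => exact hτ.comp measurable_snd
  | succ m ih =>
    refine measurable_of_Iio fun q => ?_
    have : (fun p : Config × Plane => relax τ Φ (p.1.carrier ∩ Λ) (m + 1) p.2) ⁻¹' Iio q =
        {p | relax τ Φ (p.1.carrier ∩ Λ) m p.2 < q} ∪
          {p | ∃ y ∈ p.1.carrier, y ∈ Λ ∧
            Φ y (relax τ Φ (p.1.carrier ∩ Λ) m y) p.2 < q} := by
      ext p
      simp only [mem_preimage, mem_Iio, relax_succ_lt_iff (p.1.finite_inter Λ hb), mem_union,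
        mem_ofPred_eq, mem_inter_iff, and_assoc]
    rw [this]
    refine (measurableSet_lt ih measurable_const).union ?_
    refine measurableSet_exists_mem measurable_fst (P := fun p y => y ∈ Λ ∧
      Φ y (relax τ Φ (p.1.carrier ∩ Λ) m y) p.2 < q) ((measurable_snd hΛ).inter ?_)
    refine measurableSet_lt (hΦ.comp (measurable_snd.prodMk (Measurable.prodMk ?_
      (measurable_snd.comp measurable_fst)))) measurable_const
    exact ih.comp ((measurable_fst.comp measurable_fst).prodMk measurable_snd)

theorem measurable_freeze {Λ : Set Plane} (hΛ : MeasurableSet Λ) (hb : Bornology.IsBounded Λ)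
    {τ : Plane → ℝ} {Φ : Plane → ℝ → Plane → ℝ} (hτ : Measurable τ)
    (hΦ : Measurable fun p : Plane × ℝ × Plane => Φ p.1 p.2.1 p.2.2) :
    Measurable fun p : Config × Plane => freeze τ Φ (p.1.carrier ∩ Λ) p.2 := by
  have h : Measurable fun q : ℕ × (Config × Plane) =>
      relax τ Φ (q.2.1.carrier ∩ Λ) q.1 q.2.2 :=
    measurable_from_prod_countable_right fun m => measurable_relax hΛ hb hτ hΦ m
  exact h.comp (((measurable_ncard_inter hΛ).comp measurable_fst).prodMk measurable_id)

end

end HardDisk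

end

noncomputable section

namespace HardDisk

open ProbabilityTheory

section Shift

variable (Λ : Set Plane) (τ : Plane → ℝ) (Φ : Plane → ℝ → Plane → ℝ) (e : Plane)

/-- The amount by which the point `x` of the configuration `X` is shifted. -/
def shiftTime (X : Config) (x : Plane) : ℝ := Λ.indicator (freeze τ Φ (X.carrier ∩ Λ)) x

/-- The position of the point `x` of the configuration `X` after the shift in direction `e`. -/
def shiftPoint (X : Config) (x : Plane) : Plane := x + shiftTime Λ τ Φ X x • e

theorem shiftTime_of_notMem (X : Config) {x : Plane} (hx : x ∉ Λ) : shiftTime Λ τ Φ X x = 0 :=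
  indicator_of_notMem hx _

theorem shiftTime_of_mem (X : Config) {x : Plane} (hx : x ∈ Λ) :
    shiftTime Λ τ Φ X x = freeze τ Φ (X.carrier ∩ Λ) x :=
  indicator_of_mem hx _

theorem shiftPoint_of_notMem (X : Config) {x : Plane} (hx : x ∉ Λ) :
    shiftPoint Λ τ Φ e X x = x := by
  rw [shiftPoint, shiftTime_of_notMem _ _ _ _ hx, zero_smul, add_zero]

/-- Particles in the bounded set `Λ` are shifted in direction `e`. -/
def shift (hb : Bornology.IsBounded Λ) (X : Config) : Config where
  carrier := shiftPoint Λ τ Φ e X '' X.carrier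
  finite_inter Λ' h := by
    refine (((X.finite_inter Λ hb).image (shiftPoint Λ τ Φ e X)).union
      (X.finite_inter Λ' h)).subset ?_
    rintro _ ⟨⟨x, hx, rfl⟩, hx'⟩
    by_cases hxΛ : x ∈ Λ
    · exact Or.inl ⟨x, ⟨hx, hxΛ⟩, rfl⟩
    · rw [shiftPoint_of_notMem _ _ _ _ _ hxΛ] at hx' ⊢
      exact Or.inr ⟨hx, hx'⟩

/-- Conditions on the data `(τ, Φ)` of a shift of the particles in `Λ` in direction `e`. -/
structure IsShift : Prop where
  le_step : ∀ y t x, t ≤ Φ y t x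
  strictMono : ∀ y x, StrictMono fun t => Φ y t x
  nonneg : ∀ x, 0 ≤ τ x
  stay : ∀ x ∈ Λ, ∀ s, 0 ≤ s → s ≤ τ x → x + s • e ∈ Λ
  measurable_base : Measurable τ
  measurable_step : Measurable fun p : Plane × ℝ × Plane => Φ p.1 p.2.1 p.2.2

end Shift

section Shift

variable {Λ : Set Plane} {τ : Plane → ℝ} {Φ : Plane → ℝ → Plane → ℝ} {e : Plane}

theorem IsShift.shiftTime_nonneg (h : IsShift Λ τ Φ e) (hb : Bornology.IsBounded Λ)
    (X : Config) (x : Plane) : 0 ≤ shiftTime Λ τ Φ X x :=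
  indicator_nonneg (fun x _ => le_relax_of_le (X.finite_inter Λ hb) h.le_step h.nonneg _ x) x

theorem shiftTime_le (hτ : ∀ x, 0 ≤ τ x) (hb : Bornology.IsBounded Λ) (X : Config) (x : Plane) :
    shiftTime Λ τ Φ X x ≤ τ x :=
  indicator_apply_le' (fun _ => freeze_le (X.finite_inter Λ hb) x) fun _ => hτ x

theorem IsShift.shiftPoint_mem (h : IsShift Λ τ Φ e) (hb : Bornology.IsBounded Λ) (X : Config)
    {x : Plane} (hx : x ∈ Λ) : shiftPoint Λ τ Φ e X x ∈ Λ :=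
  h.stay x hx _ (h.shiftTime_nonneg hb X x) (shiftTime_le h.nonneg hb X x)

theorem IsShift.shiftPoint_mem_iff (h : IsShift Λ τ Φ e) (hb : Bornology.IsBounded Λ) (X : Config)
    {x : Plane} : shiftPoint Λ τ Φ e X x ∈ Λ ↔ x ∈ Λ := by
  refine ⟨fun hx => ?_, h.shiftPoint_mem hb X⟩
  by_contra hn
  rw [shiftPoint_of_notMem _ _ _ _ _ hn] at hx
  exact hn hx

theorem IsShift.shift_inter (h : IsShift Λ τ Φ e) (hb : Bornology.IsBounded Λ) (X : Config) :
    (shift Λ τ Φ e hb X).carrier ∩ Λ =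
      (fun x => x + freeze τ Φ (X.carrier ∩ Λ) x • e) '' (X.carrier ∩ Λ) := by
  have h1 : EqOn (fun x => x + freeze τ Φ (X.carrier ∩ Λ) x • e) (shiftPoint Λ τ Φ e X)
      (X.carrier ∩ Λ) := fun x hx => by
    simp only [shiftPoint, shiftTime_of_mem _ _ _ _ hx.2]
  rw [h1.image_eq]
  ext y
  constructor
  · rintro ⟨⟨x, hx, rfl⟩, hy⟩
    exact ⟨x, ⟨hx, (h.shiftPoint_mem_iff hb X).1 hy⟩, rfl⟩
  · rintro ⟨x, hx, rfl⟩
    exact ⟨⟨x, hx.1, rfl⟩, h.shiftPoint_mem hb X hx.2⟩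

variable {τ' : Plane → ℝ} {Φ' : Plane → ℝ → Plane → ℝ} {e' : Plane}

theorem IsDualShift.shiftTime_shift (hd : IsDualShift e τ Φ τ' Φ') (h : IsShift Λ τ Φ e)
    (h' : IsShift Λ τ' Φ' e') (hb : Bornology.IsBounded Λ) {X : Config} {x : Plane}
    (hx : x ∈ X.carrier) :
    shiftTime Λ τ' Φ' (shift Λ τ Φ e hb X) (shiftPoint Λ τ Φ e X x) = shiftTime Λ τ Φ X x := by
  by_cases hxΛ : x ∈ Λ
  · rw [shiftTime_of_mem _ _ _ _ (h.shiftPoint_mem hb X hxΛ), h.shift_inter hb, shiftPoint,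
      shiftTime_of_mem _ _ _ _ hxΛ]
    exact hd.freeze_image (X.finite_inter Λ hb) h.le_step h.strictMono h'.le_step h'.strictMono
      ⟨hx, hxΛ⟩
  · rw [shiftPoint_of_notMem _ _ _ _ _ hxΛ, shiftTime_of_notMem _ _ _ _ hxΛ,
      shiftTime_of_notMem _ _ _ _ hxΛ]

theorem IsDualShift.shiftPoint_shift (hd : IsDualShift e τ Φ τ' Φ') (h : IsShift Λ τ Φ e)
    (h' : IsShift Λ τ' Φ' (-e)) (hb : Bornology.IsBounded Λ) {X : Config} {x : Plane}
    (hx : x ∈ X.carrier) :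
    shiftPoint Λ τ' Φ' (-e) (shift Λ τ Φ e hb X) (shiftPoint Λ τ Φ e X x) = x := by
  rw [shiftPoint, hd.shiftTime_shift h h' hb hx, shiftPoint, smul_neg, add_neg_cancel_right]

theorem IsDualShift.injOn (hd : IsDualShift e τ Φ τ' Φ') (h : IsShift Λ τ Φ e)
    (h' : IsShift Λ τ' Φ' (-e)) (hb : Bornology.IsBounded Λ) (X : Config) :
    InjOn (shiftPoint Λ τ Φ e X) X.carrier :=
  LeftInvOn.injOn (f₁' := shiftPoint Λ τ' Φ' (-e) (shift Λ τ Φ e hb X))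
    fun _ hx => hd.shiftPoint_shift h h' hb hx

theorem IsDualShift.shift_shift (hd : IsDualShift e τ Φ τ' Φ') (h : IsShift Λ τ Φ e)
    (h' : IsShift Λ τ' Φ' (-e)) (hb : Bornology.IsBounded Λ) (X : Config) :
    shift Λ τ' Φ' (-e) hb (shift Λ τ Φ e hb X) = X := by
  ext1
  change shiftPoint Λ τ' Φ' (-e) (shift Λ τ Φ e hb X) '' (shiftPoint Λ τ Φ e X '' X.carrier) = _
  have hl : LeftInvOn (shiftPoint Λ τ' Φ' (-e) (shift Λ τ Φ e hb X)) (shiftPoint Λ τ Φ e X)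
    X.carrier := fun _ hx => hd.shiftPoint_shift h h' hb hx
  exact hl.image_image

theorem IsDualShift.bijective_shift (hd : IsDualShift e τ Φ τ' Φ') (h : IsShift Λ τ Φ e)
    (h' : IsShift Λ τ' Φ' (-e)) (hb : Bornology.IsBounded Λ) :
    Function.Bijective (shift Λ τ Φ e hb) := by
  refine Function.bijective_iff_has_inverse.2
    ⟨shift Λ τ' Φ' (-e) hb, fun X => hd.shift_shift h h' hb X, fun X => ?_⟩
  have h2 : IsShift Λ τ Φ (- -e) := by rwa [neg_neg]
  have := hd.symm.shift_shift h' h2 hb X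
  rwa [neg_neg] at this

theorem IsShift.measurable_shiftTime (h : IsShift Λ τ Φ e) (hΛ : MeasurableSet Λ)
    (hb : Bornology.IsBounded Λ) :
    Measurable fun p : Config × Plane => shiftTime Λ τ Φ p.1 p.2 := by
  have h1 := (measurable_freeze hΛ hb h.measurable_base h.measurable_step).indicator
    (measurable_snd hΛ)
  convert h1 using 1
  ext p
  simp only [shiftTime, indicator]
  rfl

theorem IsShift.measurable_shiftPoint (h : IsShift Λ τ Φ e) (hΛ : MeasurableSet Λ)
    (hb : Bornology.IsBounded Λ) :
    Measurable fun p : Config × Plane => shiftPoint Λ τ Φ e p.1 p.2 :=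
  measurable_snd.add ((h.measurable_shiftTime hΛ hb).smul_const e)

theorem IsDualShift.measurable_shift (hd : IsDualShift e τ Φ τ' Φ') (h : IsShift Λ τ Φ e)
    (h' : IsShift Λ τ' Φ' (-e)) (hΛ : MeasurableSet Λ) (hb : Bornology.IsBounded Λ) :
    Measurable (shift Λ τ Φ e hb) := by
  refine measurable_config_of_count fun B hB => measurable_of_toENNReal ?_
  have hm := h.measurable_shiftPoint hΛ hb
  have h1 := Kernel.measurable_kernel_prodMk_left (κ := pts) (hm hB)
  convert h1 using 1
  ext X
  have hX : MeasurableSet (Prod.mk X ⁻¹' ((fun p : Config × Plane =>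
    shiftPoint Λ τ Φ e p.1 p.2) ⁻¹' B)) := measurable_prodMk_left (hm hB)
  rw [pts_apply_apply _ hX, Config.count, Config.count]
  congr 1
  have : (shift Λ τ Φ e hb X).carrier ∩ B =
      shiftPoint Λ τ Φ e X '' (X.carrier ∩ shiftPoint Λ τ Φ e X ⁻¹' B) := by
    rw [image_inter_preimage]
    rfl
  rw [this, ((hd.injOn h h' hb X).mono inter_subset_left).encard_image]
  rfl

end Shift

/-- A base profile `τ` for the shift of particles in `Λ` together with the slack `F y x` that a
particle at `x` gains over a particle at `y`. -/
structure Profile (Λ : Set Plane) where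
  τ : Plane → ℝ
  F : Plane → Plane → ℝ
  ρ : ℝ
  ρ_le : ρ ≤ 1 / 2
  τ_nonneg : ∀ x, 0 ≤ τ x
  τ_lip : ∀ x x', |τ x - τ x'| ≤ ρ * dist x x'
  τ_off : ∀ x ∉ Λ, τ x = 0
  τ_le_F : ∀ y ∉ Λ, ∀ x, τ x ≤ F y x
  F_nonneg : ∀ y x, 0 ≤ F y x
  F_pos : ∀ y x, 1 < dist y x → 0 < F y x
  F_eq_zero : ∀ y x, dist y x ≤ 1 → F y x = 0
  F_le : ∀ y x, 1 ≤ dist y x → F y x ≤ ρ * (dist y x - 1)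
  F_lip : ∀ y x y' x', |F y x - F y' x'| ≤ ρ * (dist y y' + dist x x')
  stay : ∀ e : Plane, ‖e‖ = 1 → ∀ x ∈ Λ, ∀ s, 0 ≤ s → s ≤ τ x → x + s • e ∈ Λ
  bounded : Bornology.IsBounded Λ
  measurableSet : MeasurableSet Λ

namespace Profile

variable {Λ : Set Plane} (P : Profile Λ)

/-- The relaxation step of a profile. -/
def step (y : Plane) (t : ℝ) (x : Plane) : ℝ := t + P.F y x

/-- The base profile of the inverse shift. -/
def dualBase (e x : Plane) : ℝ := fixPt fun s => P.τ (x - s • e)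

/-- The relaxation step of the inverse shift. -/
def dualStep (e y : Plane) (t : ℝ) (x : Plane) : ℝ :=
  fixPt fun s => t + P.F (y - t • e) (x - s • e)

theorem ρ_nonneg : 0 ≤ P.ρ := by
  have h := (abs_nonneg _).trans (P.τ_lip 0 e₁)
  have : dist (0 : Plane) e₁ = 1 := by simp [e₁]
  rwa [this, mul_one] at h

theorem ρ_lt_one : P.ρ < 1 := lt_of_le_of_lt P.ρ_le (by norm_num)

theorem continuous_τ : Continuous P.τ :=
  (LipschitzWith.of_dist_le_mul (K := ⟨P.ρ, P.ρ_nonneg⟩) fun x y => by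
    rw [Real.dist_eq]; exact P.τ_lip x y).continuous

theorem continuous_F : Continuous fun p : Plane × Plane => P.F p.1 p.2 := by
  refine (LipschitzWith.of_dist_le_mul (K := ⟨P.ρ * 2, by have := P.ρ_nonneg; positivity⟩)
    fun p q => ?_).continuous
  rw [Real.dist_eq]
  refine (P.F_lip _ _ _ _).trans ?_
  change _ ≤ P.ρ * 2 * dist p q
  rw [mul_assoc]
  refine mul_le_mul_of_nonneg_left ?_ P.ρ_nonneg
  rw [Prod.dist_eq]
  linarith [le_max_left (dist p.1 q.1) (dist p.2 q.2), le_max_right (dist p.1 q.1) (dist p.2 q.2)]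

theorem isShift {e : Plane} (he : ‖e‖ = 1) : IsShift Λ P.τ P.step e where
  le_step y t x := le_add_of_nonneg_right (P.F_nonneg y x)
  strictMono y x := fun _ _ h => by simpa [step] using h
  nonneg := P.τ_nonneg
  stay := P.stay e he
  measurable_base := P.continuous_τ.measurable
  measurable_step := (measurable_fst.comp measurable_snd).add
    (P.continuous_F.measurable.comp (measurable_fst.prodMk (measurable_snd.comp measurable_snd)))

theorem dist_line {e : Plane} (he : ‖e‖ = 1) (x : Plane) (s s' : ℝ) :
    dist (x - s • e) (x - s' • e) = |s - s'| := by
  rw [dist_sub_left, dist_eq_norm, ← sub_smul, norm_smul, he, mul_one, Real.norm_eq_abs]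

theorem τ_line {e : Plane} (he : ‖e‖ = 1) (x : Plane) (s s' : ℝ) :
    |P.τ (x - s • e) - P.τ (x - s' • e)| ≤ P.ρ * |s - s'| := by
  rw [← dist_line he x s s']
  exact P.τ_lip _ _

theorem F_line {e : Plane} (he : ‖e‖ = 1) (y : Plane) (t : ℝ) (x : Plane) (s s' : ℝ) :
    |(t + P.F (y - t • e) (x - s • e)) - (t + P.F (y - t • e) (x - s' • e))| ≤
      P.ρ * |s - s'| := by
  have h := P.F_lip (y - t • e) (x - s • e) (y - t • e) (x - s' • e)
  rwa [dist_self, zero_add, dist_line he, ← add_sub_add_left_eq_sub _ _ t] at h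

theorem isDualShift {e : Plane} (he : ‖e‖ = 1) :
    IsDualShift e P.τ P.step (P.dualBase e) (P.dualStep e) where
  le_base s x := by
    rw [dualBase, le_fixPt_iff P.ρ_lt_one (P.τ_line he _), add_sub_cancel_right]
  base_le s x := by
    rw [dualBase, fixPt_le_iff P.ρ_lt_one (P.τ_line he _), add_sub_cancel_right]
  le_step y t s x := by
    rw [dualStep, le_fixPt_iff P.ρ_lt_one (P.F_line he _ t _), add_sub_cancel_right,
      add_sub_cancel_right, step]
  step_le y t s x := by
    rw [dualStep, fixPt_le_iff P.ρ_lt_one (P.F_line he _ t _), add_sub_cancel_right,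
      add_sub_cancel_right, step]

theorem isShift_dual {e : Plane} (he : ‖e‖ = 1) :
    IsShift Λ (P.dualBase e) (P.dualStep e) (-e) where
  le_step y t x := by
    rw [dualStep, le_fixPt_iff P.ρ_lt_one (P.F_line he _ t _)]
    exact le_add_of_nonneg_right (P.F_nonneg _ _)
  strictMono y x := by
    intro t t' htt'
    simp only [dualStep]
    rw [← not_le, fixPt_le_iff P.ρ_lt_one (P.F_line he _ t' _), not_le]
    have h0 := exists_fixPt P.ρ_lt_one (P.F_line he y t x)
    set r := fixPt fun s => t + P.F (y - t • e) (x - s • e)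
    have h1 := (abs_le.1 (P.F_lip (y - t • e) (x - r • e) (y - t' • e) (x - r • e))).2
    rw [dist_self, add_zero, dist_line he, abs_of_neg (by linarith)] at h1
    nlinarith [P.ρ_lt_one]
  nonneg x := by
    rw [dualBase, le_fixPt_iff P.ρ_lt_one (P.τ_line he _)]
    exact P.τ_nonneg _
  stay x hx s hs hs' := by
    rw [dualBase, le_fixPt_iff P.ρ_lt_one (P.τ_line he _)] at hs'
    rw [smul_neg, ← sub_eq_add_neg]
    by_contra hn
    rw [P.τ_off _ hn] at hs'
    rw [le_antisymm hs' hs, zero_smul, sub_zero] at hn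
    exact hn hx
  measurable_base := measurable_fixPt P.ρ_lt_one (fun x => P.τ_line he x) fun s =>
    P.continuous_τ.measurable.comp (measurable_id.sub_const _)
  measurable_step := by
    refine measurable_fixPt (f := fun (p : Plane × ℝ × Plane) s =>
      p.2.1 + P.F (p.1 - p.2.1 • e) (p.2.2 - s • e)) P.ρ_lt_one
      (fun p => P.F_line he p.1 p.2.1 p.2.2) fun s => ?_
    have : Continuous fun p : Plane × ℝ × Plane =>
        p.2.1 + P.F (p.1 - p.2.1 • e) (p.2.2 - s • e) := by
      have := P.continuous_F.comp (f := fun p : Plane × ℝ × Plane =>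
        (p.1 - p.2.1 • e, p.2.2 - s • e)) (by fun_prop)
      exact Continuous.add (by fun_prop) this
    exact this.measurable

/-- The shift time of the particle `x` of `X`. -/
abbrev time (X : Config) (x : Plane) : ℝ := shiftTime Λ P.τ P.step X x

/-- The shift of the particles in `Λ` in direction `e`. -/
abbrev move (e : Plane) : Config → Config := shift Λ P.τ P.step e P.bounded

/-- The inverse of `Profile.move`. -/
abbrev unmove (e : Plane) : Config → Config :=
  shift Λ (P.dualBase e) (P.dualStep e) (-e) P.bounded

theorem unmove_move {e : Plane} (he : ‖e‖ = 1) (X : Config) : P.unmove e (P.move e X) = X :=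
  (P.isDualShift he).shift_shift (P.isShift he) (P.isShift_dual he) P.bounded X

theorem bijective_move {e : Plane} (he : ‖e‖ = 1) : Function.Bijective (P.move e) :=
  (P.isDualShift he).bijective_shift (P.isShift he) (P.isShift_dual he) P.bounded

theorem measurable_move {e : Plane} (he : ‖e‖ = 1) : Measurable (P.move e) :=
  (P.isDualShift he).measurable_shift (P.isShift he) (P.isShift_dual he) P.measurableSet P.bounded

theorem measurable_unmove {e : Plane} (he : ‖e‖ = 1) : Measurable (P.unmove e) := by
  refine (P.isDualShift he).symm.measurable_shift (P.isShift_dual he) ?_ P.measurableSet P.bounded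
  rw [neg_neg]
  exact P.isShift he

theorem time_nonneg (X : Config) (x : Plane) : 0 ≤ P.time X x :=
  (P.isShift (e := e₁) (by simp [e₁])).shiftTime_nonneg P.bounded X x

theorem time_le (X : Config) (x : Plane) : P.time X x ≤ P.τ x :=
  shiftTime_le P.τ_nonneg P.bounded X x

theorem time_le_add (X : Config) (x : Plane) {y : Plane} (hy : y ∈ X.carrier) :
    P.time X x ≤ P.time X y + P.F y x := by
  by_cases hyΛ : y ∈ Λ
  · by_cases hx : x ∈ Λ
    · rw [time, time, shiftTime_of_mem _ _ _ _ hx, shiftTime_of_mem _ _ _ _ hyΛ]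
      exact freeze_le_of_mem (X.finite_inter Λ P.bounded)
        (P.isShift (e := e₁) (by simp [e₁])).le_step x ⟨hy, hyΛ⟩
    · rw [time, shiftTime_of_notMem _ _ _ _ hx]
      exact add_nonneg (P.time_nonneg X y) (P.F_nonneg y x)
  · rw [time, time, shiftTime_of_notMem _ _ _ _ hyΛ, zero_add]
    exact (P.time_le X x).trans (P.τ_le_F y hyΛ x)

theorem F_le_dist (y x : Plane) : P.F y x ≤ P.ρ * dist y x := by
  rcases le_total (dist y x) 1 with h | h
  · rw [P.F_eq_zero y x h]
    exact mul_nonneg P.ρ_nonneg dist_nonneg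
  · exact (P.F_le y x h).trans (mul_le_mul_of_nonneg_left (by linarith) P.ρ_nonneg)

theorem abs_time_sub_le (X : Config) {x y : Plane} (hx : x ∈ X.carrier) (hy : y ∈ X.carrier) :
    |P.time X x - P.time X y| ≤ P.ρ * dist x y := by
  have h1 := P.time_le_add X x hy
  have h2 := P.time_le_add X y hx
  have h3 := P.F_le_dist y x
  have h4 := P.F_le_dist x y
  rw [dist_comm] at h3
  exact abs_le.2 ⟨by linarith, by linarith⟩

theorem one_lt_dist_shiftPoint_of_le {e : Plane} (he : ‖e‖ = 1) {X : Config} {x y : Plane}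
    (hy : y ∈ X.carrier) (hle : P.time X y ≤ P.time X x) (h : 1 < dist y x) :
    1 < dist (shiftPoint Λ P.τ P.step e X y) (shiftPoint Λ P.τ P.step e X x) := by
  have h1 := P.time_le_add X x hy
  have h2 := P.F_le y x h.le
  have h3 : dist y x ≤ dist (shiftPoint Λ P.τ P.step e X y) (shiftPoint Λ P.τ P.step e X x) +
      (P.time X x - P.time X y) := by
    have : y - x = (shiftPoint Λ P.τ P.step e X y - shiftPoint Λ P.τ P.step e X x) +
        (P.time X x - P.time X y) • e := by
      simp only [shiftPoint, sub_smul]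
      abel
    rw [dist_eq_norm, dist_eq_norm, this]
    refine (norm_add_le _ _).trans ?_
    rw [norm_smul, he, mul_one, Real.norm_eq_abs, abs_of_nonneg (by linarith)]
  nlinarith [P.ρ_le]

theorem one_lt_dist_shiftPoint {e : Plane} (he : ‖e‖ = 1) {X : Config} {x y : Plane}
    (hx : x ∈ X.carrier) (hy : y ∈ X.carrier) (h : 1 < dist x y) :
    1 < dist (shiftPoint Λ P.τ P.step e X x) (shiftPoint Λ P.τ P.step e X y) := by
  rcases le_total (P.time X y) (P.time X x) with hle | hle
  · rw [dist_comm] at h ⊢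
    exact P.one_lt_dist_shiftPoint_of_le he hy hle h
  · exact P.one_lt_dist_shiftPoint_of_le he hx hle h

theorem dist_shiftPoint_of_le_one {e : Plane} {X : Config} {x y : Plane}
    (hx : x ∈ X.carrier) (hy : y ∈ X.carrier) (h : dist x y ≤ 1) :
    dist (shiftPoint Λ P.τ P.step e X x) (shiftPoint Λ P.τ P.step e X y) = dist x y := by
  have h1 := P.time_le_add X x hy
  have h2 := P.time_le_add X y hx
  rw [P.F_eq_zero _ _ (by rwa [dist_comm])] at h1
  rw [P.F_eq_zero _ _ h] at h2
  have : shiftTime Λ P.τ P.step X x = shiftTime Λ P.τ P.step X y := by linarith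
  rw [shiftPoint, shiftPoint, this, dist_add_right]

theorem move_mem_hardCore_iff {e : Plane} (he : ‖e‖ = 1) (X : Config) :
    P.move e X ∈ hardCore ↔ X ∈ hardCore := by
  have hinj := (P.isDualShift he).injOn (P.isShift he) (P.isShift_dual he) P.bounded X
  constructor
  · intro h x hx y hy hxy
    by_contra! hle
    have := h _ (mem_image_of_mem _ hx) _ (mem_image_of_mem _ hy) (hinj.ne hx hy hxy)
    rw [P.dist_shiftPoint_of_le_one hx hy hle] at this
    exact absurd this (not_lt.2 hle)
  · rintro h _ ⟨x, hx, rfl⟩ _ ⟨y, hy, rfl⟩ hxy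
    exact P.one_lt_dist_shiftPoint he hx hy (h x hx y hy fun hxy' => hxy (hxy' ▸ rfl))

theorem image_hardCore {e : Plane} (he : ‖e‖ = 1) : P.move e '' hardCore = hardCore := by
  ext X
  constructor
  · rintro ⟨X, hX, rfl⟩
    exact (P.move_mem_hardCore_iff he X).2 hX
  · intro hX
    obtain ⟨X', rfl⟩ := (P.bijective_move he).2 X
    exact ⟨X', (P.move_mem_hardCore_iff he X').1 hX, rfl⟩

end Profile

end HardDisk

end

noncomputable section

namespace HardDisk

open ProbabilityTheory

section Det

theorem det_of_triangular_key {m α : Type*} [Fintype m] [DecidableEq m] [LinearOrder α]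
    (M : Matrix m m ℝ) (key : m → α) (hkey : Function.Injective key)
    (h : ∀ i j, key j < key i → M i j = 0) : M.det = ∏ i, M i i := by
  let _ : LinearOrder m := LinearOrder.lift' key hkey
  have h' : M.IsUpperTriangular := fun i j hij => h i j hij
  convert Matrix.det_of_isUpperTriangular h'

theorem det_add_smul {k : ℕ} {V : Type*} [NormedAddCommGroup V] [NormedSpace ℝ V]
    [FiniteDimensional ℝ V] (e : V) (ℓ : Fin k → (Fin k → V) →L[ℝ] ℝ)
    (A : (Fin k → V) →L[ℝ] (Fin k → V)) (hA : ∀ v i, A v i = v i + ℓ i v • e) (t : Fin k → ℝ)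
    (hℓ : ∀ i j, j ≠ i → t i ≤ t j → ℓ i (Pi.single j e) = 0) :
    A.det = ∏ i, (1 + ℓ i (Pi.single i e)) := by
  classical
  let W : (Fin k → V) →ₗ[ℝ] (Fin k → ℝ) := LinearMap.pi fun i => (ℓ i : (Fin k → V) →ₗ[ℝ] ℝ)
  let U : (Fin k → ℝ) →ₗ[ℝ] (Fin k → V) :=
    LinearMap.pi fun i => (LinearMap.proj i : (Fin k → ℝ) →ₗ[ℝ] ℝ).smulRight e
  have hAUW : (A : (Fin k → V) →ₗ[ℝ] (Fin k → V)) = 1 + U ∘ₗ W := by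
    refine LinearMap.ext fun v => funext fun i => ?_
    change A v i = _
    rw [hA]
    rfl
  let b := Module.finBasis ℝ (Fin k → V)
  let c := Pi.basisFun ℝ (Fin k)
  have h1 : A.det = LinearMap.det (1 + W ∘ₗ U) := by
    rw [ContinuousLinearMap.det, hAUW, ← LinearMap.det_toMatrix b, ← LinearMap.det_toMatrix c,
      map_add, map_add, LinearMap.toMatrix_comp b c b, LinearMap.toMatrix_comp c b c,
      LinearMap.toMatrix_one, LinearMap.toMatrix_one, Matrix.det_one_add_mul_comm]
  have hM : ∀ i j, LinearMap.toMatrix' (1 + W ∘ₗ U) i j =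
      (1 : Matrix (Fin k) (Fin k) ℝ) i j + ℓ i (Pi.single j e) := by
    intro i j
    rw [LinearMap.toMatrix'_apply]
    have hU : U (Pi.single j 1) = Pi.single j e := by
      funext l
      change (Pi.single j (1 : ℝ) : Fin k → ℝ) l • e = _
      by_cases hl : l = j
      · subst hl; simp
      · simp [Pi.single_eq_of_ne hl]
    rw [LinearMap.add_apply, LinearMap.comp_apply, hU, Pi.add_apply]
    congr 1
    by_cases hij : i = j
    · subst hij; simp
    · simp [hij]
  rw [h1, ← LinearMap.det_toMatrix', det_of_triangular_key _
    (fun i => toLex (-t i, i)) (fun i j hij => by simpa using congrArg (fun p => (ofLex p).2) hij)]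
  · simp [hM]
  · intro i j hij
    have hne : j ≠ i := fun h => by subst h; exact lt_irrefl _ hij
    have hle : t i ≤ t j := by
      rcases Prod.Lex.lt_iff.1 hij with h | h
      · simpa using h.le
      · simpa using h.1.le
    rw [hM, hℓ i j hne hle, Matrix.one_apply_ne hne.symm, add_zero]

end Det

theorem abs_deriv_le_of_sub_le {f : ℝ → ℝ} {b : ℝ} (hb : 0 ≤ b)
    (h : ∀ s, f 0 - f s ≤ b * |s|) : |deriv f 0| ≤ b := by
  by_cases hf : DifferentiableAt ℝ f 0
  · have hd := hf.hasDerivAt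
    have hr := hd.tendsto_slope_zero_right
    have hl := hd.tendsto_slope_zero_left
    simp only [zero_add, smul_eq_mul] at hr hl
    rw [abs_le]
    constructor
    · refine ge_of_tendsto hr (Filter.eventually_of_mem self_mem_nhdsWithin fun s hs => ?_)
      have hs : 0 < s := hs
      have := h s
      rw [abs_of_pos hs] at this
      rw [inv_mul_eq_div, le_div_iff₀ hs]
      linarith
    · refine le_of_tendsto hl (Filter.eventually_of_mem self_mem_nhdsWithin fun s hs => ?_)
      have hs : s < 0 := hs
      have := h s
      rw [abs_of_neg hs] at this
      rw [inv_mul_eq_div, div_le_iff_of_neg hs]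
      linarith
  · rw [deriv_zero_of_not_differentiableAt hf]
    simpa using hb

theorem fderiv_apply_eq_of_touch {V : Type*} [NormedAddCommGroup V] [NormedSpace ℝ V] {f : V → ℝ}
    {f' : V →L[ℝ] ℝ} {x v : V} (hf : HasFDerivAt f f' x) {g : ℝ → ℝ} {g' : ℝ}
    (hg : HasDerivAt g g' 0) (hle : ∀ s, f (x + s • v) ≤ g s) (heq : f x = g 0) : f' v = g' := by
  have h1 : HasDerivAt (fun s : ℝ => f (x + s • v)) (f' v) 0 :=
    hf.hasLineDerivAt v
  have h2 := h1.sub hg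
  have hmax : IsLocalMax ((fun s : ℝ => f (x + s • v)) - g) 0 := by
    refine Filter.Eventually.of_forall fun s => ?_
    simp only [Pi.sub_apply, zero_smul, add_zero, heq, sub_self]
    linarith [hle s]
  linarith [hmax.hasDerivAt_eq_zero h2]

theorem addHaar_image_null {V : Type*} [NormedAddCommGroup V] [NormedSpace ℝ V]
    [FiniteDimensional ℝ V] [MeasurableSpace V] [BorelSpace V] (μ : Measure V)
    [μ.IsAddHaarMeasure] {K : NNReal} {f : V → V} (hf : LipschitzWith K f) {s : Set V}
    (hs : μ s = 0) : μ (f '' s) = 0 := by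
  have h1 : Measure.hausdorffMeasure (Module.finrank ℝ V : ℝ) s = 0 :=
    (Measure.absolutelyContinuous_isAddHaarMeasure
      (Measure.hausdorffMeasure (Module.finrank ℝ V : ℝ)) μ) hs
  have h2 := hf.hausdorffMeasure_image_le (d := (Module.finrank ℝ V : ℝ)) (by positivity) s
  rw [h1, mul_zero] at h2
  exact (Measure.absolutelyContinuous_isAddHaarMeasure μ
    (Measure.hausdorffMeasure (Module.finrank ℝ V : ℝ))) (le_antisymm h2 bot_le)

end HardDisk
end

noncomputable section

namespace HardDisk

open ProbabilityTheory

namespace Profile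

variable {Λ : Set Plane} (P : Profile Λ)

theorem le_step (y : Plane) (t : ℝ) (x : Plane) : t ≤ P.step y t x :=
  le_add_of_nonneg_right (P.F_nonneg y x)

theorem strictMono_step (y x : Plane) : StrictMono fun t => P.step y t x :=
  fun _ _ h => by simpa [step] using h

/-- The shift times of the particles of a tuple. -/
def tupleTime {k : ℕ} (x : Fin k → Plane) (i : Fin k) : ℝ := freeze P.τ P.step (range x) (x i)

/-- The shift of a tuple of particles. -/
def moveTuple (e : Plane) {k : ℕ} (x : Fin k → Plane) : Fin k → Plane :=
  fun i => x i + P.tupleTime x i • e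

variable {k : ℕ}

theorem tupleTime_le (x : Fin k → Plane) (i : Fin k) : P.tupleTime x i ≤ P.τ (x i) :=
  freeze_le (finite_range x) _

theorem tupleTime_le_add (x : Fin k → Plane) (i j : Fin k) :
    P.tupleTime x i ≤ P.tupleTime x j + P.F (x j) (x i) :=
  freeze_le_of_mem (finite_range x) P.le_step _ (mem_range_self j)

theorem tupleTime_eq_or (x : Fin k → Plane) (i : Fin k) :
    P.tupleTime x i = P.τ (x i) ∨
      ∃ j, x j ≠ x i ∧ P.tupleTime x i = P.tupleTime x j + P.F (x j) (x i) := by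
  rcases freeze_eq_or (τ := P.τ) (finite_range x) P.le_step P.strictMono_step (x i) with
    h | ⟨_, ⟨j, rfl⟩, hne, h⟩
  · exact Or.inl h
  · exact Or.inr ⟨j, hne, h⟩

theorem exists_relax_le (m : ℕ) : ∃ C : ℝ, 0 ≤ C ∧ ∀ (x x' : Fin k → Plane) (i : Fin k),
    relax P.τ P.step (range x) m (x i) ≤
      relax P.τ P.step (range x') m (x' i) + C * dist x x' := by
  induction m with
  | zero =>
    refine ⟨P.ρ, P.ρ_nonneg, fun x x' i => ?_⟩
    have h1 := (abs_le.1 (P.τ_lip (x i) (x' i))).2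
    have h2 := mul_le_mul_of_nonneg_left (dist_le_pi_dist x x' i) P.ρ_nonneg
    simp only [relax]
    linarith
  | succ m ih =>
    obtain ⟨C, hC, h⟩ := ih
    refine ⟨C + P.ρ * 2, by linarith [P.ρ_nonneg], fun x x' i => ?_⟩
    have hd : 0 ≤ P.ρ * dist x x' := mul_nonneg P.ρ_nonneg dist_nonneg
    rcases relax_succ_eq (τ := P.τ) (Φ := P.step) (finite_range x') m (x' i) with
      h1 | ⟨_, ⟨j, rfl⟩, h1⟩
    · have h2 := relax_succ_le (τ := P.τ) (Φ := P.step) (finite_range x) m (x i)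
      have h3 := h x x' i
      rw [h1]
      nlinarith
    · have h2 := relax_succ_le_of_mem (τ := P.τ) (Φ := P.step) (finite_range x) m (x i)
        (mem_range_self j)
      have h3 := h x x' j
      have h4 := (abs_le.1 (P.F_lip (x j) (x i) (x' j) (x' i))).2
      have h5 := mul_le_mul_of_nonneg_left (dist_le_pi_dist x x' i) P.ρ_nonneg
      have h6 := mul_le_mul_of_nonneg_left (dist_le_pi_dist x x' j) P.ρ_nonneg
      rw [h1]
      simp only [step] at h2 ⊢
      nlinarith

theorem exists_lipschitzWith_tupleTime (i : Fin k) :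
    ∃ C, LipschitzWith C fun x : Fin k → Plane => P.tupleTime x i := by
  obtain ⟨C, hC, h⟩ := P.exists_relax_le (k := k) k
  have hf : ∀ x : Fin k → Plane, P.tupleTime x i = relax P.τ P.step (range x) k (x i) := by
    refine fun x => (relax_eq_freeze (finite_range x) P.le_step ?_ _).symm
    rw [← image_univ]
    exact (ncard_image_le finite_univ).trans (by simp)
  refine ⟨⟨C, hC⟩, LipschitzWith.of_dist_le_mul fun x x' => ?_⟩
  rw [Real.dist_eq, hf, hf]
  change _ ≤ C * dist x x'
  have h1 := h x x' i
  have h2 := h x' x i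
  rw [dist_comm] at h2
  exact abs_le.2 ⟨by linarith, by linarith⟩

theorem exists_lipschitzWith_moveTuple {e : Plane} (he : ‖e‖ = 1) :
    ∃ C, LipschitzWith C fun x : Fin k → Plane => P.moveTuple e x := by
  choose C hC using fun i => P.exists_lipschitzWith_tupleTime (k := k) i
  refine ⟨1 + Finset.univ.sum C, LipschitzWith.of_dist_le_mul fun x x' => ?_⟩
  refine (dist_pi_le_iff (by positivity)).2 fun i => ?_
  simp only [moveTuple]
  refine (dist_add_add_le _ _ _ _).trans ?_
  rw [dist_eq_norm (P.tupleTime x i • e), ← sub_smul, norm_smul, he, mul_one, ← dist_eq_norm]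
  have h1 := (hC i).dist_le_mul x x'
  have h2 : (C i : ℝ) ≤ ((Finset.univ.sum C : NNReal) : ℝ) := by
    exact_mod_cast Finset.single_le_sum (f := C) (fun _ _ => zero_le) (Finset.mem_univ i)
  have h3 := mul_le_mul_of_nonneg_right h2 (dist_nonneg (x := x) (y := x'))
  have h4 := dist_le_pi_dist x x' i
  push_cast at h3 ⊢
  linarith

theorem fderiv_tupleTime_eq_zero {x : Fin k → Plane} (hx : Pairwise fun i j => 1 < dist (x i) (x j))
    {ℓ : Fin k → (Fin k → Plane) →L[ℝ] ℝ}
    (hℓ : ∀ i, HasFDerivAt (fun x : Fin k → Plane => P.tupleTime x i) (ℓ i) x) (i : Fin k) :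
    ∀ v : Fin k → Plane, v i = 0 → (∀ j, P.tupleTime x j < P.tupleTime x i → v j = 0) →
      ℓ i v = 0 := by
  have hwf : WellFounded fun i j : Fin k => P.tupleTime x i < P.tupleTime x j :=
    have : IsTrans (Fin k) fun i j => P.tupleTime x i < P.tupleTime x j :=
      ⟨fun _ _ _ => lt_trans⟩
    have : Std.Irrefl fun i j : Fin k => P.tupleTime x i < P.tupleTime x j :=
      ⟨fun _ => lt_irrefl _⟩
    Finite.wellFounded_of_trans_of_irrefl _
  induction i using hwf.induction with
  | _ i ih =>
    intro v hvi hv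
    rcases P.tupleTime_eq_or x i with h | ⟨j, hne, h⟩
    · refine fderiv_apply_eq_of_touch (hℓ i) (hasDerivAt_const 0 (P.τ (x i))) (fun s => ?_) h
      simpa [hvi] using P.tupleTime_le (x + s • v) i
    · have hij : j ≠ i := fun hij => hne (hij ▸ rfl)
      have hlt : P.tupleTime x j < P.tupleTime x i := by
        linarith [P.F_pos _ _ (hx hij)]
      have h1 : (ℓ i - ℓ j) v = 0 := by
        refine fderiv_apply_eq_of_touch ((hℓ i).sub (hℓ j))
          (hasDerivAt_const 0 (P.F (x j) (x i))) (fun s => ?_) ?_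
        · have h2 := P.tupleTime_le_add (x + s • v) i j
          simp only [Pi.add_apply, Pi.smul_apply, hvi, hv j hlt, smul_zero, add_zero] at h2
          simp only [Pi.sub_apply]
          linarith
        · simp only [Pi.sub_apply]
          linarith
      have h2 := ih j hlt v (hv j hlt) fun l hl => hv l (hl.trans hlt)
      rw [sub_apply, h2, sub_zero] at h1
      exact h1

/-- The set of particles of `X` that determine the shift time at `x`. -/
def active (X : Config) (x : Plane) : Set Plane :=
  {y | y ∈ Λ ∧ P.time X y < P.time X x ∧ P.time X x = P.time X y + P.F y x}

/-- The derivative in direction `e` of the shift time of the particle `x` of `X`. -/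
def slope (e : Plane) (X : Config) (x : Plane) : ℝ :=
  open scoped Classical in
  if P.time X x = P.τ x then deriv (fun s : ℝ => P.τ (x + s • e)) 0
  else ((pts X) (P.active X x)).toReal⁻¹ *
    ∫ y in P.active X x, deriv (fun s : ℝ => P.F y (x + s • e)) 0 ∂(pts X)

/-- The Jacobian of the shift in direction `e`. -/
def jacobian (e : Plane) (X : Config) : ℝ :=
  Real.exp (∫ x in Λ, Real.log (1 + P.slope e X x) ∂(pts X))

theorem measurable_time : Measurable fun p : Config × Plane => P.time p.1 p.2 :=
  (P.isShift (e := e₁) (by simp [e₁])).measurable_shiftTime P.measurableSet P.bounded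

theorem measurableSet_active :
    MeasurableSet {p : (Config × Plane) × Plane | p.2 ∈ P.active p.1.1 p.1.2} := by
  have h1 : Measurable fun p : (Config × Plane) × Plane => P.time p.1.1 p.1.2 :=
    P.measurable_time.comp measurable_fst
  have h2 : Measurable fun p : (Config × Plane) × Plane => P.time p.1.1 p.2 :=
    P.measurable_time.comp ((measurable_fst.comp measurable_fst).prodMk measurable_snd)
  have h3 : Measurable fun p : (Config × Plane) × Plane => P.F p.2 p.1.2 :=
    P.continuous_F.measurable.comp (measurable_snd.prodMk (measurable_snd.comp measurable_fst))
  exact (measurable_snd P.measurableSet).inter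
    ((measurableSet_lt h2 h1).inter (measurableSet_eq_fun h1 (h2.add h3)))

theorem measurable_deriv_τ (e : Plane) :
    Measurable fun x => deriv (fun s : ℝ => P.τ (x + s • e)) 0 := by
  have h := measurable_deriv_with_param (f := fun (x : Plane) (s : ℝ) => P.τ (x + s • e))
    (P.continuous_τ.comp (by fun_prop))
  exact h.comp (measurable_id.prodMk measurable_const)

theorem measurable_deriv_F (e : Plane) :
    Measurable fun p : Plane × Plane => deriv (fun s : ℝ => P.F p.1 (p.2 + s • e)) 0 := by
  have h := measurable_deriv_with_param
    (f := fun (p : Plane × Plane) (s : ℝ) => P.F p.1 (p.2 + s • e))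
    (P.continuous_F.comp (f := fun q : (Plane × Plane) × ℝ => (q.1.1, q.1.2 + q.2 • e))
      (by fun_prop))
  exact h.comp (measurable_id.prodMk measurable_const)

theorem measurable_slope (e : Plane) :
    Measurable fun p : Config × Plane => P.slope e p.1 p.2 := by
  classical
  have hact := P.measurableSet_active
  refine Measurable.ite (measurableSet_eq_fun P.measurable_time
    (P.continuous_τ.measurable.comp measurable_snd))
    ((P.measurable_deriv_τ e).comp measurable_snd) (Measurable.mul ?_ ?_)
  · have h := Kernel.measurable_kernel_prodMk_left
      (κ := pts.comap (Prod.fst : Config × Plane → Config) measurable_fst) hact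
    exact h.ennreal_toReal.inv
  · have hF : Measurable fun q : (Config × Plane) × Plane =>
        deriv (fun s : ℝ => P.F q.2 (q.1.2 + s • e)) 0 :=
      (P.measurable_deriv_F e).comp (measurable_snd.prodMk (measurable_snd.comp measurable_fst))
    have h := ((hF.indicator hact).stronglyMeasurable).integral_kernel_prod_right'
      (κ := pts.comap (Prod.fst : Config × Plane → Config) measurable_fst)
    convert h.measurable using 1
    ext p
    rw [← integral_indicator (show MeasurableSet (P.active p.1 p.2) from
      measurable_prodMk_left (x := p) hact)]
    rfl

theorem measurable_jacobian (e : Plane) : Measurable (P.jacobian e) := by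
  have h : Measurable fun p : Config × Plane => Real.log (1 + P.slope e p.1 p.2) :=
    Real.measurable_log.comp ((P.measurable_slope e).const_add 1)
  have h2 := h.stronglyMeasurable.integral_kernel_prod_right' (κ := pts.restrict P.measurableSet)
  exact Real.measurable_exp.comp h2.measurable

theorem jacobian_pos (e : Plane) (X : Config) : 0 < P.jacobian e X := Real.exp_pos _

theorem pts_active_lt_top (X : Config) (x : Plane) : pts X (P.active X x) < ∞ := by
  have hm : MeasurableSet (P.active X x) :=
    measurable_prodMk_left (x := (X, x)) P.measurableSet_active
  rw [pts_apply_apply _ hm, ENat.toENNReal_lt_top, Config.count]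
  exact ((X.finite_inter Λ P.bounded).subset (inter_subset_inter_right _ fun y hy => hy.1)).encard_lt_top

theorem abs_slope_le {e x : Plane} {b : ℝ} (hb : 0 ≤ b)
    (hτ : ∀ s : ℝ, P.τ x - P.τ (x + s • e) ≤ b * |s|)
    (hF : ∀ y, ∀ s : ℝ, P.F y x - P.F y (x + s • e) ≤ b * |s|) (X : Config) :
    |P.slope e X x| ≤ b := by
  classical
  have h1 : |deriv (fun s : ℝ => P.τ (x + s • e)) 0| ≤ b :=
    abs_deriv_le_of_sub_le hb (by simpa using hτ)
  have h2 : ∀ y, |deriv (fun s : ℝ => P.F y (x + s • e)) 0| ≤ b := fun y =>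
    abs_deriv_le_of_sub_le hb (by simpa using hF y)
  rw [slope]
  split_ifs with h
  · exact h1
  · have h3 := norm_setIntegral_le_of_norm_le_const (P.pts_active_lt_top X x) (C := b)
      (f := fun y => deriv (fun s : ℝ => P.F y (x + s • e)) 0) (fun y _ => h2 y)
    rw [abs_mul, abs_of_nonneg (by positivity)]
    rw [Real.norm_eq_abs, Measure.real] at h3
    rcases eq_or_lt_of_le (ENNReal.toReal_nonneg (a := pts X (P.active X x))) with h0 | h0
    · rw [← h0]; simpa using hb
    · rw [inv_mul_le_iff₀ h0]
      linarith

theorem abs_slope_le_ρ {e : Plane} (he : ‖e‖ = 1) (X : Config) (x : Plane) :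
    |P.slope e X x| ≤ P.ρ := by
  have hd : ∀ s : ℝ, dist x (x + s • e) = |s| := fun s => by
    rw [dist_self_add_right, norm_smul, he, mul_one, Real.norm_eq_abs]
  refine P.abs_slope_le P.ρ_nonneg (fun s => ?_) (fun y s => ?_) X
  · have := (abs_le.1 (P.τ_lip x (x + s • e))).2
    rwa [hd] at this
  · have := (abs_le.1 (P.F_lip y x y (x + s • e))).2
    rwa [hd, dist_self, zero_add] at this

theorem slope_neg (e : Plane) (X : Config) (x : Plane) : P.slope (-e) X x = -P.slope e X x := by
  classical
  have h : ∀ f : Plane → ℝ, deriv (fun s : ℝ => f (x + s • -e)) 0 =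
      -deriv (fun s : ℝ => f (x + s • e)) 0 := by
    intro f
    have := deriv_comp_neg (fun s : ℝ => f (x + s • e)) 0
    simpa using this
  simp only [slope, h]
  split_ifs
  · rfl
  · rw [integral_neg, mul_neg]

end Profile

end HardDisk
end

noncomputable section

namespace HardDisk

open ProbabilityTheory

theorem glue_inter {Λ : Set Plane} (Y : Config) {k : ℕ} {x : Fin k → Plane} (hx : ∀ i, x i ∈ Λ) :
    (Config.glue Λ Y x).carrier ∩ Λ = range x := by
  ext p
  constructor
  · rintro ⟨h | h, hp⟩
    · exact h
    · exact absurd hp h.2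
  · rintro ⟨i, rfl⟩
    exact ⟨Or.inl ⟨i, rfl⟩, hx i⟩

theorem setIntegral_pts {Λ : Set Plane} (hΛ : MeasurableSet Λ) (hb : Bornology.IsBounded Λ)
    (X : Config) (f : Plane → ℝ) :
    ∫ x in Λ, f x ∂(pts X) = ∑ x ∈ (X.finite_inter Λ hb).toFinset, f x := by
  rw [pts_apply, Measure.restrict_restrict hΛ, inter_comm]
  have hc : (Measure.count.restrict (X.carrier ∩ Λ) : Measure Plane) =
      Measure.count.restrict (X.finite_inter Λ hb).toFinset := by
    rw [Finite.coe_toFinset]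
  rw [hc, setIntegral_finset]
  · simp [Measure.real]
  · rw [← biUnion_of_singleton ((X.finite_inter Λ hb).toFinset : Set Plane),
      integrableOn_finite_biUnion (Finset.finite_toSet _)]
    exact fun x _ => integrableOn_singleton (hx := by simp)

theorem ae_injective (k : ℕ) : ∀ᵐ x : Fin k → Plane, Function.Injective x := by
  have h : ∀ᵐ x : Fin k → Plane, ∀ i j, i ≠ j → x i ≠ x j := by
    rw [ae_all_iff]
    intro i
    rw [ae_all_iff]
    intro j
    by_cases hij : i = j
    · simp [hij]
    let L : (Fin k → Plane) →ₗ[ℝ] Plane :=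
      (LinearMap.proj i : (Fin k → Plane) →ₗ[ℝ] Plane) - LinearMap.proj j
    have hL : LinearMap.ker L ≠ ⊤ := by
      intro htop
      have : L (Pi.single i e₁ : Fin k → Plane) = 0 := by
        rw [← LinearMap.mem_ker, htop]; trivial
      simp only [L, LinearMap.sub_apply, LinearMap.proj_apply, Pi.single_eq_same,
        Pi.single_eq_of_ne (Ne.symm hij), sub_zero] at this
      simp [e₁] at this
    have h0 := Measure.addHaar_submodule (volume : Measure (Fin k → Plane)) (LinearMap.ker L) hL
    filter_upwards [measure_eq_zero_iff_ae_notMem.1 h0] with x hx _ hxij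
    exact hx (by simp [L, hxij])
  filter_upwards [h] with x hx i j hij
  by_contra hne
  exact hx i j hne hij

/-- Tuples of points of `Λ`. -/
def tuplesIn (Λ : Set Plane) (k : ℕ) : Set (Fin k → Plane) := {x | ∀ i, x i ∈ Λ}

theorem measurableSet_tuplesIn {Λ : Set Plane} (hΛ : MeasurableSet Λ) (k : ℕ) :
    MeasurableSet (tuplesIn Λ k) := by
  have : tuplesIn Λ k = ⋂ i, (fun x => x i) ⁻¹' Λ := by
    ext x
    simp only [mem_iInter]
    rfl
  rw [this]
  exact MeasurableSet.iInter fun i => measurable_pi_apply i hΛ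

/-- Tuples in `Λ` which together with the particles of `Y` outside `Λ` are hard-core. -/
def hardTuples (Λ : Set Plane) (Y : Config) (k : ℕ) : Set (Fin k → Plane) :=
  tuplesIn Λ k ∩ Config.glue Λ Y ⁻¹' hardCore

theorem measurableSet_hardTuples {Λ : Set Plane} (hΛ : MeasurableSet Λ)
    (Y : Config) (k : ℕ) : MeasurableSet (hardTuples Λ Y k) :=
  (measurableSet_tuplesIn hΛ k).inter (measurable_glue Λ Y k measurableSet_hardCore)

namespace Profile

variable {Λ : Set Plane} (P : Profile Λ)

theorem time_glue (Y : Config) {k : ℕ} {x : Fin k → Plane} (hx : ∀ i, x i ∈ Λ) (i : Fin k) :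
    P.time (Config.glue Λ Y x) (x i) = P.tupleTime x i := by
  rw [time, shiftTime_of_mem _ _ _ _ (hx i), glue_inter Y hx, tupleTime]

theorem glue_moveTuple (Y : Config) (e : Plane) {k : ℕ} {x : Fin k → Plane} (hx : ∀ i, x i ∈ Λ) :
    Config.glue Λ Y (P.moveTuple e x) = P.move e (Config.glue Λ Y x) := by
  have hpt : ∀ i, shiftPoint Λ P.τ P.step e (Config.glue Λ Y x) (x i) = P.moveTuple e x i :=
    fun i => by
      have := P.time_glue Y hx i
      rw [time] at this
      rw [shiftPoint, this, moveTuple]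
  ext p
  constructor
  · rintro (⟨i, rfl⟩ | h)
    · exact ⟨x i, Or.inl ⟨i, rfl⟩, hpt i⟩
    · exact ⟨p, Or.inr h, shiftPoint_of_notMem _ _ _ _ _ h.2⟩
  · rintro ⟨y, ⟨i, rfl⟩ | h, rfl⟩
    · exact Or.inl ⟨i, (hpt i).symm⟩
    · rw [shiftPoint_of_notMem _ _ _ _ _ h.2]
      exact Or.inr h

theorem injective_moveTuple {e : Plane} (he : ‖e‖ = 1) {k : ℕ} :
    Function.Injective fun x : Fin k → Plane => P.moveTuple e x := by
  have key : ∀ x : Fin k → Plane, ∀ i, freeze (P.dualBase e) (P.dualStep e)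
      (range (P.moveTuple e x)) (P.moveTuple e x i) = P.tupleTime x i := by
    intro x i
    have h := (P.isDualShift he).freeze_image (finite_range x) P.le_step P.strictMono_step
      (P.isShift_dual he).le_step (P.isShift_dual he).strictMono (mem_range_self i)
    rw [← range_comp] at h
    exact h
  intro x x' h
  have h : P.moveTuple e x = P.moveTuple e x' := h
  funext i
  have h1 := key x i
  rw [h, key x' i] at h1
  have h2 := congrFun h i
  simp only [moveTuple, h1] at h2
  exact add_right_cancel h2

theorem moveTuple_mem {e : Plane} (he : ‖e‖ = 1) {k : ℕ} {x : Fin k → Plane}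
    (hx : ∀ i, x i ∈ Λ) (i : Fin k) : P.moveTuple e x i ∈ Λ :=
  P.stay e he _ (hx i) _
    (le_relax_of_le (finite_range x) P.le_step P.τ_nonneg _ _) (P.tupleTime_le x i)

theorem exists_moveTuple_eq {e : Plane} (he : ‖e‖ = 1) {k : ℕ} {y : Fin k → Plane}
    (hy : ∀ i, y i ∈ Λ) : ∃ x : Fin k → Plane, (∀ i, x i ∈ Λ) ∧ P.moveTuple e x = y := by
  set t' := freeze (P.dualBase e) (P.dualStep e) (range y)
  have hs := P.isShift_dual he
  refine ⟨fun i => y i + t' (y i) • -e, fun i => ?_, ?_⟩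
  · exact hs.stay _ (hy i) _ (le_relax_of_le (finite_range y) hs.le_step hs.nonneg _ _)
      (freeze_le (finite_range y) _)
  · funext i
    have h := (P.isDualShift he).symm.freeze_image (finite_range y) hs.le_step hs.strictMono
      P.le_step P.strictMono_step (mem_range_self i)
    rw [← range_comp] at h
    have h' : P.tupleTime (fun i => y i + t' (y i) • -e) i = t' (y i) := h
    rw [moveTuple, h', smul_neg, neg_add_cancel_right]

theorem image_hardTuples {e : Plane} (he : ‖e‖ = 1) (Y : Config) (k : ℕ) :
    (fun x => P.moveTuple e x) '' hardTuples Λ Y k = hardTuples Λ Y k := by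
  ext y
  constructor
  · rintro ⟨x, hx, rfl⟩
    refine ⟨P.moveTuple_mem he hx.1, ?_⟩
    change Config.glue Λ Y (P.moveTuple e x) ∈ hardCore
    rw [P.glue_moveTuple Y e hx.1, P.move_mem_hardCore_iff he]
    exact hx.2
  · intro hy
    obtain ⟨x, hx, rfl⟩ := P.exists_moveTuple_eq he hy.1
    refine ⟨x, ⟨hx, ?_⟩, rfl⟩
    change Config.glue Λ Y x ∈ hardCore
    rw [← P.move_mem_hardCore_iff he, ← P.glue_moveTuple Y e hx]
    exact hy.2

/-- The profile is differentiable off the set `N`. -/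
structure SmoothOff (N : Set Plane) : Prop where
  measurableSet : MeasurableSet N
  null : volume N = 0
  τ_diff : ∀ x ∉ N, DifferentiableAt ℝ P.τ x
  F_diff : ∀ x ∉ N, ∀ y, 1 < dist y x → DifferentiableAt ℝ (P.F y) x

variable {P} in
theorem _root_.HardDisk.hasDerivAt_line {f : Plane → ℝ} {x : Plane} (hf : DifferentiableAt ℝ f x)
    (e : Plane) : HasDerivAt (fun s : ℝ => f (x + s • e))
      (deriv (fun s : ℝ => f (x + s • e)) 0) 0 :=
  (hf.hasFDerivAt.hasLineDerivAt e).differentiableAt.hasDerivAt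

theorem fderiv_tupleTime_single {N : Set Plane} (hN : P.SmoothOff N) (Y : Config) {k : ℕ} (e : Plane)
    {x : Fin k → Plane} (hxΛ : ∀ i, x i ∈ Λ) (hx : Pairwise fun i j => 1 < dist (x i) (x j))
    (hxN : ∀ i, x i ∉ N) {ℓ : Fin k → (Fin k → Plane) →L[ℝ] ℝ}
    (hℓ : ∀ i, HasFDerivAt (fun x : Fin k → Plane => P.tupleTime x i) (ℓ i) x) (i : Fin k) :
    ℓ i (Pi.single i e) = P.slope e (Config.glue Λ Y x) (x i) := by
  have hline : ∀ s : ℝ, (x + s • (Pi.single i e : Fin k → Plane)) i = x i + s • e :=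
    fun s => by simp
  rw [slope, P.time_glue Y hxΛ]
  split_ifs with h
  · refine fderiv_apply_eq_of_touch (hℓ i) (hasDerivAt_line (hN.τ_diff _ (hxN i)) e)
      (fun s => ?_) (by simpa using h)
    rw [← hline]
    exact P.tupleTime_le _ i
  · have hmact : MeasurableSet (P.active (Config.glue Λ Y x) (x i)) :=
      measurable_prodMk_left (x := (Config.glue Λ Y x, x i)) P.measurableSet_active
    have hconst : ∀ y ∈ P.active (Config.glue Λ Y x) (x i) ∩ (Config.glue Λ Y x).carrier,
        deriv (fun s : ℝ => P.F y (x i + s • e)) 0 = ℓ i (Pi.single i e) := by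
      rintro y ⟨⟨hyΛ, hlt, heq⟩, hyX⟩
      obtain ⟨j, rfl⟩ : y ∈ range x := glue_inter Y hxΛ ▸ ⟨hyX, hyΛ⟩
      rw [P.time_glue Y hxΛ, P.time_glue Y hxΛ] at hlt heq
      have hji : j ≠ i := fun hji => by subst hji; exact lt_irrefl _ hlt
      have h1 : (ℓ i - ℓ j) (Pi.single i e) = deriv (fun s : ℝ => P.F (x j) (x i + s • e)) 0 := by
        refine fderiv_apply_eq_of_touch ((hℓ i).sub (hℓ j))
          (hasDerivAt_line (hN.F_diff _ (hxN i) _ (hx hji)) e) (fun s => ?_) ?_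
        · have h2 := P.tupleTime_le_add (x + s • (Pi.single i e : Fin k → Plane)) i j
          rw [hline] at h2
          simp only [Pi.add_apply, Pi.smul_apply, Pi.single_eq_of_ne hji, smul_zero,
            add_zero] at h2
          simp only [Pi.sub_apply]
          linarith
        · simp only [Pi.sub_apply, zero_smul, add_zero]
          linarith
      have h2 : ℓ j (Pi.single i e) = 0 :=
        P.fderiv_tupleTime_eq_zero hx hℓ j _ (Pi.single_eq_of_ne hji _) fun l hl =>
          Pi.single_eq_of_ne (fun hli => by subst hli; exact lt_asymm hl hlt) _
      rw [sub_apply, h2, sub_zero] at h1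
      exact h1.symm
    obtain ⟨j, hne, hj⟩ := (P.tupleTime_eq_or x i).resolve_left h
    have hji : j ≠ i := fun hji => hne (hji ▸ rfl)
    have hmem : x j ∈ (Config.glue Λ Y x).carrier ∩ P.active (Config.glue Λ Y x) (x i) := by
      refine ⟨Or.inl ⟨j, rfl⟩, hxΛ j, ?_, ?_⟩
      · rw [P.time_glue Y hxΛ, P.time_glue Y hxΛ]
        linarith [P.F_pos _ _ (hx hji)]
      · rw [P.time_glue Y hxΛ, P.time_glue Y hxΛ, hj]
    have hpos : 0 < (pts (Config.glue Λ Y x) (P.active (Config.glue Λ Y x) (x i))).toReal := by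
      refine ENNReal.toReal_pos ?_ (P.pts_active_lt_top _ _).ne
      rw [pts_apply_apply _ hmact, Ne, ENat.toENNReal_eq_zero, Config.count, encard_eq_zero]
      exact Set.Nonempty.ne_empty ⟨_, hmem⟩
    have hint : ∫ y in P.active (Config.glue Λ Y x) (x i),
        deriv (fun s : ℝ => P.F y (x i + s • e)) 0 ∂(pts (Config.glue Λ Y x)) =
        ∫ y in P.active (Config.glue Λ Y x) (x i), ℓ i (Pi.single i e)
          ∂(pts (Config.glue Λ Y x)) := by
      rw [pts_apply, Measure.restrict_restrict hmact]
      exact setIntegral_congr_fun (hmact.inter (Config.measurableSet _)) hconst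
    rw [hint, setIntegral_const, Measure.real, smul_eq_mul, inv_mul_cancel_left₀ hpos.ne']

theorem jacobian_glue {e : Plane} (he : ‖e‖ = 1) (Y : Config) {k : ℕ} {x : Fin k → Plane}
    (hxΛ : ∀ i, x i ∈ Λ) (hx : Function.Injective x) :
    P.jacobian e (Config.glue Λ Y x) =
      ∏ i, (1 + P.slope e (Config.glue Λ Y x) (x i)) := by
  classical
  have hpos : ∀ y, 0 < 1 + P.slope e (Config.glue Λ Y x) y := fun y => by
    have := (abs_le.1 (P.abs_slope_le_ρ he (Config.glue Λ Y x) y)).1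
    linarith [P.ρ_le]
  rw [jacobian, setIntegral_pts P.measurableSet P.bounded]
  have : ((Config.glue Λ Y x).finite_inter Λ P.bounded).toFinset = Finset.univ.image x := by
    ext p
    simp [glue_inter Y hxΛ]
  rw [this, Finset.sum_image fun _ _ _ _ h => hx h, Real.exp_sum]
  exact Finset.prod_congr rfl fun i _ => Real.exp_log (hpos _)

theorem lintegral_hardTuples {N : Set Plane} (hN : P.SmoothOff N) {e : Plane} (he : ‖e‖ = 1)
    (Y : Config) (k : ℕ) (h : (Fin k → Plane) → ℝ≥0∞) :
    ∫⁻ x in hardTuples Λ Y k, h x =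
      ∫⁻ x in hardTuples Λ Y k,
        ENNReal.ofReal (P.jacobian e (Config.glue Λ Y x)) * h (P.moveTuple e x) := by
  set D := hardTuples Λ Y k
  let s : Set (Fin k → Plane) := D ∩ ((⋂ i, ⋂ j, ⋂ _ : i ≠ j, {x | 1 < dist (x i) (x j)}) ∩
    ((⋂ i, {x | x i ∉ N}) ∩ ⋂ i, {x | DifferentiableAt ℝ (fun x => P.tupleTime x i) x}))
  have hs_mem : ∀ x ∈ s, (∀ i, x i ∈ Λ) ∧ (Pairwise fun i j => 1 < dist (x i) (x j)) ∧
      (∀ i, x i ∉ N) ∧ ∀ i, DifferentiableAt ℝ (fun x => P.tupleTime x i) x := by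
    rintro x ⟨hD, h1, h2, h3⟩
    simp only [mem_iInter] at h1 h2 h3
    exact ⟨hD.1, fun i j hij => h1 i j hij, h2, h3⟩
  have hDm : MeasurableSet D := measurableSet_hardTuples P.measurableSet Y k
  have hsm : MeasurableSet s := by
    refine hDm.inter (MeasurableSet.inter ?_ (MeasurableSet.inter ?_ ?_))
    · exact MeasurableSet.iInter fun i => MeasurableSet.iInter fun j => MeasurableSet.iInter fun _ =>
        measurableSet_lt measurable_const ((measurable_pi_apply i).dist (measurable_pi_apply j))
    · exact MeasurableSet.iInter fun i => (measurable_pi_apply i hN.measurableSet).compl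
    · exact MeasurableSet.iInter fun i => measurableSet_of_differentiableAt ℝ _
  have hsD : s ⊆ D := inter_subset_left
  have hnull : volume (D \ s) = 0 := by
    have h1 : ∀ᵐ x : Fin k → Plane, ∀ i, DifferentiableAt ℝ (fun x => P.tupleTime x i) x := by
      rw [ae_all_iff]
      intro i
      obtain ⟨C, hC⟩ := P.exists_lipschitzWith_tupleTime (k := k) i
      exact hC.ae_differentiableAt
    have h2 : ∀ᵐ x : Fin k → Plane, ∀ i, x i ∉ N := by
      rw [ae_all_iff]
      intro i
      have hq : Measure.QuasiMeasurePreserving (Function.eval i)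
          (volume : Measure (Fin k → Plane)) volume :=
        Measure.quasiMeasurePreserving_eval (fun _ : Fin k => (volume : Measure Plane)) i
      exact hq.ae (measure_eq_zero_iff_ae_notMem.1 hN.null)
    rw [measure_eq_zero_iff_ae_notMem]
    filter_upwards [h1, h2, ae_injective k] with x hx1 hx2 hx3 hx
    refine hx.2 ⟨hx.1, ?_, ?_, ?_⟩
    · simp only [mem_iInter]
      exact fun i j hij => hx.1.2 _ (Or.inl ⟨i, rfl⟩) _ (Or.inl ⟨j, rfl⟩) (hx3.ne hij)
    · simp only [mem_iInter]
      exact hx2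
    · simp only [mem_iInter]
      exact hx1
  have hsD_ae : s =ᵐ[volume] D :=
    Filter.EventuallyLE.antisymm (Filter.Eventually.of_forall hsD) (ae_le_set.2 hnull)
  set T : (Fin k → Plane) → (Fin k → Plane) := fun x => P.moveTuple e x
  have himg_ae : T '' s =ᵐ[volume] D := by
    have hTD : T '' D = D := P.image_hardTuples he Y k
    refine Filter.EventuallyLE.antisymm
      (Filter.Eventually.of_forall ((image_mono hsD).trans hTD.subset)) ?_
    rw [ae_le_set]
    obtain ⟨C, hC⟩ := P.exists_lipschitzWith_moveTuple (k := k) he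
    refine measure_mono_null ?_ (addHaar_image_null volume hC hnull)
    nth_rewrite 1 [← hTD]
    exact (image_sdiff (P.injective_moveTuple he) D s).superset
  choose! ℓ hℓ using fun (x : Fin k → Plane) (hx : x ∈ s) (i : Fin k) =>
    ((hs_mem x hx).2.2.2 i : DifferentiableAt ℝ (fun x => P.tupleTime x i) x)
  let A : (Fin k → Plane) → (Fin k → Plane) →L[ℝ] (Fin k → Plane) := fun x =>
    ContinuousLinearMap.pi fun i => ContinuousLinearMap.proj i + (ℓ x i).smulRight e
  have hA : ∀ x ∈ s, HasFDerivWithinAt T (A x) s x := by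
    intro x hx
    refine HasFDerivAt.hasFDerivWithinAt (hasFDerivAt_pi.2 fun i => ?_)
    exact (ContinuousLinearMap.proj (R := ℝ) (φ := fun _ : Fin k => Plane) i).hasFDerivAt.add
      ((hℓ x hx i).smul_const e)
  have hdet : ∀ x ∈ s, ENNReal.ofReal |(A x).det| =
      ENNReal.ofReal (P.jacobian e (Config.glue Λ Y x)) := by
    intro x hx
    obtain ⟨hxΛ, hxp, hxN, -⟩ := hs_mem x hx
    have hinj : Function.Injective x := fun i j hij => by
      by_contra hne
      have : 1 < dist (x i) (x j) := hxp hne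
      rw [hij, dist_self] at this
      linarith
    rw [det_add_smul e (ℓ x) (A x) (fun v i => rfl) (fun i => P.tupleTime x i)]
    · have : ∏ i, (1 + ℓ x i (Pi.single i e)) = P.jacobian e (Config.glue Λ Y x) := by
        rw [P.jacobian_glue he Y hxΛ hinj]
        exact Finset.prod_congr rfl fun i _ => by
          rw [P.fderiv_tupleTime_single hN Y e hxΛ hxp hxN (hℓ x hx) i]
      rw [this, abs_of_pos (P.jacobian_pos e _)]
    · intro i j hji hle
      refine P.fderiv_tupleTime_eq_zero hxp (hℓ x hx) i _ (Pi.single_eq_of_ne hji.symm _)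
        fun l hl => Pi.single_eq_of_ne (fun hlj => ?_) _
      subst hlj
      exact absurd hle (not_le.2 hl)
  rw [← setLIntegral_congr himg_ae, ← setLIntegral_congr hsD_ae,
    lintegral_image_eq_lintegral_abs_det_fderiv_mul volume hsm hA
      (P.injective_moveTuple he).injOn h]
  exact setLIntegral_congr_fun hsm fun x hx => by simp only [hdet x hx]; rfl

theorem weight_move {e : Plane} (he : ‖e‖ = 1) (z : ℝ) (X : Config) :
    weight z Λ (P.move e X) = weight z Λ X := by
  have hcard : ((P.move e X).carrier ∩ Λ).ncard = (X.carrier ∩ Λ).ncard := by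
    rw [(P.isShift he).shift_inter P.bounded]
    refine InjOn.ncard_image fun x hx y hy hxy => ?_
    refine (P.isDualShift he).injOn (P.isShift he) (P.isShift_dual he) P.bounded X hx.1 hy.1 ?_
    simpa only [shiftPoint, shiftTime_of_mem _ _ _ _ hx.2, shiftTime_of_mem _ _ _ _ hy.2] using hxy
  classical
  simp only [weight, indicator, P.move_mem_hardCore_iff he, hcard]

end Profile

theorem measurable_weight (z : ℝ) {Λ : Set Plane} (hΛ : MeasurableSet Λ) :
    Measurable (weight z Λ) :=
  ((measurable_from_top (f := fun k : ℕ => ENNReal.ofReal z ^ k)).comp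
    (measurable_ncard_inter hΛ)).indicator measurableSet_hardCore

theorem lintegral_poisson {Λ : Set Plane} (Y : Config) {f : Config → ℝ≥0∞}
    (hf : Measurable f) :
    ∫⁻ X, f X ∂(poisson Λ Y) = ENNReal.ofReal (Real.exp (-(volume Λ).toReal)) *
      ∑' k : ℕ, ((k.factorial : ℝ≥0∞)⁻¹) *
        ∫⁻ x in tuplesIn Λ k, f (Config.glue Λ Y x) := by
  rw [poisson, lintegral_smul_measure, lintegral_sum_measure, smul_eq_mul]
  congr 1
  refine tsum_congr fun k => ?_
  rw [lintegral_smul_measure, smul_eq_mul, lintegral_map hf (measurable_glue Λ Y k),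
    ← Measure.restrict_pi_pi, volume_pi]
  have : (univ.pi fun _ : Fin k => Λ) = tuplesIn Λ k := by
    ext x
    simp only [mem_pi, mem_univ, true_imp_iff]
    rfl
  rw [this]

theorem setLIntegral_weight {Λ : Set Plane} (hΛ : MeasurableSet Λ) (Y : Config) (z : ℝ) (k : ℕ)
    (f : (Fin k → Plane) → ℝ≥0∞) :
    ∫⁻ x in tuplesIn Λ k, f x * weight z Λ (Config.glue Λ Y x) =
      ∫⁻ x in hardTuples Λ Y k, f x * weight z Λ (Config.glue Λ Y x) := by
  have hD := measurableSet_hardTuples hΛ Y k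
  have hΛk := measurableSet_tuplesIn hΛ k
  rw [← lintegral_indicator hΛk, ← lintegral_indicator hD]
  refine lintegral_congr fun x => ?_
  by_cases hx : x ∈ tuplesIn Λ k
  · by_cases hc : Config.glue Λ Y x ∈ hardCore
    · rw [indicator_of_mem (show x ∈ hardTuples Λ Y k from ⟨hx, hc⟩), indicator_of_mem hx]
    · rw [indicator_of_notMem (fun h : x ∈ hardTuples Λ Y k => hc h.2), indicator_of_mem hx,
        weight, indicator_of_notMem hc, mul_zero]
  · rw [indicator_of_notMem (fun h : x ∈ hardTuples Λ Y k => hx h.1),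
      indicator_of_notMem hx]

namespace Profile

variable {Λ : Set Plane} (P : Profile Λ)

theorem lintegral_move {N : Set Plane} (hN : P.SmoothOff N) {e : Plane} (he : ‖e‖ = 1)
    (Y : Config) (z : ℝ) {f : Config → ℝ≥0∞} (hf : Measurable f) :
    ∫⁻ X, f X * weight z Λ X ∂(poisson Λ Y) =
      ∫⁻ X, ENNReal.ofReal (P.jacobian e X) * f (P.move e X) * weight z Λ X ∂(poisson Λ Y) := by
  have hw := measurable_weight z P.measurableSet
  rw [lintegral_poisson (f := fun X => f X * weight z Λ X) Y (hf.mul hw), lintegral_poisson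
    (f := fun X => ENNReal.ofReal (P.jacobian e X) * f (P.move e X) * weight z Λ X) Y
    (((P.measurable_jacobian e).ennreal_ofReal.mul (hf.comp (P.measurable_move he))).mul hw)]
  congr 1
  refine tsum_congr fun k => ?_
  congr 1
  rw [setLIntegral_weight P.measurableSet Y z k (fun x => f (Config.glue Λ Y x)),
    setLIntegral_weight P.measurableSet Y z k
      (fun x => ENNReal.ofReal (P.jacobian e (Config.glue Λ Y x)) *
        f (P.move e (Config.glue Λ Y x))),
    P.lintegral_hardTuples hN he Y k]
  refine setLIntegral_congr_fun (measurableSet_hardTuples P.measurableSet Y k) fun x hx => ?_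
  rw [P.glue_moveTuple Y e hx.1, P.weight_move he, mul_assoc]

theorem isImageDensity {N : Set Plane} (hN : P.SmoothOff N) {e : Plane} (he : ‖e‖ = 1)
    (Y : Config) (z : ℝ) : IsImageDensity (gibbs z Λ Y) (P.move e) (P.jacobian e) := by
  have hmove := P.measurable_move he
  have hjac := P.measurable_jacobian e
  have hg : Measurable fun X => P.jacobian e (P.unmove e X) := hjac.comp (P.measurable_unmove he)
  refine ⟨fun X => P.jacobian e (P.unmove e X), hg, fun X => (P.jacobian_pos e _).le, ?_,
    fun X => by simp only [P.unmove_move he]⟩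
  have hw := measurable_weight z P.measurableSet
  ext A hA
  rw [withDensity_apply _ hA, ← lintegral_indicator hA,
    lintegral_map (hg.ennreal_ofReal.indicator hA) hmove]
  rw [gibbs, lintegral_smul_measure, Measure.smul_apply, withDensity_apply _ hA,
    ← lintegral_indicator hA,
    lintegral_withDensity_eq_lintegral_mul (g := fun X => A.indicator
      (fun x => ENNReal.ofReal (P.jacobian e (P.unmove e x))) (P.move e X)) _ hw ((hg.ennreal_ofReal.indicator hA).comp hmove)]
  congr 1
  have h := P.lintegral_move hN he Y z (f := A.indicator 1) (measurable_one.indicator hA)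
  convert h using 1
  · refine lintegral_congr fun X => ?_
    by_cases hX : X ∈ A <;> simp [hX]
  · refine lintegral_congr fun X => ?_
    by_cases hX : P.move e X ∈ A
    · simp [hX, P.unmove_move he, mul_comm]
    · simp [hX]

end Profile

end HardDisk
end

noncomputable section

namespace HardDisk

open ProbabilityTheory

section Gibbs

/-- Injective hard-core tuples. -/
def properTuples (Λ : Set Plane) (Y : Config) (k : ℕ) : Set (Fin k → Plane) :=
  hardTuples Λ Y k ∩ {x | Function.Injective x}

theorem properTuples_ae_eq (Λ : Set Plane) (Y : Config) (k : ℕ) :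
    properTuples Λ Y k =ᵐ[volume] hardTuples Λ Y k := by
  refine Filter.EventuallyLE.antisymm (Filter.Eventually.of_forall inter_subset_left) ?_
  filter_upwards [ae_injective k] with x hx h
  exact ⟨h, hx⟩

theorem measurableSet_properTuples {Λ : Set Plane} (hΛ : MeasurableSet Λ) (Y : Config) (k : ℕ) :
    MeasurableSet (properTuples Λ Y k) := by
  refine (measurableSet_hardTuples hΛ Y k).inter ?_
  have : {x : Fin k → Plane | Function.Injective x} =
      ⋂ i, ⋂ j, ⋂ _ : i ≠ j, {x | x i = x j}ᶜ := by
    ext x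
    simp only [mem_iInter, mem_compl_iff, mem_ofPred_eq, Function.Injective]
    exact ⟨fun h i j hij hx => hij (h hx), fun h i j hx => by_contra fun hij => h i j hij hx⟩
  rw [this]
  exact MeasurableSet.iInter fun i => MeasurableSet.iInter fun j => MeasurableSet.iInter fun _ =>
    (measurableSet_eq_fun (measurable_pi_apply i) (measurable_pi_apply j)).compl

theorem one_lt_dist_of_mem_properTuples {Λ : Set Plane} {Y : Config} {k : ℕ} {x : Fin k → Plane}
    (hx : x ∈ properTuples Λ Y k) {i j : Fin k} (hij : i ≠ j) : 1 < dist (x i) (x j) :=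
  hx.1.2 _ (Or.inl ⟨i, rfl⟩) _ (Or.inl ⟨j, rfl⟩) (hx.2.ne hij)

theorem weight_glue {Λ : Set Plane} {Y : Config} {k : ℕ} {x : Fin k → Plane} (z : ℝ)
    (hx : x ∈ properTuples Λ Y k) :
    weight z Λ (Config.glue Λ Y x) = ENNReal.ofReal z ^ k := by
  rw [weight, indicator_of_mem (show _ ∈ hardCore from hx.1.2), glue_inter Y hx.1.1, ← image_univ,
    InjOn.ncard_image hx.2.injOn]
  simp

/-- The unnormalized expectation of a function of the particles in `Λ`. -/
def hardSum (z : ℝ) (Λ : Set Plane) (Y : Config) (B : (k : ℕ) → (Fin k → Plane) → ℝ≥0∞) : ℝ≥0∞ :=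
  ∑' k : ℕ, (k.factorial : ℝ≥0∞)⁻¹ * (ENNReal.ofReal z ^ k * ∫⁻ x in properTuples Λ Y k, B k x)

theorem lintegral_weight_poisson (z : ℝ) {Λ : Set Plane} (hΛ : MeasurableSet Λ) (Y : Config)
    {f : Config → ℝ≥0∞} (hf : Measurable f) :
    ∫⁻ X, f X * weight z Λ X ∂(poisson Λ Y) =
      ENNReal.ofReal (Real.exp (-(volume Λ).toReal)) *
        hardSum z Λ Y fun _ x => f (Config.glue Λ Y x) := by
  have hw := measurable_weight z hΛ
  rw [lintegral_poisson (f := fun X => f X * weight z Λ X) Y (hf.mul hw), hardSum]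
  congr 1
  refine tsum_congr fun k => ?_
  congr 1
  rw [setLIntegral_weight hΛ Y z k (fun x => f (Config.glue Λ Y x)),
    ← setLIntegral_congr (properTuples_ae_eq Λ Y k),
    ← lintegral_const_mul (f := fun x => f (Config.glue Λ Y x)) _
      (hf.comp (measurable_glue Λ Y k))]
  refine setLIntegral_congr_fun (measurableSet_properTuples hΛ Y k) fun x hx => ?_
  simp only [weight_glue z hx, mul_comm]

theorem partitionFn_eq (z : ℝ) {Λ : Set Plane} (hΛ : MeasurableSet Λ) (Y : Config) :
    partitionFn z Λ Y = ENNReal.ofReal (Real.exp (-(volume Λ).toReal)) *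
      hardSum z Λ Y fun _ _ => 1 := by
  rw [partitionFn, ← lintegral_weight_poisson z hΛ Y measurable_const]
  simp

theorem lintegral_gibbs (z : ℝ) {Λ : Set Plane} (hΛ : MeasurableSet Λ) (Y : Config)
    {f : Config → ℝ≥0∞} (hf : Measurable f) :
    ∫⁻ X, f X ∂(gibbs z Λ Y) = (partitionFn z Λ Y)⁻¹ *
      (ENNReal.ofReal (Real.exp (-(volume Λ).toReal)) *
        hardSum z Λ Y fun _ x => f (Config.glue Λ Y x)) := by
  rw [gibbs, lintegral_smul_measure, lintegral_withDensity_eq_lintegral_mul _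
    (measurable_weight z hΛ) hf, smul_eq_mul, ← lintegral_weight_poisson z hΛ Y hf]
  simp only [Pi.mul_apply, mul_comm]

theorem hardSum_mono (z : ℝ) {Λ : Set Plane} (hΛ : MeasurableSet Λ) (Y : Config)
    {B B' : (k : ℕ) → (Fin k → Plane) → ℝ≥0∞}
    (h : ∀ k, ∀ x ∈ properTuples Λ Y k, B k x ≤ B' k x) :
    hardSum z Λ Y B ≤ hardSum z Λ Y B' := by
  refine ENNReal.tsum_le_tsum fun k => ?_
  gcongr 2
  exact setLIntegral_mono' (measurableSet_properTuples hΛ Y k) (h k)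

theorem hardSum_const (z : ℝ) (Λ : Set Plane) (Y : Config) (C : ℝ≥0∞) :
    hardSum z Λ Y (fun _ _ => C) = C * hardSum z Λ Y fun _ _ => 1 := by
  simp only [hardSum]
  rw [← ENNReal.tsum_mul_left]
  refine tsum_congr fun k => ?_
  simp only [setLIntegral_const]
  ring

theorem lintegral_gibbs_le (z : ℝ) {Λ : Set Plane} (hΛ : MeasurableSet Λ) (Y : Config)
    {f : Config → ℝ≥0∞} (hf : Measurable f) {C : ℝ≥0∞}
    (h : (hardSum z Λ Y fun _ x => f (Config.glue Λ Y x)) ≤ C * hardSum z Λ Y fun _ _ => 1) :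
    ∫⁻ X, f X ∂(gibbs z Λ Y) ≤ C := by
  rw [lintegral_gibbs z hΛ Y hf]
  calc _ ≤ (partitionFn z Λ Y)⁻¹ * (ENNReal.ofReal (Real.exp (-(volume Λ).toReal)) *
        (C * hardSum z Λ Y fun _ _ => 1)) := by gcongr
    _ = C * ((partitionFn z Λ Y)⁻¹ * partitionFn z Λ Y) := by
        rw [partitionFn_eq z hΛ Y]; ring
    _ ≤ C := mul_le_of_le_one_right bot_le (ENNReal.inv_mul_le_one _)

theorem gibbs_univ_le (z : ℝ) {Λ : Set Plane} (hΛ : MeasurableSet Λ) (Y : Config) :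
    gibbs z Λ Y univ ≤ 1 := by
  rw [← lintegral_one]
  exact lintegral_gibbs_le z hΛ Y measurable_const (by rw [one_mul])

theorem gibbs_le_of_hardSum (z : ℝ) {Λ : Set Plane} (hΛ : MeasurableSet Λ) (Y : Config)
    {A : Set Config} (hA : MeasurableSet A) {B : (k : ℕ) → (Fin k → Plane) → ℝ≥0∞} {C : ℝ≥0∞}
    (hAB : ∀ k, ∀ x ∈ properTuples Λ Y k, Config.glue Λ Y x ∈ A → 1 ≤ B k x)
    (hB : hardSum z Λ Y B ≤ C * hardSum z Λ Y fun _ _ => 1) : gibbs z Λ Y A ≤ C := by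
  rw [← lintegral_indicator_one hA]
  refine lintegral_gibbs_le z hΛ Y (measurable_one.indicator hA) (le_trans ?_ hB)
  refine hardSum_mono z hΛ Y fun k x hx => ?_
  by_cases h : Config.glue Λ Y x ∈ A
  · rw [indicator_of_mem h]
    exact hAB k x hx h
  · rw [indicator_of_notMem h]
    exact bot_le

theorem ae_gibbs_mem_hardCore (z : ℝ) {Λ : Set Plane} (hΛ : MeasurableSet Λ) (Y : Config) :
    ∀ᵐ X ∂(gibbs z Λ Y), X ∈ hardCore := by
  have h : gibbs z Λ Y hardCoreᶜ ≤ 0 := by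
    refine gibbs_le_of_hardSum z hΛ Y measurableSet_hardCore.compl (B := fun _ _ => 0)
      (fun k x hx h => absurd hx.1.2 h) ?_
    rw [hardSum_const]
  exact le_antisymm h bot_le

end Gibbs

section Chains

variable (g a : Plane → ℝ≥0∞)

/-- The sum over chains of `j` further distinct particles of `x`, starting from the particle `p`;
each step `v` has the weight `g v`, and the last particle `q` of the chain the weight `a q`. -/
def chainSum : ℕ → (k : ℕ) → Plane → (Fin k → Plane) → ℝ≥0∞
  | 0, _, p, _ => a p
  | _ + 1, 0, _, _ => 0
  | j + 1, k + 1, p, x => ∑ i, g (p - x i) * chainSum j k (x i) (i.removeNth x)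

/-- The sum over chains of `j + 1` distinct particles of `x`. -/
def chainTotal (j : ℕ) : (k : ℕ) → (Fin k → Plane) → ℝ≥0∞
  | 0, _ => 0
  | k + 1, x => ∑ i, chainSum g a j k (x i) (i.removeNth x)

variable {g a}

theorem measurable_removeNth {k : ℕ} (i : Fin (k + 1)) :
    Measurable fun x : Fin (k + 1) → Plane => (i.removeNth x : Fin k → Plane) :=
  measurable_pi_lambda _ fun _ => measurable_pi_apply _

theorem measurable_chainSum (hg : Measurable g) (ha : Measurable a) (j : ℕ) :
    ∀ k, Measurable fun q : Plane × (Fin k → Plane) => chainSum g a j k q.1 q.2 := by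
  induction j with
  | zero => exact fun k => ha.comp measurable_fst
  | succ j ih =>
    intro k
    cases k with
    | zero => exact measurable_const
    | succ k =>
      refine Finset.measurable_sum _ fun i _ => ?_
      have hi : Measurable fun q : Plane × (Fin (k + 1) → Plane) => q.2 i :=
        (measurable_pi_apply i).comp measurable_snd
      exact (hg.comp (measurable_fst.sub hi)).mul
        ((ih k).comp (hi.prodMk ((measurable_removeNth i).comp measurable_snd)))

theorem lintegral_chainSum_succ (hg : Measurable g) (j k : ℕ) (x : Fin k → Plane) :
    ∫⁻ p, chainSum g a (j + 1) k p x = (∫⁻ v, g v) * chainTotal g a j k x := by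
  cases k with
  | zero => simp [chainSum, chainTotal]
  | succ k =>
    simp only [chainSum, chainTotal]
    have hgi : ∀ i, Measurable fun p => g (p - x i) := fun i =>
      hg.comp (measurable_id.sub_const (x i))
    rw [lintegral_finsetSum _ fun i _ => (hgi i).mul_const _, Finset.mul_sum]
    refine Finset.sum_congr rfl fun i _ => ?_
    rw [lintegral_mul_const _ (hgi i), lintegral_sub_right_eq_self g (x i)]

theorem removeNth_mem_properTuples {Λ : Set Plane} {Y : Config} {k : ℕ} {x : Fin (k + 1) → Plane}
    (hx : x ∈ properTuples Λ Y (k + 1)) (i : Fin (k + 1)) :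
    (i.removeNth x : Fin k → Plane) ∈ properTuples Λ Y k := by
  refine ⟨⟨fun l => hx.1.1 _, ?_⟩, fun l l' h => Fin.succAbove_right_injective (hx.2 h)⟩
  have hsub : (Config.glue Λ Y (i.removeNth x : Fin k → Plane)).carrier ⊆
      (Config.glue Λ Y x).carrier := by
    rintro p (⟨l, rfl⟩ | h)
    · exact Or.inl ⟨i.succAbove l, rfl⟩
    · exact Or.inr h
  exact fun p hp q hq hpq => hx.1.2 p (hsub hp) q (hsub hq) hpq

theorem lintegral_properTuples_succ_le {Λ : Set Plane} (hΛ : MeasurableSet Λ) (Y : Config) {k : ℕ}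
    (i : Fin (k + 1)) {f : Plane × (Fin k → Plane) → ℝ≥0∞} (hf : Measurable f) :
    ∫⁻ x in properTuples Λ Y (k + 1), f (x i, i.removeNth x) ≤
      ∫⁻ x in properTuples Λ Y k, ∫⁻ p, f (p, x) := by
  have hm := measurableSet_properTuples hΛ Y k
  have hmp := volume_preserving_piFinSuccAbove (fun _ : Fin (k + 1) => Plane) i
  let F : Plane × (Fin k → Plane) → ℝ≥0∞ := (Prod.snd ⁻¹' properTuples Λ Y k).indicator f
  have hF : Measurable F := hf.indicator (measurable_snd hm)
  calc ∫⁻ x in properTuples Λ Y (k + 1), f (x i, i.removeNth x)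
      ≤ ∫⁻ x : Fin (k + 1) → Plane, F (x i, i.removeNth x) := by
        rw [← lintegral_indicator (measurableSet_properTuples hΛ Y (k + 1))]
        refine lintegral_mono fun x => ?_
        by_cases hx : x ∈ properTuples Λ Y (k + 1)
        · rw [indicator_of_mem hx]
          simp only [F]
          rw [indicator_of_mem (show _ ∈ Prod.snd ⁻¹' properTuples Λ Y k from
            removeNth_mem_properTuples hx i)]
        · rw [indicator_of_notMem hx]
          exact bot_le
    _ = ∫⁻ q : Plane × (Fin k → Plane), F q := hmp.lintegral_comp hF
    _ = ∫⁻ x : Fin k → Plane, ∫⁻ p, F (p, x) := by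
        rw [Measure.volume_eq_prod, lintegral_prod_symm' _ hF]
    _ = ∫⁻ x in properTuples Λ Y k, ∫⁻ p, f (p, x) := by
        rw [← lintegral_indicator hm]
        refine lintegral_congr fun x => ?_
        by_cases hx : x ∈ properTuples Λ Y k
        · rw [indicator_of_mem hx]
          exact lintegral_congr fun p => indicator_of_mem (show (p, x) ∈ Prod.snd ⁻¹' _ from hx) f
        · rw [indicator_of_notMem hx, ← lintegral_zero]
          exact lintegral_congr fun p =>
            indicator_of_notMem (show (p, x) ∉ Prod.snd ⁻¹' _ from hx) f

theorem measurable_chainSum_removeNth (hg : Measurable g) (ha : Measurable a) (j k : ℕ)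
    (i : Fin (k + 1)) : Measurable fun x : Fin (k + 1) → Plane =>
      chainSum g a j k (x i) (i.removeNth x) :=
  (measurable_chainSum hg ha j k).comp ((measurable_pi_apply i).prodMk (measurable_removeNth i))

theorem lintegral_chainTotal_succ_le (hg : Measurable g) (ha : Measurable a) {Λ : Set Plane}
    (hΛ : MeasurableSet Λ) (Y : Config) (j k : ℕ) :
    ∫⁻ x in properTuples Λ Y (k + 1), chainTotal g a (j + 1) (k + 1) x ≤
      (k + 1) * ((∫⁻ v, g v) * ∫⁻ x in properTuples Λ Y k, chainTotal g a j k x) := by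
  have hm := measurable_chainSum hg ha (j + 1) k
  have hmt : Measurable fun x : Fin k → Plane => chainTotal g a j k x := by
    cases k with
    | zero => exact measurable_const
    | succ k => exact Finset.measurable_sum _ fun i _ => measurable_chainSum_removeNth hg ha j k i
  change ∫⁻ x in properTuples Λ Y (k + 1), ∑ i : Fin (k + 1),
    chainSum g a (j + 1) k (x i) (i.removeNth x) ≤ _
  rw [lintegral_finsetSum _ fun i _ => measurable_chainSum_removeNth hg ha (j + 1) k i]
  calc _ ≤ ∑ _i : Fin (k + 1), ∫⁻ x in properTuples Λ Y k,
        ∫⁻ p, chainSum g a (j + 1) k p x :=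
        Finset.sum_le_sum fun i _ => lintegral_properTuples_succ_le hΛ Y i hm
    _ = _ := by
        simp only [lintegral_chainSum_succ hg, Finset.sum_const, Finset.card_univ, Fintype.card_fin,
          nsmul_eq_mul, lintegral_const_mul _ hmt]
        push_cast
        rfl

theorem hardSum_chainTotal_succ_le (hg : Measurable g) (ha : Measurable a) (z : ℝ) {Λ : Set Plane}
    (hΛ : MeasurableSet Λ) (Y : Config) (j : ℕ) :
    hardSum z Λ Y (chainTotal g a (j + 1)) ≤
      (ENNReal.ofReal z * ∫⁻ v, g v) * hardSum z Λ Y (chainTotal g a j) := by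
  rw [hardSum, tsum_eq_zero_add' ENNReal.summable]
  have h0 : ∫⁻ x in properTuples Λ Y 0, chainTotal g a (j + 1) 0 x = 0 := lintegral_zero
  rw [h0, mul_zero, mul_zero, zero_add, hardSum, ← ENNReal.tsum_mul_left]
  refine ENNReal.tsum_le_tsum fun k => ?_
  have h := lintegral_chainTotal_succ_le hg ha hΛ Y j k
  calc _ ≤ ((k + 1).factorial : ℝ≥0∞)⁻¹ * (ENNReal.ofReal z ^ (k + 1) *
        ((k + 1) * ((∫⁻ v, g v) * ∫⁻ x in properTuples Λ Y k, chainTotal g a j k x))) := by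
        gcongr
    _ = (((k + 1).factorial : ℝ≥0∞)⁻¹ * (k + 1)) * (ENNReal.ofReal z * ∫⁻ v, g v) *
        (ENNReal.ofReal z ^ k * ∫⁻ x in properTuples Λ Y k, chainTotal g a j k x) := by
        rw [pow_succ]; ring
    _ = _ := by
        have : ((k + 1).factorial : ℝ≥0∞)⁻¹ * (k + 1) = (k.factorial : ℝ≥0∞)⁻¹ := by
          rw [Nat.factorial_succ, Nat.cast_mul, ENNReal.mul_inv (Or.inr (by simp)) (Or.inr
            (by simpa using k.factorial_ne_zero)), mul_right_comm]
          push_cast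
          rw [ENNReal.inv_mul_cancel (by positivity) (by finiteness), one_mul]
        rw [this]
        ring

theorem hardSum_chainTotal_le (hg : Measurable g) (ha : Measurable a) (z : ℝ) {Λ : Set Plane}
    (hΛ : MeasurableSet Λ) (Y : Config) (j : ℕ) :
    hardSum z Λ Y (chainTotal g a j) ≤
      (ENNReal.ofReal z * ∫⁻ v, g v) ^ j * hardSum z Λ Y (chainTotal g a 0) := by
  induction j with
  | zero => simp
  | succ j ih =>
    refine (hardSum_chainTotal_succ_le hg ha z hΛ Y j).trans ?_
    rw [pow_succ', mul_assoc (ENNReal.ofReal z * ∫⁻ v, g v)]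
    exact mul_le_mul_right ih _

theorem prod_le_chainSum (j : ℕ) : ∀ (k : ℕ) (x : Fin k → Plane) (y : ℕ → Plane),
    (∀ i, 1 ≤ i → i ≤ j → y i ∈ range x) → (∀ i i', 1 ≤ i → i < i' → i' ≤ j → y i ≠ y i') →
    (∏ i ∈ Finset.range j, g (y i - y (i + 1))) * a (y j) ≤ chainSum g a j k (y 0) x := by
  induction j with
  | zero => intro k x y _ _; simp [chainSum]
  | succ j ih =>
    intro k x y hy hinj
    obtain ⟨l, hl⟩ := hy 1 le_rfl (by omega)
    cases k with
    | zero => exact l.elim0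
    | succ k =>
      rw [Finset.prod_range_succ', mul_right_comm]
      have h := ih k (l.removeNth x) (fun i => y (i + 1)) (fun i h1 h2 => ?_)
        fun i i' h1 h2 h3 => hinj _ _ (by omega) (by omega) (by omega)
      · simp only [chainSum]
        refine le_trans ?_ (Finset.single_le_sum (f := fun i => g (y 0 - x i) *
          chainSum g a j k (x i) (i.removeNth x)) (fun _ _ => bot_le) (Finset.mem_univ l))
        simp only [hl, mul_comm (g (y 0 - y 1))]
        gcongr
      · obtain ⟨l', hl'⟩ := hy (i + 1) (by omega) (by omega)
        have hne : l' ≠ l := fun h => hinj 1 (i + 1) le_rfl (by omega) (by omega)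
          (by rw [← hl, ← hl', h])
        obtain ⟨l'', rfl⟩ := Fin.exists_succAbove_eq hne
        exact ⟨l'', hl'⟩

theorem prod_le_chainTotal (j k : ℕ) (x : Fin k → Plane) (y : ℕ → Plane)
    (hy : ∀ i ≤ j, y i ∈ range x) (hinj : ∀ i i', i < i' → i' ≤ j → y i ≠ y i') :
    (∏ i ∈ Finset.range j, g (y i - y (i + 1))) * a (y j) ≤ chainTotal g a j k x := by
  obtain ⟨l, hl⟩ := hy 0 (Nat.zero_le _)
  cases k with
  | zero => exact l.elim0
  | succ k =>
    have h := prod_le_chainSum (g := g) (a := a) j k (l.removeNth x) y (fun i h1 h2 => ?_)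
      fun i i' _ h2 h3 => hinj i i' h2 h3
    · refine h.trans ?_
      rw [← hl]
      exact Finset.single_le_sum (f := fun i => chainSum g a j k (x i) (i.removeNth x))
        (fun _ _ => bot_le) (Finset.mem_univ l)
    · obtain ⟨l', hl'⟩ := hy i h2
      have hne : l' ≠ l := fun h => hinj 0 i (by omega) h2 (by rw [← hl, ← hl', h])
      obtain ⟨l'', rfl⟩ := Fin.exists_succAbove_eq hne
      exact ⟨l'', hl'⟩

end Chains

section Packing

theorem volume_ball_half (x : Plane) :
    volume (Metric.ball x (1 / 2)) = ENNReal.ofReal (Real.pi / 4) := by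
  rw [EuclideanSpace.volume_ball_fin_two, ← ENNReal.ofReal_pow (by norm_num),
    ← NNReal.coe_real_pi, ← ENNReal.ofReal_mul (by norm_num)]
  congr 1
  ring

theorem sum_mul_le_lintegral {A : Finset Plane}
    (hA : ∀ x ∈ A, ∀ y ∈ A, x ≠ y → 1 < dist x y) {f h : Plane → ℝ≥0∞}
    (hfh : ∀ x ∈ A, ∀ p ∈ Metric.ball x (1 / 2), f x ≤ h p) :
    (∑ x ∈ A, f x) * ENNReal.ofReal (Real.pi / 4) ≤ ∫⁻ p, h p := by
  have hd : (A : Set Plane).PairwiseDisjoint fun x => Metric.ball x (1 / 2) := by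
    intro x hx y hy hxy
    refine Metric.ball_disjoint_ball ?_
    linarith [hA x hx y hy hxy]
  calc _ = ∑ x ∈ A, ∫⁻ _ in Metric.ball x (1 / 2), f x := by
        rw [Finset.sum_mul]
        exact Finset.sum_congr rfl fun x _ => by rw [setLIntegral_const, volume_ball_half]
    _ ≤ ∑ x ∈ A, ∫⁻ p in Metric.ball x (1 / 2), h p :=
        Finset.sum_le_sum fun x hx => setLIntegral_mono' measurableSet_ball (hfh x hx)
    _ = ∫⁻ p in ⋃ x ∈ A, Metric.ball x (1 / 2), h p :=
        (lintegral_biUnion_finset hd (fun _ _ => measurableSet_ball) h).symm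
    _ ≤ ∫⁻ p, h p := setLIntegral_le_lintegral _ _

end Packing

end HardDisk
end

noncomputable section

namespace HardDisk

/-- Parameters of the logarithmic profile. -/
structure LogParams where
  r : ℝ
  R : ℝ
  c : ℝ
  σ : ℝ
  one_le_r : 1 ≤ r
  r_lt_R : r < R
  c_pos : 0 < c
  c_le : c ≤ σ
  σ_le : σ ≤ r / 2

namespace LogParams

variable (p : LogParams)

/-- The truncated distance to the origin. -/
def w (x : Plane) : ℝ := max ‖x‖ p.r

/-- The logarithmic base profile. -/
def base (x : Plane) : ℝ := max 0 (p.c * Real.log (p.R / p.w x))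

/-- The logarithmic slack. -/
def slack (y x : Plane) : ℝ := p.σ * Real.log (1 + max 0 (dist y x - 1) / p.w x)

theorem r_pos : 0 < p.r := by linarith [p.one_le_r]

theorem R_pos : 0 < p.R := p.r_pos.trans p.r_lt_R

theorem σ_pos : 0 < p.σ := p.c_pos.trans_le p.c_le

theorem r_le_w (x : Plane) : p.r ≤ p.w x := le_max_right _ _

theorem norm_le_w (x : Plane) : ‖x‖ ≤ p.w x := le_max_left _ _

theorem w_pos (x : Plane) : 0 < p.w x := p.r_pos.trans_le (p.r_le_w x)

theorem w_le_add (x x' : Plane) : p.w x' ≤ p.w x + dist x x' := by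
  have h : ‖x'‖ ≤ ‖x‖ + dist x x' := by
    rw [dist_comm, dist_eq_norm]
    linarith [norm_sub_norm_le x' x]
  exact max_le (h.trans (by linarith [p.norm_le_w x]))
    (by linarith [p.r_le_w x, dist_nonneg (x := x) (y := x')])

theorem base_nonneg (x : Plane) : 0 ≤ p.base x := le_max_left _ _

theorem le_base (x : Plane) : p.c * Real.log (p.R / p.w x) ≤ p.base x := le_max_right _ _

theorem base_sub_le (x x' : Plane) : p.base x - p.base x' ≤ p.σ / p.w x * dist x x' := by
  have hpos : 0 ≤ p.σ / p.w x * dist x x' :=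
    mul_nonneg (div_nonneg p.σ_pos.le (p.w_pos x).le) dist_nonneg
  rcases max_cases 0 (p.c * Real.log (p.R / p.w x)) with h | h
  · have : p.base x = 0 := h.1
    linarith [p.base_nonneg x']
  · have h1 : p.base x = p.c * Real.log (p.R / p.w x) := h.1
    have h2 := p.le_base x'
    have h3 : Real.log (p.R / p.w x) - Real.log (p.R / p.w x') = Real.log (p.w x' / p.w x) := by
      rw [Real.log_div p.R_pos.ne' (p.w_pos x).ne', Real.log_div p.R_pos.ne' (p.w_pos x').ne',
        Real.log_div (p.w_pos x').ne' (p.w_pos x).ne']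
      ring
    have h4 : Real.log (p.w x' / p.w x) ≤ dist x x' / p.w x := by
      refine (Real.log_le_sub_one_of_pos (div_pos (p.w_pos x') (p.w_pos x))).trans ?_
      rw [div_sub_one (p.w_pos x).ne', div_le_div_iff_of_pos_right (p.w_pos x)]
      linarith [p.w_le_add x x']
    have h5 : p.c * (dist x x' / p.w x) ≤ p.σ * (dist x x' / p.w x) :=
      mul_le_mul_of_nonneg_right p.c_le (div_nonneg dist_nonneg (p.w_pos x).le)
    calc p.base x - p.base x' ≤ p.c * Real.log (p.w x' / p.w x) := by
          rw [← h3]; linarith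
      _ ≤ p.c * (dist x x' / p.w x) := mul_le_mul_of_nonneg_left h4 p.c_pos.le
      _ ≤ p.σ * (dist x x' / p.w x) := h5
      _ = p.σ / p.w x * dist x x' := by ring

theorem slack_nonneg (y x : Plane) : 0 ≤ p.slack y x :=
  mul_nonneg p.σ_pos.le (Real.log_nonneg
    (le_add_of_nonneg_right (div_nonneg (le_max_left _ _) (p.w_pos x).le)))

theorem one_add_pos {d w : ℝ} (hd : 0 ≤ d) (hw : 0 < w) : 0 < 1 + d / w := by positivity

theorem slack_sub_le (y x y' x' : Plane) :
    p.slack y x - p.slack y' x' ≤ p.σ / p.w x * (dist y y' + dist x x') := by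
  set d := max 0 (dist y x - 1)
  set d' := max 0 (dist y' x' - 1)
  set h := dist y y' + dist x x'
  have hh : 0 ≤ h := add_nonneg dist_nonneg dist_nonneg
  have hw := p.w_pos x
  have hw' := p.w_pos x'
  have hd0 : 0 ≤ d := le_max_left _ _
  have hd0' : 0 ≤ d' := le_max_left _ _
  have hd : d ≤ d' + h := by
    refine max_le (by linarith) ?_
    have h1 : dist y x ≤ dist y y' + dist y' x' + dist x' x := dist_triangle4 _ _ _ _
    rw [dist_comm x' x] at h1
    linarith [le_max_right 0 (dist y' x' - 1)]
  have hww : p.w x' ≤ p.w x + h := (p.w_le_add x x').trans (by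
    linarith [dist_nonneg (x := y) (y := y')])
  have key : 1 + d / p.w x ≤ (1 + d' / p.w x') * (1 + h / p.w x) := by
    have h1 : d' / (p.w x + h) ≤ d' / p.w x' := div_le_div_of_nonneg_left hd0' hw' hww
    have h2 : (1 + d' / (p.w x + h)) * (1 + h / p.w x) = 1 + (d' + h) / p.w x := by
      field_simp
      ring
    calc 1 + d / p.w x ≤ 1 + (d' + h) / p.w x := by gcongr
      _ = (1 + d' / (p.w x + h)) * (1 + h / p.w x) := h2.symm
      _ ≤ _ := by gcongr
  have hlog : Real.log (1 + d / p.w x) - Real.log (1 + d' / p.w x') ≤ h / p.w x := by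
    have h1 := Real.log_le_log (one_add_pos hd0 hw) key
    rw [Real.log_mul (one_add_pos hd0' hw').ne' (one_add_pos hh hw).ne'] at h1
    have h2 := Real.log_le_sub_one_of_pos (one_add_pos hh hw)
    linarith
  calc p.slack y x - p.slack y' x'
      = p.σ * (Real.log (1 + d / p.w x) - Real.log (1 + d' / p.w x')) := by
        simp only [slack]; ring
    _ ≤ p.σ * (h / p.w x) := mul_le_mul_of_nonneg_left hlog p.σ_pos.le
    _ = _ := by ring

theorem div_w_le (x : Plane) : p.σ / p.w x ≤ p.σ / p.r :=
  div_le_div_of_nonneg_left p.σ_pos.le p.r_pos (p.r_le_w x)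

/-- The logarithmic profile in the box `Λ_n`. -/
def profile (n : ℝ) (hn : p.R + 1 ≤ n) : Profile (box n) where
  τ := p.base
  F := p.slack
  ρ := p.σ / p.r
  ρ_le := by
    rw [div_le_iff₀ p.r_pos]
    linarith [p.σ_le]
  τ_nonneg := p.base_nonneg
  τ_lip x x' := by
    have h1 := p.base_sub_le x x'
    have h2 := p.base_sub_le x' x
    have h3 := mul_le_mul_of_nonneg_right (p.div_w_le x) (dist_nonneg (x := x) (y := x'))
    have h4 := mul_le_mul_of_nonneg_right (p.div_w_le x') (dist_nonneg (x := x) (y := x'))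
    rw [dist_comm] at h2
    exact abs_le.2 ⟨by linarith, by linarith⟩
  τ_off x hx := by
    have h1 : n < ‖x‖ := by
      by_contra! h
      exact hx (mem_box_of_norm_le h)
    refine max_eq_left (mul_nonpos_of_nonneg_of_nonpos p.c_pos.le ?_)
    refine Real.log_nonpos (div_pos p.R_pos (p.w_pos x)).le ?_
    rw [div_le_one (p.w_pos x)]
    linarith [p.norm_le_w x]
  τ_le_F y hy x := by
    have h1 : n < ‖y‖ := by
      by_contra! h
      exact hy (mem_box_of_norm_le h)
    refine max_le (p.slack_nonneg y x) ?_
    have hw := p.w_pos x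
    have h2 : p.R / p.w x ≤ 1 + max 0 (dist y x - 1) / p.w x := by
      rw [div_le_iff₀ hw, add_mul, div_mul_cancel₀ _ hw.ne']
      have h3 : ‖y‖ ≤ ‖x‖ + dist y x := by
        rw [dist_eq_norm]
        linarith [norm_sub_norm_le y x]
      linarith [le_max_right 0 (dist y x - 1), p.norm_le_w x]
    have h3 := Real.log_le_log (div_pos p.R_pos hw) h2
    have h4 : 0 ≤ Real.log (1 + max 0 (dist y x - 1) / p.w x) := Real.log_nonneg
      (le_add_of_nonneg_right (div_nonneg (le_max_left _ _) hw.le))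
    calc _ ≤ p.c * Real.log (1 + max 0 (dist y x - 1) / p.w x) :=
          mul_le_mul_of_nonneg_left h3 p.c_pos.le
      _ ≤ _ := mul_le_mul_of_nonneg_right p.c_le h4
  F_nonneg := p.slack_nonneg
  F_pos y x h := by
    refine mul_pos p.σ_pos (Real.log_pos ?_)
    have : 0 < max 0 (dist y x - 1) / p.w x :=
      div_pos (lt_max_of_lt_right (by linarith)) (p.w_pos x)
    linarith
  F_eq_zero y x h := by
    rw [slack, max_eq_left (by linarith)]
    simp
  F_le y x h := by
    have h1 := p.slack_nonneg y x
    have hd : 0 ≤ (dist y x - 1) / p.w x := div_nonneg (by linarith) (p.w_pos x).le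
    rw [slack, max_eq_right (by linarith)]
    have h2 := Real.log_le_sub_one_of_pos (show 0 < 1 + (dist y x - 1) / p.w x by linarith)
    calc _ ≤ p.σ * ((dist y x - 1) / p.w x) :=
          mul_le_mul_of_nonneg_left (by linarith) p.σ_pos.le
      _ = p.σ / p.w x * (dist y x - 1) := by ring
      _ ≤ _ := mul_le_mul_of_nonneg_right (p.div_w_le x) (by linarith)
  F_lip y x y' x' := by
    have hd : 0 ≤ dist y y' + dist x x' := add_nonneg dist_nonneg dist_nonneg
    have h1 := p.slack_sub_le y x y' x'
    have h2 := p.slack_sub_le y' x' y x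
    have h3 := mul_le_mul_of_nonneg_right (p.div_w_le x) hd
    have h4 := mul_le_mul_of_nonneg_right (p.div_w_le x') hd
    rw [dist_comm y' y, dist_comm x' x] at h2
    exact abs_le.2 ⟨by linarith, by linarith⟩
  stay e he x hx s hs hs' := by
    rcases max_cases 0 (p.c * Real.log (p.R / p.w x)) with h | h
    · have h1 : p.base x = 0 := h.1
      have : s = 0 := le_antisymm (h1 ▸ hs') hs
      simpa [this] using hx
    · have h1 : p.base x = p.c * Real.log (p.R / p.w x) := h.1
      have hw := p.w_pos x
      have h2 := Real.log_le_sub_one_of_pos (div_pos p.R_pos hw)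
      have h3 : 1 < p.R / p.w x := by
        by_contra! hle
        have := Real.log_nonpos (div_pos p.R_pos hw).le hle
        nlinarith [h.2, p.c_pos]
      have h4 : p.w x < p.R := by rwa [one_lt_div hw] at h3
      have h5 : s ≤ p.R - p.w x := by
        have h6 : p.c ≤ p.w x := by linarith [p.c_le, p.σ_le, p.r_le_w x, p.r_pos]
        calc s ≤ p.c * (p.R / p.w x - 1) :=
              (h1 ▸ hs').trans (mul_le_mul_of_nonneg_left h2 p.c_pos.le)
          _ ≤ p.w x * (p.R / p.w x - 1) := mul_le_mul_of_nonneg_right h6 (by linarith)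
          _ = p.R - p.w x := by field_simp
      refine mem_box_of_norm_le ((norm_add_le _ _).trans ?_)
      rw [norm_smul, he, mul_one, Real.norm_eq_abs, abs_of_nonneg hs]
      linarith [p.norm_le_w x]
  bounded := isBounded_box n
  measurableSet := measurableSet_box n

theorem continuous_w : Continuous p.w := continuous_norm.max continuous_const

theorem differentiableAt_w {x : Plane} (hx : ‖x‖ ≠ p.r) : DifferentiableAt ℝ p.w x := by
  rcases lt_or_gt_of_ne hx with h | h
  · have : p.w =ᶠ[nhds x] fun _ => p.r := by
      filter_upwards [continuous_norm.continuousAt.eventually_lt continuousAt_const h] with y hy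
      exact max_eq_right hy.le
    exact (differentiableAt_const _).congr_of_eventuallyEq this
  · have : p.w =ᶠ[nhds x] fun y => ‖y‖ := by
      filter_upwards [continuousAt_const.eventually_lt continuous_norm.continuousAt h] with y hy
      exact max_eq_left hy.le
    have hx0 : x ≠ 0 := by
      rintro rfl
      rw [norm_zero] at h
      linarith [p.r_pos]
    exact (differentiableAt_id.norm ℝ hx0).congr_of_eventuallyEq this

theorem base_eventuallyEq_zero {x : Plane} (hx : p.R < ‖x‖) : p.base =ᶠ[nhds x] fun _ => 0 := by
  filter_upwards [continuousAt_const.eventually_lt continuous_norm.continuousAt hx] with y hy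
  refine max_eq_left (mul_nonpos_of_nonneg_of_nonpos p.c_pos.le ?_)
  refine Real.log_nonpos (div_pos p.R_pos (p.w_pos y)).le ?_
  rw [div_le_one (p.w_pos y)]
  exact hy.le.trans (p.norm_le_w y)

theorem smoothOff (n : ℝ) (hn : p.R + 1 ≤ n) :
    (p.profile n hn).SmoothOff (Metric.sphere 0 p.r ∪ Metric.sphere 0 p.R) where
  measurableSet := Metric.isClosed_sphere.measurableSet.union Metric.isClosed_sphere.measurableSet
  null := measure_union_null (Measure.addHaar_sphere _ _ _) (Measure.addHaar_sphere _ _ _)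
  τ_diff x hx := by
    simp only [mem_union, mem_sphere_iff_norm, sub_zero, not_or] at hx
    change DifferentiableAt ℝ p.base x
    rcases lt_or_gt_of_ne hx.2 with h | h
    · have hw : p.w x < p.R := max_lt h p.r_lt_R
      have : p.base =ᶠ[nhds x] fun y => p.c * (Real.log p.R - Real.log (p.w y)) := by
        filter_upwards [p.continuous_w.continuousAt.eventually_lt continuousAt_const hw] with y hy
        rw [← Real.log_div p.R_pos.ne' (p.w_pos y).ne']
        exact max_eq_right (mul_nonneg p.c_pos.le
          (Real.log_nonneg ((one_le_div (p.w_pos y)).2 hy.le)))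
      refine DifferentiableAt.congr_of_eventuallyEq ?_ this
      exact (((p.differentiableAt_w hx.1).log (p.w_pos x).ne').const_sub _).const_mul _
    · exact (differentiableAt_const _).congr_of_eventuallyEq (p.base_eventuallyEq_zero h)
  F_diff x hx y hy := by
    simp only [mem_union, mem_sphere_iff_norm, sub_zero, not_or] at hx
    change DifferentiableAt ℝ (fun x => p.slack y x) x
    have hc : Continuous fun x => dist y x := by fun_prop
    have : (fun x => p.slack y x) =ᶠ[nhds x]
        fun x => p.σ * (Real.log (p.w x + (dist y x - 1)) - Real.log (p.w x)) := by
      filter_upwards [continuousAt_const.eventually_lt hc.continuousAt hy] with x' hx'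
      have hw := p.w_pos x'
      rw [slack, max_eq_right (by linarith), ← Real.log_div (by linarith) hw.ne', add_div,
        div_self hw.ne']
    refine DifferentiableAt.congr_of_eventuallyEq ?_ this
    have hd : DifferentiableAt ℝ (fun x => dist y x) x := by
      refine DifferentiableAt.dist ℝ (differentiableAt_const y) differentiableAt_id ?_
      rintro rfl
      simp only [dist_self] at hy
      linarith
    have hw := p.w_pos x
    have hdw := p.differentiableAt_w hx.1
    exact (((hdw.add (hd.sub_const 1)).log (by simp only [Pi.add_apply]; linarith)).sub
      (hdw.log hw.ne')).const_mul _

theorem abs_slope_le {n : ℝ} (hn : p.R + 1 ≤ n) {e : Plane} (he : ‖e‖ = 1) (X : Config)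
    (x : Plane) : |(p.profile n hn).slope e X x| ≤ p.σ / p.w x := by
  have hd : ∀ s : ℝ, dist x (x + s • e) = |s| := fun s => by
    rw [dist_self_add_right, norm_smul, he, mul_one, Real.norm_eq_abs]
  refine (p.profile n hn).abs_slope_le (div_nonneg p.σ_pos.le (p.w_pos x).le) (fun s => ?_)
    (fun y s => ?_) X
  · rw [← hd]
    exact p.base_sub_le _ _
  · have := p.slack_sub_le y x y (x + s • e)
    rwa [dist_self, zero_add, hd] at this

theorem slope_eq_zero {n : ℝ} (hn : p.R + 1 ≤ n) (e : Plane) (X : Config) {x : Plane}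
    (hx : p.R < ‖x‖) : (p.profile n hn).slope e X x = 0 := by
  have h0 := p.base_eventuallyEq_zero hx
  have h1 : (p.profile n hn).τ x = 0 := h0.self_of_nhds
  have h2 : (p.profile n hn).time X x = (p.profile n hn).τ x := by
    have h3 := (p.profile n hn).time_le X x
    have h4 := (p.profile n hn).time_nonneg X x
    linarith
  rw [Profile.slope, if_pos h2]
  have hc : Filter.Tendsto (fun s : ℝ => x + s • e) (nhds 0) (nhds x) := by
    have : Continuous fun s : ℝ => x + s • e := by fun_prop
    simpa using this.tendsto 0
  have h3 : (fun s : ℝ => p.base (x + s • e)) =ᶠ[nhds 0] fun _ => 0 := hc.eventually h0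
  exact h3.deriv_eq.trans (deriv_const _ _)

end LogParams

end HardDisk
end

noncomputable section

namespace HardDisk

open ProbabilityTheory

section Percolation

theorem Profile.exists_chain {Λ : Set Plane} (P : Profile Λ) {S : Set Plane} (hS : S.Finite)
    (x : Plane) (hx : x ∈ S) : ∃ (m : ℕ) (y : ℕ → Plane), y 0 = x ∧ (∀ l ≤ m, y l ∈ S) ∧
      (∀ l < m, y (l + 1) ≠ y l ∧ freeze P.τ P.step S (y l) =
        freeze P.τ P.step S (y (l + 1)) + P.F (y (l + 1)) (y l)) ∧
      freeze P.τ P.step S (y m) = P.τ (y m) := by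
  revert hx
  refine freeze_induction (τ := P.τ) (Φ := P.step) (P := fun x => x ∈ S →
    ∃ (m : ℕ) (y : ℕ → Plane), y 0 = x ∧ (∀ l ≤ m, y l ∈ S) ∧
      (∀ l < m, y (l + 1) ≠ y l ∧ freeze P.τ P.step S (y l) =
        freeze P.τ P.step S (y (l + 1)) + P.F (y (l + 1)) (y l)) ∧
      freeze P.τ P.step S (y m) = P.τ (y m)) hS P.le_step
    P.strictMono_step (fun x h hx => ⟨0, fun _ => x, rfl, fun _ _ => hx, by simp, h⟩)
    (fun x v hv hP h hx => ?_) x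
  by_cases hvx : v = x
  · exact hvx ▸ hP hv
  obtain ⟨m, y, h0, hyS, hy, hm⟩ := hP hv
  refine ⟨m + 1, fun l => Nat.casesOn l x y, rfl, fun l hl => ?_, fun l hl => ?_, hm⟩
  · cases l with
    | zero => exact hx
    | succ l => exact hyS l (by omega)
  · cases l with
    | zero =>
      change y 0 ≠ x ∧ freeze P.τ P.step S x = freeze P.τ P.step S (y 0) + P.F (y 0) x
      rw [h0]
      exact ⟨hvx, h⟩
    | succ l => exact hy l (by omega)

theorem log_add_sum_le {A : ℝ} (hA : 0 < A) {d w : ℕ → ℝ} (hd : ∀ l, 0 ≤ d l) (hw : ∀ l, 0 < w l)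
    (q : ℕ) (h : ∀ l < q, w l ≤ A + ∑ i ∈ Finset.range l, d i) :
    Real.log (A + ∑ i ∈ Finset.range q, d i) ≤
      Real.log A + ∑ i ∈ Finset.range q, Real.log (1 + d i / w i) := by
  induction q with
  | zero => simp
  | succ q ih =>
    have h1 := ih fun l hl => h l (by omega)
    have h2 := h q (by omega)
    have hpos : 0 < A + ∑ i ∈ Finset.range q, d i :=
      add_pos_of_pos_of_nonneg hA (Finset.sum_nonneg fun i _ => hd i)
    rw [Finset.sum_range_succ, Finset.sum_range_succ, ← add_assoc]
    have h3 : A + ∑ i ∈ Finset.range q, d i + d q =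
        (A + ∑ i ∈ Finset.range q, d i) * (1 + d q / (A + ∑ i ∈ Finset.range q, d i)) := by
      field_simp
    have h4 : Real.log (1 + d q / (A + ∑ i ∈ Finset.range q, d i)) ≤
        Real.log (1 + d q / w q) :=
      Real.log_le_log (LogParams.one_add_pos (hd q) hpos)
        (by gcongr 1 + ?_; exact div_le_div_of_nonneg_left (hd q) (hw q) h2)
    rw [h3, Real.log_mul hpos.ne' (LogParams.one_add_pos (hd q) hpos).ne']
    linarith

theorem le_of_window {ℓ : ℕ} (hℓ : 0 < ℓ) {f : ℕ → ℝ} {a : ℝ} (m : ℕ)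
    (h0 : ∀ q < ℓ, q ≤ m → f q ≤ a) (h1 : ∀ j, j + ℓ ≤ m → f (j + ℓ) ≤ f j) : f m ≤ a := by
  induction m using Nat.strong_induction_on with
  | _ m ih =>
    by_cases hm : m < ℓ
    · exact h0 m hm le_rfl
    · have h2 := h1 (m - ℓ) (by omega)
      rw [Nat.sub_add_cancel (not_lt.1 hm)] at h2
      exact h2.trans (ih (m - ℓ) (by omega) (fun q hq hq' => h0 q hq (by omega))
        fun j hj => h1 j (by omega))

namespace LogParams

variable (p : LogParams)

theorem w_chain_le {y : ℕ → Plane} {b : ℝ} {j : ℕ} (hb : p.w (y j) ≤ b) (i : ℕ) :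
    p.w (y (j + i)) ≤ b + i +
      ∑ l ∈ Finset.range i, max 0 (dist (y (j + l + 1)) (y (j + l)) - 1) := by
  induction i with
  | zero => simpa using hb
  | succ i ih =>
    rw [Finset.sum_range_succ]
    have h := p.w_le_add (y (j + i)) (y (j + (i + 1)))
    rw [dist_comm] at h
    have h2 := le_max_right 0 (dist (y (j + i + 1)) (y (j + i)) - 1)
    rw [← add_assoc] at h ⊢
    push_cast
    linarith

theorem norm_chain_le {y : ℕ → Plane} (i : ℕ) :
    ‖y i‖ ≤ ‖y 0‖ + i + ∑ l ∈ Finset.range i, max 0 (dist (y (l + 1)) (y l) - 1) := by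
  induction i with
  | zero => simp
  | succ i ih =>
    rw [Finset.sum_range_succ]
    have h := norm_sub_norm_le (y (i + 1)) (y i)
    rw [← dist_eq_norm] at h
    have h2 := le_max_right 0 (dist (y (i + 1)) (y i) - 1)
    push_cast
    linarith

/-- A window of a chain in which the radial growth exceeds the accumulated slack is short. -/
theorem sum_le_of_window {K ε : ℝ} (hK1 : 1 < K) {ℓ : ℕ}
    (hK : ∀ w, p.r ≤ w → Real.log (1 + ℓ / w) ≤ (K - 1) * Real.log (1 + ε * ℓ / (w + ℓ)))
    (hε : 0 ≤ ε) (y : ℕ → Plane) (j : ℕ)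
    (h : Real.log (min (p.w (y j)) p.R) + K * ∑ i ∈ Finset.range ℓ,
        Real.log (1 + max 0 (dist (y (j + i + 1)) (y (j + i)) - 1) / p.w (y (j + i))) <
      Real.log (min (p.w (y (j + ℓ))) p.R)) :
    ‖y j‖ < p.R ∧
      ∑ i ∈ Finset.range ℓ, max 0 (dist (y (j + i + 1)) (y (j + i)) - 1) ≤ ε * ℓ := by
  set d : ℕ → ℝ := fun i => max 0 (dist (y (j + i + 1)) (y (j + i)) - 1) with hd
  have hd0 : ∀ i, 0 ≤ d i := fun i => le_max_left _ _
  set s := ∑ i ∈ Finset.range ℓ, Real.log (1 + d i / p.w (y (j + i))) with hs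
  have hs0 : 0 ≤ s := Finset.sum_nonneg fun i _ => Real.log_nonneg
    (le_add_of_nonneg_right (div_nonneg (hd0 i) (p.w_pos _).le))
  set w := p.w (y j) with hw
  have hwpos : 0 < w := p.w_pos _
  have hminpos : ∀ x, 0 < min (p.w x) p.R := fun x => lt_min (p.w_pos x) p.R_pos
  have hwR : w < p.R := by
    by_contra! hle
    rw [min_eq_right hle] at h
    have := Real.log_le_log (hminpos (y (j + ℓ))) (min_le_right _ _)
    nlinarith
  refine ⟨(p.norm_le_w _).trans_lt hwR, ?_⟩
  rw [min_eq_left hwR.le] at h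
  set D := ∑ i ∈ Finset.range ℓ, d i with hD
  have hD0 : 0 ≤ D := Finset.sum_nonneg fun i _ => hd0 i
  have hA : 0 < w + ℓ := by positivity
  have h1 : Real.log (w + ℓ + D) ≤ Real.log (w + ℓ) + s := by
    refine log_add_sum_le hA hd0 (w := fun i => p.w (y (j + i))) (fun i => p.w_pos _) ℓ
      fun l hl => (p.w_chain_le (le_refl w) l).trans ?_
    have : (l : ℝ) ≤ ℓ := by exact_mod_cast hl.le
    simp only [hd]
    linarith
  have h2 : Real.log (min (p.w (y (j + ℓ))) p.R) ≤ Real.log (w + ℓ + D) :=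
    Real.log_le_log (hminpos _) ((min_le_left _ _).trans (p.w_chain_le (le_refl w) ℓ))
  have h3 : Real.log (w + ℓ) = Real.log w + Real.log (1 + ℓ / w) := by
    rw [← Real.log_mul hwpos.ne' (by positivity)]
    congr 1
    field_simp
  have h4 : Real.log (w + ℓ + D) = Real.log (w + ℓ) + Real.log (1 + D / (w + ℓ)) := by
    rw [← Real.log_mul hA.ne' (by positivity)]
    congr 1
    field_simp
  have h5 : (K - 1) * Real.log (1 + D / (w + ℓ)) < (K - 1) * Real.log (1 + ε * ℓ / (w + ℓ)) := by
    refine lt_of_lt_of_le ?_ (hK w (p.r_le_w _))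
    have : (K - 1) * Real.log (1 + D / (w + ℓ)) ≤ (K - 1) * s :=
      mul_le_mul_of_nonneg_left (by linarith) (by linarith)
    linarith
  have h6 := lt_of_mul_lt_mul_left h5 (by linarith)
  have h7 := (Real.log_lt_log_iff (by positivity) (by positivity)).1 h6
  exact ((div_lt_div_iff_of_pos_right hA).1 (by linarith)).le

/-- A particle near the origin which is slowed down starts a chain of particles with small gaps. -/
theorem exists_short_chain {n : ℝ} (hn : p.R + 1 ≤ n) {K ε : ℝ} (hK1 : 1 < K)
    (hσ : p.σ = K * p.c) {ℓ : ℕ} (hℓ : 0 < ℓ)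
    (hK : ∀ w, p.r ≤ w → Real.log (1 + ℓ / w) ≤ (K - 1) * Real.log (1 + ε * ℓ / (w + ℓ)))
    (hε : 0 ≤ ε) {S : Set Plane} (hS : S.Finite)
    (hhc : ∀ x ∈ S, ∀ y ∈ S, x ≠ y → 1 < dist x y) {x : Plane} (hx : x ∈ S)
    (hxr : ‖x‖ + ℓ ≤ p.r + 1)
    (hbad : freeze (p.profile n hn).τ (p.profile n hn).step S x < p.c * Real.log (p.R / p.r)) :
    ∃ y : ℕ → Plane, (∀ i ≤ ℓ, y i ∈ S) ∧ (∀ i i', i < i' → i' ≤ ℓ → y i ≠ y i') ∧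
      ‖y ℓ‖ < p.R ∧ ∑ i ∈ Finset.range ℓ, (‖y i - y (i + 1)‖ - 1) ≤ ε * ℓ := by
  set P := p.profile n hn with hP
  obtain ⟨m, y, h0, hyS, hy, hm⟩ := P.exists_chain hS x hx
  set t := freeze P.τ P.step S with ht
  set d : ℕ → ℝ := fun i => max 0 (dist (y (i + 1)) (y i) - 1) with hd
  have hd0 : ∀ i, 0 ≤ d i := fun i => le_max_left _ _
  set s : ℕ → ℝ := fun i => Real.log (1 + d i / p.w (y i)) with hs
  have hs0 : ∀ i, 0 ≤ s i := fun i => Real.log_nonneg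
    (le_add_of_nonneg_right (div_nonneg (hd0 i) (p.w_pos _).le))
  have hF : ∀ l, P.F (y (l + 1)) (y l) = p.σ * s l := fun l => rfl
  have hdist : ∀ l < m, 1 < dist (y (l + 1)) (y l) := fun l hl =>
    hhc _ (hyS _ (by omega)) _ (hyS _ (by omega)) (hy l hl).1
  have hanti : ∀ i i', i < i' → i' ≤ m → t (y i') < t (y i) := by
    intro i i' hii
    induction i', hii using Nat.le_induction with
    | base =>
      intro hi
      linarith [(hy i (by omega)).2, P.F_pos _ _ (hdist i (by omega))]
    | succ i' hii ih =>
      intro hi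
      linarith [(hy i' (by omega)).2, P.F_pos _ _ (hdist i' (by omega)), ih (by omega)]
  have hsum : ∀ q ≤ m, t (y 0) = t (y q) + p.σ * ∑ i ∈ Finset.range q, s i := by
    intro q
    induction q with
    | zero => simp
    | succ q ih =>
      intro hq
      rw [ih (by omega), (hy q (by omega)).2, hF, Finset.sum_range_succ]
      ring
  have hminpos : ∀ x, 0 < min (p.w x) p.R := fun x => lt_min (p.w_pos x) p.R_pos
  by_cases hwin : ∃ j, j + ℓ ≤ m ∧ Real.log (min (p.w (y j)) p.R) +
      K * ∑ i ∈ Finset.range ℓ, s (j + i) < Real.log (min (p.w (y (j + ℓ))) p.R)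
  · obtain ⟨j, hj, hwin⟩ := hwin
    obtain ⟨h1, h2⟩ := p.sum_le_of_window hK1 hK hε y j hwin
    refine ⟨fun i => y (j + (ℓ - i)), fun i hi => hyS _ (by omega), fun i i' hii hi' heq => ?_,
      by simpa using h1, le_trans (le_of_eq ?_) h2⟩
    · have := hanti (j + (ℓ - i')) (j + (ℓ - i)) (by omega) (by omega)
      simp only at heq
      rw [heq] at this
      exact lt_irrefl _ this
    · rw [← Finset.sum_range_reflect]
      refine Finset.sum_congr rfl fun i hi => ?_
      have hi := Finset.mem_range.1 hi
      dsimp only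
      rw [← dist_eq_norm, show j + (ℓ - (ℓ - 1 - i)) = j + i + 1 by omega,
        show j + (ℓ - (ℓ - 1 - i + 1)) = j + i by omega,
        max_eq_right (by linarith [hdist (j + i) (by omega)])]
  · exfalso
    push Not at hwin
    have hle := le_of_window (f := fun q => Real.log (min (p.w (y q)) p.R) -
      K * ∑ i ∈ Finset.range q, s i) (a := Real.log p.r) hℓ m (fun q hq _ => ?_) fun j hj => ?_
    · have h1 := hsum m le_rfl
      have h2 : t (y 0) < p.c * (Real.log p.R - Real.log p.r) := by
        rw [h0, ← Real.log_div p.R_pos.ne' p.r_pos.ne']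
        exact hbad
      have h3 : P.τ (y m) = p.base (y m) := rfl
      rw [hm, h3, hσ] at h1
      rcases le_total (p.w (y m)) p.R with h | h
      · rw [min_eq_left h] at hle
        have h4 := p.le_base (y m)
        rw [Real.log_div p.R_pos.ne' (p.w_pos _).ne'] at h4
        nlinarith [p.c_pos]
      · rw [min_eq_right h] at hle
        have h4 := p.base_nonneg (y m)
        nlinarith [p.c_pos]
    · have hq1 : (q : ℝ) + 1 ≤ ℓ := by exact_mod_cast hq
      have h1 : ∀ l ≤ q, p.w (y l) ≤ p.r + ∑ i ∈ Finset.range l, d i := by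
        intro l hl
        have hl' : (l : ℝ) ≤ q := by exact_mod_cast hl
        have h2 := norm_chain_le (y := y) l
        rw [h0] at h2
        exact max_le (h2.trans (by simp only [hd]; linarith))
          (le_add_of_nonneg_right (Finset.sum_nonneg fun i _ => hd0 i))
      have h2 := log_add_sum_le p.r_pos hd0 (w := fun l => p.w (y l)) (fun l => p.w_pos _) q
        fun l hl => h1 l hl.le
      have h3 := Real.log_le_log (hminpos (y q)) ((min_le_left _ _).trans (h1 q le_rfl))
      have h4 : 0 ≤ ∑ i ∈ Finset.range q, s i := Finset.sum_nonneg fun i _ => hs0 i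
      have h5 : (∑ i ∈ Finset.range q, s i) ≤ K * ∑ i ∈ Finset.range q, s i := by nlinarith
      change Real.log _ ≤ Real.log p.r + ∑ i ∈ Finset.range q, s i at h2
      linarith
    · have h1 := hwin j hj
      rw [Finset.sum_range_add]
      linarith

end LogParams

end Percolation

end HardDisk
end

noncomputable section

namespace HardDisk

open ProbabilityTheory

theorem lintegral_fun_norm {f : ℝ → ℝ} (hf : ∀ r, 0 ≤ f r)
    (hi : IntegrableOn (fun r => r * f r) (Ioi 0)) :
    ∫⁻ p : Plane, ENNReal.ofReal (f ‖p‖) =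
      ENNReal.ofReal (2 * Real.pi * ∫ r in Ioi 0, r * f r) := by
  have hdim : Module.finrank ℝ Plane = 2 := by simp
  have hint : Integrable (fun p : Plane => f ‖p‖) := by
    rw [integrable_fun_norm_addHaar volume]
    simpa [hdim] using hi
  rw [← ofReal_integral_eq_lintegral_ofReal hint (Filter.Eventually.of_forall fun p => hf _),
    integral_fun_norm_addHaar volume]
  congr 1
  have : volume.real (Metric.ball (0 : Plane) 1) = Real.pi := by
    rw [Measure.real, EuclideanSpace.volume_ball_fin_two]
    simp [Real.pi_nonneg]
  rw [hdim, this]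
  simp
  ring

section Gap

/-- The exponential profile of the gap weights. -/
def gapProfile (ε : ℝ) : ℝ → ℝ := (Ioi 1).indicator fun r => Real.exp (1 - (r - 1) / ε)

/-- The exponential weight of a step between two particles at distance greater than one. -/
def gapWeight (ε : ℝ) (v : Plane) : ℝ≥0∞ := ENNReal.ofReal (gapProfile ε ‖v‖)

theorem measurable_gapWeight (ε : ℝ) : Measurable (gapWeight ε) := by
  have : Measurable (gapProfile ε) := Measurable.indicator (by fun_prop) measurableSet_Ioi
  exact (this.comp measurable_norm).ennreal_ofReal

theorem lintegral_gapWeight {ε : ℝ} (hε : 0 < ε) :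
    ∫⁻ v, gapWeight ε v = ENNReal.ofReal (2 * Real.pi * ((ε + ε ^ 2) * Real.exp 1)) := by
  let G : ℝ → ℝ := fun r => -(ε * r + ε ^ 2) * Real.exp (1 - (r - 1) / ε)
  have hG : ∀ r ∈ Ici (1 : ℝ), HasDerivAt G (r * Real.exp (1 - (r - 1) / ε)) r := by
    intro r _
    have h1 : HasDerivAt (fun r : ℝ => -(ε * r + ε ^ 2)) (-(ε * 1)) r :=
      (((hasDerivAt_id r).const_mul ε).add_const _).neg
    have h2 : HasDerivAt (fun r : ℝ => Real.exp (1 - (r - 1) / ε))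
        (Real.exp (1 - (r - 1) / ε) * -(1 / ε)) r :=
      ((((hasDerivAt_id r).sub_const 1).div_const ε).const_sub 1).exp
    refine (h1.mul h2).congr_deriv ?_
    field_simp
    ring
  have hlim : Filter.Tendsto G Filter.atTop (nhds 0) := by
    have h1 := Real.tendsto_pow_mul_exp_neg_atTop_nhds_zero 1
    have h0 := Real.tendsto_pow_mul_exp_neg_atTop_nhds_zero 0
    have h2 : Filter.Tendsto (fun r : ℝ => r / ε) Filter.atTop Filter.atTop :=
      Filter.tendsto_id.atTop_div_const hε
    have h3 := ((h1.add h0).comp h2).const_mul (-(ε ^ 2) * Real.exp (1 + 1 / ε))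
    rw [add_zero, mul_zero] at h3
    refine h3.congr fun r => ?_
    have : Real.exp (1 - (r - 1) / ε) = Real.exp (1 + 1 / ε) * Real.exp (-(r / ε)) := by
      rw [← Real.exp_add]
      congr 1
      ring
    simp only [G, Function.comp_apply, this]
    field_simp
  have hpos : ∀ r ∈ Ioi (1 : ℝ), 0 ≤ r * Real.exp (1 - (r - 1) / ε) := fun r hr =>
    mul_nonneg (zero_le_one.trans (le_of_lt hr)) (Real.exp_nonneg _)
  have heq : ∀ r, r * gapProfile ε r =
      (Ioi (1 : ℝ)).indicator (fun r => r * Real.exp (1 - (r - 1) / ε)) r := fun r => by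
    by_cases hr : r ∈ Ioi (1 : ℝ) <;> simp [gapProfile, hr]
  have hsub : Ioi (1 : ℝ) ⊆ Ioi 0 := Ioi_subset_Ioi zero_le_one
  have hint := integrableOn_Ioi_deriv_of_nonneg' hG hpos hlim
  unfold gapWeight
  rw [lintegral_fun_norm]
  · congr 2
    simp only [heq]
    rw [setIntegral_indicator measurableSet_Ioi, inter_eq_self_of_subset_right hsub,
      integral_Ioi_of_hasDerivAt_of_nonneg' hG hpos hlim]
    simp [G]
    ring
  · exact fun r => indicator_nonneg (fun _ _ => Real.exp_nonneg _) r
  · simp only [heq]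
    rw [IntegrableOn, integrable_indicator_iff measurableSet_Ioi, IntegrableOn,
      Measure.restrict_restrict measurableSet_Ioi, inter_eq_self_of_subset_left hsub]
    exact hint

theorem one_le_prod_gapWeight {ε : ℝ} (hε : 0 < ε) {ℓ : ℕ} {y : ℕ → Plane}
    (hy : ∀ i < ℓ, 1 < ‖y i - y (i + 1)‖)
    (hs : ∑ i ∈ Finset.range ℓ, (‖y i - y (i + 1)‖ - 1) ≤ ε * ℓ) :
    1 ≤ ∏ i ∈ Finset.range ℓ, gapWeight ε (y i - y (i + 1)) := by
  have h1 : ∏ i ∈ Finset.range ℓ, gapWeight ε (y i - y (i + 1)) =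
      ∏ i ∈ Finset.range ℓ, ENNReal.ofReal (Real.exp (1 - (‖y i - y (i + 1)‖ - 1) / ε)) :=
    Finset.prod_congr rfl fun i hi => by
      rw [gapWeight, gapProfile, indicator_of_mem
        (show _ ∈ Ioi (1 : ℝ) from hy i (Finset.mem_range.1 hi))]
  rw [h1, ← ENNReal.ofReal_prod_of_nonneg fun _ _ => Real.exp_nonneg _, ← Real.exp_sum,
    ENNReal.one_le_ofReal, Real.one_le_exp_iff, Finset.sum_sub_distrib, ← Finset.sum_div]
  simp only [Finset.sum_const, Finset.card_range, nsmul_eq_mul, mul_one]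
  rw [sub_nonneg, div_le_iff₀ hε]
  linarith

end Gap

theorem sum_indicator_ball_le {A : Finset Plane}
    (hA : ∀ x ∈ A, ∀ y ∈ A, x ≠ y → 1 < dist x y) {R : ℝ} (hR : 0 ≤ R) :
    ∑ x ∈ A, (Metric.ball (0 : Plane) R).indicator (fun _ => (1 : ℝ≥0∞)) x ≤
      ENNReal.ofReal ((2 * R + 1) ^ 2) := by
  have h := sum_mul_le_lintegral hA (f := (Metric.ball (0 : Plane) R).indicator fun _ => 1)
    (h := (Metric.ball (0 : Plane) (R + 1 / 2)).indicator fun _ => 1) fun x _ q hq => by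
      by_cases hx : x ∈ Metric.ball (0 : Plane) R
      · rw [indicator_of_mem hx, indicator_of_mem]
        rw [Metric.mem_ball] at *
        linarith [dist_triangle q x 0]
      · rw [indicator_of_notMem hx]
        exact bot_le
  rw [lintegral_indicator_const measurableSet_ball, one_mul,
    EuclideanSpace.volume_ball_fin_two, ← ENNReal.ofReal_pow (by linarith),
    ← ENNReal.ofReal_mul (by positivity)] at h
  have hpi : 0 < Real.pi / 4 := by positivity
  have h2 : ENNReal.ofReal ((R + 1 / 2) ^ 2 * Real.pi) =
      ENNReal.ofReal ((2 * R + 1) ^ 2) * ENNReal.ofReal (Real.pi / 4) := by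
    rw [← ENNReal.ofReal_mul (by positivity)]
    congr 1
    ring
  rw [h2] at h
  exact (ENNReal.mul_le_mul_iff_left (ENNReal.ofReal_pos.2 hpi).ne' ENNReal.ofReal_ne_top).1 h

theorem chainTotal_zero_le {Λ : Set Plane} {Y : Config} {g : Plane → ℝ≥0∞} {R : ℝ} (hR : 0 ≤ R)
    (k : ℕ) {x : Fin k → Plane} (hx : x ∈ properTuples Λ Y k) :
    chainTotal g ((Metric.ball (0 : Plane) R).indicator fun _ => 1) 0 k x ≤
      ENNReal.ofReal ((2 * R + 1) ^ 2) := by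
  classical
  cases k with
  | zero => exact bot_le
  | succ k =>
    simp only [chainTotal, chainSum]
    rw [← Finset.sum_image (f := (Metric.ball (0 : Plane) R).indicator fun _ => (1 : ℝ≥0∞))
      (g := x) (s := Finset.univ) hx.2.injOn]
    refine sum_indicator_ball_le (fun v hv v' hv' hne => ?_) hR
    obtain ⟨i, -, rfl⟩ := Finset.mem_image.1 hv
    obtain ⟨j, -, rfl⟩ := Finset.mem_image.1 hv'
    exact one_lt_dist_of_mem_properTuples hx fun h => hne (by rw [h])

namespace LogParams

variable (p : LogParams)

/-- Configurations all of whose particles in the box of size `s` move by the full amount. -/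
def goodSet {n : ℝ} (hn : p.R + 1 ≤ n) (s : ℝ) : Set Config :=
  {X | ∀ x ∈ X.carrier ∩ box s, (p.profile n hn).time X x = p.c * Real.log (p.R / p.r)}

theorem measurableSet_goodSet {n : ℝ} (hn : p.R + 1 ≤ n) (s : ℝ) :
    MeasurableSet (p.goodSet hn s) := by
  have h := measurableSet_forall_mem (α := Config) (X := fun X => X) measurable_id
    (P := fun X x => x ∈ box s → (p.profile n hn).time X x = p.c * Real.log (p.R / p.r)) ?_
  · convert h using 1
    ext X
    exact ⟨fun h x hx hs => h x ⟨hx, hs⟩, fun h x hx => h x hx.1 hx.2⟩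
  · have h1 : MeasurableSet {q : Config × Plane | q.2 ∈ box s} :=
      measurable_snd (measurableSet_box s)
    have h2 : MeasurableSet {q : Config × Plane | (p.profile n hn).time q.1 q.2 =
        p.c * Real.log (p.R / p.r)} :=
      measurableSet_eq_fun (p.profile n hn).measurable_time measurable_const
    convert h1.compl.union h2 using 1
    ext q
    simp only [mem_ofPred_eq, mem_union, mem_compl_iff, imp_iff_not_or]

theorem gibbs_compl_goodSet_le (z : ℝ) {n : ℝ} (hn : p.R + 1 ≤ n) {K ε : ℝ} (hK1 : 1 < K)
    (hσ : p.σ = K * p.c) {ℓ : ℕ} (hℓ : 0 < ℓ)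
    (hK : ∀ w, p.r ≤ w → Real.log (1 + ℓ / w) ≤ (K - 1) * Real.log (1 + ε * ℓ / (w + ℓ)))
    (hε : 0 < ε) {s : ℝ} (hs : √2 * s + ℓ ≤ p.r + 1) (Y : Config) :
    gibbs z (box n) Y (p.goodSet hn s)ᶜ ≤
      (ENNReal.ofReal z * ENNReal.ofReal (2 * Real.pi * ((ε + ε ^ 2) * Real.exp 1))) ^ ℓ *
        ENNReal.ofReal ((2 * p.R + 1) ^ 2) := by
  have hℓ1 : (1 : ℝ) ≤ ℓ := by exact_mod_cast hℓ
  have hB := measurableSet_box n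
  set a : Plane → ℝ≥0∞ := (Metric.ball (0 : Plane) p.R).indicator fun _ => 1 with ha
  have ham : Measurable a := measurable_const.indicator measurableSet_ball
  refine gibbs_le_of_hardSum z hB Y (p.measurableSet_goodSet hn s).compl
    (B := chainTotal (gapWeight ε) a ℓ) (fun k x hx hbad => ?_) ?_
  · simp only [goodSet, mem_compl_iff, mem_ofPred_eq, not_forall] at hbad
    obtain ⟨v, ⟨hv, hvs⟩, hne⟩ := hbad
    have hnorm : ‖v‖ ≤ p.r := by linarith [norm_le_of_mem_box hvs]
    have hvn : v ∈ box n := mem_box_of_norm_le (by linarith [p.r_lt_R])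
    have hvr : v ∈ range x := glue_inter Y hx.1.1 ▸ ⟨hv, hvn⟩
    have hle := (p.profile n hn).time_le (Config.glue (box n) Y x) v
    have hτ : (p.profile n hn).τ v = p.c * Real.log (p.R / p.r) := by
      change p.base v = _
      rw [base, w, max_eq_right hnorm]
      exact max_eq_right (mul_nonneg p.c_pos.le
        (Real.log_nonneg ((one_le_div p.r_pos).2 p.r_lt_R.le)))
    have hlt := lt_of_le_of_ne (hτ ▸ hle) hne
    rw [Profile.time, shiftTime_of_mem _ _ _ _ hvn, glue_inter Y hx.1.1] at hlt
    have hhc : ∀ v ∈ range x, ∀ v' ∈ range x, v ≠ v' → 1 < dist v v' := by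
      rintro _ ⟨i, rfl⟩ _ ⟨j, rfl⟩ hij
      exact one_lt_dist_of_mem_properTuples hx fun h => hij (by rw [h])
    obtain ⟨y, hyS, hinj, hyR, hsum⟩ := p.exists_short_chain hn hK1 hσ hℓ hK hε.le
      (finite_range x) hhc hvr (by linarith [norm_le_of_mem_box hvs]) hlt
    refine le_trans ?_ (prod_le_chainTotal ℓ k x y hyS hinj)
    rw [ha, indicator_of_mem (by simpa using hyR), mul_one]
    refine one_le_prod_gapWeight hε (fun i hi => ?_) hsum
    rw [← dist_eq_norm]
    exact hhc _ (hyS _ hi.le) _ (hyS _ hi) (hinj _ _ (Nat.lt_succ_self i) hi)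
  · refine (hardSum_chainTotal_le (measurable_gapWeight ε) ham z hB Y ℓ).trans ?_
    rw [lintegral_gapWeight hε, mul_assoc (_ ^ ℓ), ← hardSum_const]
    gcongr
    exact hardSum_mono z hB Y fun k x hx => chainTotal_zero_le p.R_pos.le k hx

end LogParams

end HardDisk
end

noncomputable section

namespace HardDisk

open ProbabilityTheory

theorem abs_log_add_log_le {a b : ℝ} (hab : |a| ≤ b) (hb : b ≤ 1 / 20) :
    |Real.log (1 + a) + Real.log (1 + -a)| ≤ 101 / 100 * b ^ 2 := by
  have h1 := abs_le.1 hab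
  have ha : a ^ 2 ≤ b ^ 2 := sq_le_sq' h1.1 h1.2
  have hb2 : b ^ 2 ≤ 1 / 400 := by nlinarith [abs_nonneg a]
  have hpos : 0 < 1 - a ^ 2 := by linarith
  rw [← Real.log_mul (by linarith) (by linarith), show (1 + a) * (1 + -a) = 1 - a ^ 2 by ring,
    abs_of_nonpos (Real.log_nonpos hpos.le (by nlinarith))]
  have h2 := Real.one_sub_inv_le_log_of_pos hpos
  have h3 : (1 - a ^ 2)⁻¹ ≤ 1 + 101 / 100 * b ^ 2 := by
    rw [inv_le_comm₀ hpos (by nlinarith), inv_eq_one_div, div_le_iff₀ (by nlinarith)]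
    nlinarith [sq_nonneg a, sq_nonneg b]
  linarith

/-- The integral of `s / (s - 1/2)²` over `(r, b]`. -/
theorem integral_div_sub_half_sq {r b : ℝ} (hr : 1 ≤ r) (hrb : r ≤ b) :
    ∫ s in r..b, s * (1 / (s - 1 / 2) ^ 2) =
      Real.log ((b - 1 / 2) / (r - 1 / 2)) + 1 / (2 * (r - 1 / 2)) - 1 / (2 * (b - 1 / 2)) := by
  have hne : ∀ s ∈ uIcc r b, s - 1 / 2 ≠ 0 := fun s hs => by
    rw [uIcc_of_le hrb] at hs
    linarith [hs.1]
  have hderiv : ∀ s ∈ uIcc r b, HasDerivAt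
      (fun s : ℝ => Real.log (s - 1 / 2) - 1 / 2 * (s - 1 / 2)⁻¹)
      (s * (1 / (s - 1 / 2) ^ 2)) s := fun s hs => by
    have h1 : HasDerivAt (fun s : ℝ => s - 1 / 2) 1 s := (hasDerivAt_id s).sub_const _
    refine ((h1.log (hne s hs)).sub ((h1.inv (hne s hs)).const_mul _)).congr_deriv ?_
    have := hne s hs
    field_simp
    ring
  rw [intervalIntegral.integral_eq_sub_of_hasDerivAt hderiv]
  · have h1 := hne r left_mem_uIcc
    have h2 := hne b right_mem_uIcc
    rw [Real.log_div h2 h1]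
    field_simp
    ring
  · refine ContinuousOn.intervalIntegrable ?_
    exact continuousOn_id.mul (continuousOn_const.div (by fun_prop) fun s hs =>
      pow_ne_zero 2 (hne s hs))

namespace LogParams

variable (p : LogParams)

/-- The radial profile which dominates the squared slopes. -/
def tail (s : ℝ) : ℝ := (Ioc p.r (p.R + 1 / 2)).indicator (fun s => 1 / (s - 1 / 2) ^ 2) s

theorem lintegral_tail_le :
    ∫⁻ q : Plane, ENNReal.ofReal (p.tail ‖q‖) ≤ ENNReal.ofReal
      (2 * Real.pi * (Real.log (p.R / (p.r - 1 / 2)) + 1 / (2 * (p.r - 1 / 2)))) := by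
  have hr := p.one_le_r
  have hR : p.r ≤ p.R + 1 / 2 := by linarith [p.r_lt_R]
  have heq : ∀ s, s * p.tail s =
      (Ioc p.r (p.R + 1 / 2)).indicator (fun s => s * (1 / (s - 1 / 2) ^ 2)) s := fun s => by
    by_cases hs : s ∈ Ioc p.r (p.R + 1 / 2)
    · simp only [tail, indicator_of_mem hs]
    · simp only [tail, indicator_of_notMem hs, mul_zero]
  have hsub : Ioc p.r (p.R + 1 / 2) ⊆ Ioi 0 := fun s hs => p.r_pos.trans hs.1
  have hint : IntegrableOn (fun s : ℝ => s * (1 / (s - 1 / 2) ^ 2)) (Ioc p.r (p.R + 1 / 2)) := by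
    refine IntegrableOn.mono_set (ContinuousOn.integrableOn_Icc (a := p.r) (b := p.R + 1 / 2) ?_)
      Ioc_subset_Icc_self
    exact continuousOn_id.mul (continuousOn_const.div (by fun_prop) fun s hs =>
      pow_ne_zero 2 (by linarith [hs.1]))
  rw [lintegral_fun_norm]
  · refine ENNReal.ofReal_le_ofReal (mul_le_mul_of_nonneg_left ?_ (by positivity))
    simp only [heq]
    rw [setIntegral_indicator measurableSet_Ioc, inter_eq_self_of_subset_right hsub,
      ← intervalIntegral.integral_of_le hR, integral_div_sub_half_sq hr hR, add_sub_cancel_right]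
    have : 0 ≤ 1 / (2 * p.R) := by have := p.R_pos; positivity
    linarith
  · exact fun s => indicator_nonneg (fun _ _ => by positivity) s
  · simp only [heq]
    rw [IntegrableOn, integrable_indicator_iff measurableSet_Ioc, IntegrableOn,
      Measure.restrict_restrict measurableSet_Ioc, inter_eq_self_of_subset_left hsub]
    exact hint

theorem sum_inv_sq_le {A : Finset Plane} (hA : ∀ x ∈ A, ∀ y ∈ A, x ≠ y → 1 < dist x y) :
    ∑ x ∈ A, (Metric.closedBall (0 : Plane) p.R).indicator (fun x => 1 / p.w x ^ 2) x ≤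
      8 * (1 / 2 + (Real.log (p.R / (p.r - 1 / 2)) + 1 / (2 * (p.r - 1 / 2)))) := by
  have hr := p.one_le_r
  set J := Real.log (p.R / (p.r - 1 / 2)) + 1 / (2 * (p.r - 1 / 2)) with hJ
  have hJ0 : 0 ≤ J := by
    refine add_nonneg (Real.log_nonneg ?_) (one_div_nonneg.2 (by linarith))
    rw [one_le_div (by linarith)]
    linarith [p.r_lt_R]
  set f : Plane → ℝ := (Metric.closedBall (0 : Plane) p.R).indicator (fun x => 1 / p.w x ^ 2)
  have hf0 : ∀ x, 0 ≤ f x := fun x => indicator_nonneg (fun _ _ => by positivity) x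
  have h := sum_mul_le_lintegral hA (f := fun x => ENNReal.ofReal (f x))
    (h := fun q => (Metric.closedBall (0 : Plane) p.r).indicator
      (fun _ => ENNReal.ofReal (1 / p.r ^ 2)) q + ENNReal.ofReal (p.tail ‖q‖)) fun x _ q hq => by
      by_cases hx : x ∈ Metric.closedBall (0 : Plane) p.R
      · have hw := p.r_le_w x
        simp only [f]
        rw [indicator_of_mem hx]
        rw [mem_closedBall_zero_iff] at hx
        rw [Metric.mem_ball, dist_eq_norm] at hq
        have hqx := norm_sub_norm_le q x
        by_cases hqr : ‖q‖ ≤ p.r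
        · rw [indicator_of_mem (by simpa using hqr)]
          refine le_add_of_le_of_nonneg (ENNReal.ofReal_le_ofReal ?_) bot_le
          have := p.r_pos
          gcongr
        · rw [tail, indicator_of_mem (show ‖q‖ ∈ Ioc _ _ from ⟨not_le.1 hqr, by linarith⟩)]
          refine le_add_of_nonneg_of_le bot_le (ENNReal.ofReal_le_ofReal ?_)
          have h1 : 0 < ‖q‖ - 1 / 2 := by linarith [not_le.1 hqr]
          have h2 : ‖q‖ - 1 / 2 ≤ p.w x := by linarith [p.norm_le_w x]
          gcongr
      · simp only [f]
        rw [indicator_of_notMem hx, ENNReal.ofReal_zero]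
        exact bot_le
  have hm : Measurable ((Metric.closedBall (0 : Plane) p.r).indicator
      fun _ => ENNReal.ofReal (1 / p.r ^ 2)) :=
    measurable_const.indicator measurableSet_closedBall
  rw [lintegral_add_left hm, lintegral_indicator_const measurableSet_closedBall,
    EuclideanSpace.volume_closedBall_fin_two, ← ENNReal.ofReal_sum_of_nonneg fun x _ => hf0 x,
    ← ENNReal.ofReal_pow p.r_pos.le,
    ← ENNReal.ofReal_mul (Finset.sum_nonneg fun x _ => hf0 x),
    ← ENNReal.ofReal_mul (sq_nonneg _), ← ENNReal.ofReal_mul (by positivity)] at h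
  have h2 := h.trans (add_le_add_right p.lintegral_tail_le _)
  have hpi := Real.pi_pos
  rw [← ENNReal.ofReal_add (by positivity) (by positivity),
    ENNReal.ofReal_le_ofReal_iff (by positivity)] at h2
  have h3 : 1 / p.r ^ 2 * (p.r ^ 2 * Real.pi) = Real.pi := by
    have := p.r_pos
    field_simp
  rw [h3] at h2
  refine le_of_mul_le_mul_right (h2.trans_eq ?_) (show 0 < Real.pi / 4 by positivity)
  ring

theorem abs_log_jacobian_le {n : ℝ} (hn : p.R + 1 ≤ n) (hσ : p.σ ≤ p.r / 20) {e : Plane}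
    (he : ‖e‖ = 1) {X : Config} (hX : X ∈ hardCore) :
    |Real.log ((p.profile n hn).jacobian e X * (p.profile n hn).jacobian (-e) X)| ≤
      101 / 100 * p.σ ^ 2 *
        (8 * (1 / 2 + (Real.log (p.R / (p.r - 1 / 2)) + 1 / (2 * (p.r - 1 / 2))))) := by
  set P := p.profile n hn
  have hfin := X.finite_inter (box n) (isBounded_box n)
  rw [Real.log_mul (P.jacobian_pos _ _).ne' (P.jacobian_pos _ _).ne', Profile.jacobian,
    Profile.jacobian, Real.log_exp, Real.log_exp,
    setIntegral_pts (measurableSet_box n) (isBounded_box n),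
    setIntegral_pts (measurableSet_box n) (isBounded_box n), ← Finset.sum_add_distrib]
  refine (Finset.abs_sum_le_sum_abs _ _).trans ?_
  refine le_trans ?_ (mul_le_mul_of_nonneg_left (p.sum_inv_sq_le (A := hfin.toFinset)
    fun x hx y hy hxy => ?_) (by positivity))
  · rw [Finset.mul_sum]
    refine Finset.sum_le_sum fun x _ => ?_
    rw [P.slope_neg]
    by_cases hx : x ∈ Metric.closedBall (0 : Plane) p.R
    · rw [indicator_of_mem hx]
      have hw := p.w_pos x
      have h1 : p.σ / p.w x ≤ 1 / 20 := by
        rw [div_le_iff₀ hw]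
        linarith [p.r_le_w x]
      refine (abs_log_add_log_le (p.abs_slope_le hn he X x) h1).trans_eq ?_
      field_simp
    · rw [indicator_of_notMem hx, mul_zero]
      rw [mem_closedBall_zero_iff, not_le] at hx
      rw [p.slope_eq_zero hn e X hx]
      simp
  · rw [Finite.mem_toFinset] at hx hy
    exact hX x hx.1 y hy.1 hxy

theorem integral_abs_log_jacobian_le {n : ℝ} (hn : p.R + 1 ≤ n) (hσ : p.σ ≤ p.r / 20) {e : Plane}
    (he : ‖e‖ = 1) (z : ℝ) (Y : Config) :
    Integrable (fun X => Real.log ((p.profile n hn).jacobian e X *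
      (p.profile n hn).jacobian (-e) X)) (gibbs z (box n) Y) ∧
    ∫ X, |Real.log ((p.profile n hn).jacobian e X * (p.profile n hn).jacobian (-e) X)|
      ∂(gibbs z (box n) Y) ≤ 101 / 100 * p.σ ^ 2 *
        (8 * (1 / 2 + (Real.log (p.R / (p.r - 1 / 2)) + 1 / (2 * (p.r - 1 / 2))))) := by
  set P := p.profile n hn
  set μ := gibbs z (box n) Y
  set C := 101 / 100 * p.σ ^ 2 *
    (8 * (1 / 2 + (Real.log (p.R / (p.r - 1 / 2)) + 1 / (2 * (p.r - 1 / 2)))))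
  have hμ : μ univ ≤ 1 := gibbs_univ_le z (measurableSet_box n) Y
  have : IsFiniteMeasure μ := ⟨hμ.trans_lt ENNReal.one_lt_top⟩
  have hae : ∀ᵐ X ∂μ, |Real.log (P.jacobian e X * P.jacobian (-e) X)| ≤ C := by
    filter_upwards [ae_gibbs_mem_hardCore z (measurableSet_box n) Y] with X hX
    exact p.abs_log_jacobian_le hn hσ he hX
  have hm : Measurable fun X => Real.log (P.jacobian e X * P.jacobian (-e) X) :=
    Real.measurable_log.comp ((P.measurable_jacobian e).mul (P.measurable_jacobian (-e)))
  have hint : Integrable (fun X => Real.log (P.jacobian e X * P.jacobian (-e) X)) μ :=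
    Integrable.of_bound hm.aestronglyMeasurable C hae
  refine ⟨hint, ?_⟩
  have hr := p.one_le_r
  have hC : 0 ≤ C := by
    have : 0 ≤ Real.log (p.R / (p.r - 1 / 2)) := by
      refine Real.log_nonneg ?_
      rw [one_le_div (by linarith)]
      linarith [p.r_lt_R]
    have : 0 ≤ 1 / (2 * (p.r - 1 / 2)) := one_div_nonneg.2 (by linarith)
    positivity
  calc _ ≤ ∫ _, C ∂μ := integral_mono_ae hint.abs (integrable_const C) hae
    _ = μ.real univ * C := by rw [integral_const, smul_eq_mul]
    _ ≤ C := mul_le_of_le_one_left hC (ENNReal.toReal_le_of_le_ofReal zero_le_one (by simpa))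

end LogParams

end HardDisk
end

noncomputable section

namespace HardDisk

section Numerics

theorem log_two_hundred_le : Real.log 200 ≤ 53 / 10 := by
  rw [Real.log_le_iff_le_exp (by norm_num)]
  have h : (200 : ℝ) ^ 10 ≤ Real.exp (53 / 10) ^ 10 := by
    rw [← Real.exp_nat_mul, show ((10 : ℕ) : ℝ) * (53 / 10) = ((53 : ℕ) : ℝ) * 1 by norm_num,
      Real.exp_nat_mul]
    calc (200 : ℝ) ^ 10 ≤ 2.7182818283 ^ 53 := by norm_num
      _ ≤ Real.exp 1 ^ 53 := by gcongr; exact Real.exp_one_gt_d9.le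
  exact le_of_pow_le_pow_left₀ (by norm_num) (Real.exp_nonneg _) h

theorem five_le_log {n : ℝ} (hn : 200 ≤ n) : 5 ≤ Real.log n := by
  rw [Real.le_log_iff_exp_le (by linarith), show (5 : ℝ) = ((5 : ℕ) : ℝ) * 1 by norm_num,
    Real.exp_nat_mul]
  calc Real.exp 1 ^ 5 ≤ 2.7182818286 ^ 5 := by gcongr; exact Real.exp_one_lt_d9.le
    _ ≤ 200 := by norm_num
    _ ≤ n := hn

theorem le_sqrt {n : ℝ} (hn : 200 ≤ n) : 14142 / 1000 ≤ √n :=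
  Real.le_sqrt_of_sq_le (by norm_num; linarith)

theorem log_le_sqrt {n : ℝ} (hn : 200 ≤ n) : Real.log n ≤ 33 / 10 + 14143 / 100000 * √n := by
  have h0 : (0 : ℝ) ≤ n := by linarith
  have hs := le_sqrt hn
  have h1 : n = 200 * ((√n / √200) * (√n / √200)) := by
    rw [div_mul_div_comm, Real.mul_self_sqrt h0, Real.mul_self_sqrt (by norm_num)]
    ring
  have h200 : (0 : ℝ) < √200 := by positivity
  have hpos : 0 < √n / √200 := by positivity
  have h2 : Real.log n = Real.log 200 + 2 * Real.log (√n / √200) := by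
    conv_lhs => rw [h1]
    rw [Real.log_mul (by norm_num) (by positivity), Real.log_mul hpos.ne' hpos.ne']
    ring
  have h3 := Real.log_le_sub_one_of_pos hpos
  have h4 : √n / √200 ≤ 14143 / 200000 * √n := by
    rw [div_le_iff₀ h200]
    have : 14142 / 1000 ≤ √200 := le_sqrt le_rfl
    nlinarith
  linarith [log_two_hundred_le]

theorem sqrt_two_lower : 14142 / 10000 ≤ √2 := Real.le_sqrt_of_sq_le (by norm_num)

theorem sqrt_two_upper : √2 ≤ 14143 / 10000 := by
  rw [Real.sqrt_le_left (by norm_num)]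
  norm_num

/-- The radius inside which the profile is constant. -/
def innerRadius (n : ℝ) : ℝ := √2 * √n + 41 / 10 * Real.log n

theorem forty_le_innerRadius {n : ℝ} (hn : 200 ≤ n) : 40 ≤ innerRadius n := by
  have h1 := sqrt_two_lower
  have h2 := le_sqrt hn
  have h3 := five_le_log hn
  rw [innerRadius]
  nlinarith

theorem innerRadius_le {n : ℝ} (hn : 200 ≤ n) : innerRadius n ≤ 298 / 100 * √n := by
  have h1 := sqrt_two_upper
  have h2 := le_sqrt hn
  have h3 := log_le_sqrt hn
  rw [innerRadius]
  nlinarith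

theorem sqrt_div_three_le {n : ℝ} (hn : 200 ≤ n) : √n / 3 ≤ (n - 1) / innerRadius n := by
  have h1 := forty_le_innerRadius hn
  have h2 := innerRadius_le hn
  have h3 : √n * √n = n := Real.mul_self_sqrt (by linarith)
  have h4 := le_sqrt hn
  rw [div_le_div_iff₀ (by norm_num) (by linarith)]
  nlinarith

theorem half_log_sub_le {n : ℝ} (hn : 200 ≤ n) :
    Real.log n / 2 - 11 / 10 ≤ Real.log ((n - 1) / innerRadius n) := by
  have h1 := le_sqrt hn
  have h2 := Real.log_le_log (by positivity) (sqrt_div_three_le hn)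
  rw [Real.log_div (by positivity) (by norm_num), Real.log_sqrt (by linarith)] at h2
  have h3 : Real.log 3 ≤ 11 / 10 := by
    rw [Real.log_le_iff_le_exp (by norm_num)]
    have h : (3 : ℝ) ^ 10 ≤ Real.exp (11 / 10) ^ 10 := by
      rw [← Real.exp_nat_mul, show ((10 : ℕ) : ℝ) * (11 / 10) = ((11 : ℕ) : ℝ) * 1 by norm_num,
        Real.exp_nat_mul]
      calc (3 : ℝ) ^ 10 ≤ 2.7182818283 ^ 11 := by norm_num
        _ ≤ Real.exp 1 ^ 11 := by gcongr; exact Real.exp_one_gt_d9.le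
    exact le_of_pow_le_pow_left₀ (by norm_num) (Real.exp_nonneg _) h
  linarith

theorem log_one_add_le {u : ℝ} (hu : 0 ≤ u) (hu' : u ≤ 55 / 100) :
    Real.log (1 + u) ≤ 145 / 100 * u / (1 + 125 / 100 * u) := by
  rw [le_div_iff₀ (by positivity)]
  rcases le_total u (36 / 100) with h | h
  · have := Real.log_le_sub_one_of_pos (show 0 < 1 + u by linarith)
    nlinarith
  · have h1 : Real.log (1 + u) = Real.log (3 / 2) + Real.log ((1 + u) / (3 / 2)) := by
      rw [← Real.log_mul (by norm_num) (by positivity)]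
      congr 1
      field_simp
    have h2 := Real.log_le_sub_one_of_pos (show 0 < (1 + u) / (3 / 2) by positivity)
    have h3 : Real.log (3 / 2) ≤ 42 / 100 := by
      rw [Real.log_le_iff_le_exp (by norm_num)]
      have := Real.quadratic_le_exp_of_nonneg (show (0 : ℝ) ≤ 42 / 100 by norm_num)
      norm_num at this ⊢
      linarith
    have h4 : Real.log (1 + u) ≤ 42 / 100 + ((1 + u) / (3 / 2) - 1) := by linarith
    nlinarith

theorem log_one_add_le_mul_log {ε u : ℝ} (hε : 0 < ε) (hε' : ε ≤ 1 / 4) (hu : 0 ≤ u)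
    (hu' : u ≤ 55 / 100) :
    Real.log (1 + u) ≤ (17 / 10 / ε - 1) * Real.log (1 + ε * u / (1 + u)) := by
  have h1 := Real.one_sub_inv_le_log_of_pos (show 0 < 1 + ε * u / (1 + u) by positivity)
  have h2 : 1 - (1 + ε * u / (1 + u))⁻¹ = ε * u / (1 + u + ε * u) := by
    field_simp
    ring
  have hk : 0 ≤ 17 / 10 / ε - 1 := by
    rw [sub_nonneg, one_le_div hε]
    linarith
  rw [h2] at h1
  refine le_trans ?_ (mul_le_mul_of_nonneg_left h1 hk)
  have h3 : (17 / 10 / ε - 1) * (ε * u / (1 + u + ε * u)) =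
      (17 / 10 - ε) * u / (1 + u + ε * u) := by
    field_simp
  rw [h3]
  refine (log_one_add_le hu hu').trans ?_
  have : u * (145 / 100 * (1 + u + ε * u)) ≤ u * ((17 / 10 - ε) * (1 + 125 / 100 * u)) :=
    mul_le_mul_of_nonneg_left (by nlinarith) hu
  rw [div_le_div_iff₀ (by positivity) (by positivity)]
  nlinarith

theorem window_div_le {n w : ℝ} (hn : 200 ≤ n) (hw : innerRadius n ≤ w) :
    (⌈41 / 10 * Real.log n⌉₊ : ℝ) / w ≤ 55 / 100 := by
  have h0 := forty_le_innerRadius hn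
  have h1 := sqrt_two_lower
  have h2 := le_sqrt hn
  have h3 := log_le_sqrt hn
  have h4 := five_le_log hn
  have h5 := (Nat.ceil_lt_add_one (show 0 ≤ 41 / 10 * Real.log n by positivity)).le
  rw [div_le_iff₀ (by linarith)]
  rw [innerRadius] at hw
  nlinarith

theorem log_one_add_window_le {n ε : ℝ} (hn : 200 ≤ n) (hε : 0 < ε) (hε' : ε ≤ 1 / 4) {w : ℝ}
    (hw : innerRadius n ≤ w) :
    Real.log (1 + ⌈41 / 10 * Real.log n⌉₊ / w) ≤ (17 / 10 / ε - 1) *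
      Real.log (1 + ε * ⌈41 / 10 * Real.log n⌉₊ / (w + ⌈41 / 10 * Real.log n⌉₊)) := by
  have h0 := forty_le_innerRadius hn
  have hw0 : 0 < w := by linarith
  set ℓ : ℝ := (⌈41 / 10 * Real.log n⌉₊ : ℝ) with hℓ
  have hℓ0 : 0 ≤ ℓ := Nat.cast_nonneg _
  have h := log_one_add_le_mul_log hε hε' (div_nonneg hℓ0 hw0.le) (window_div_le hn hw)
  have h1 : ε * (ℓ / w) / (1 + ℓ / w) = ε * ℓ / (w + ℓ) := by
    field_simp
  rwa [h1] at h

theorem gap_factor_le {z ε : ℝ} (hε : 0 < ε) (hε' : ε ≤ 1 / 4) (hzε : z * ε ≤ 1 / 48) :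
    z * (2 * Real.pi * ((ε + ε ^ 2) * Real.exp 1)) ≤ Real.exp (-(4 / 5)) := by
  have h1 : Real.exp (9 / 5) ≤ 611 / 100 := by
    have h : Real.exp (9 / 5) ^ 5 ≤ (611 / 100) ^ 5 := by
      rw [← Real.exp_nat_mul, show ((5 : ℕ) : ℝ) * (9 / 5) = ((9 : ℕ) : ℝ) * 1 by norm_num,
        Real.exp_nat_mul]
      calc Real.exp 1 ^ 9 ≤ 2.7182818286 ^ 9 := by gcongr; exact Real.exp_one_lt_d9.le
        _ ≤ _ := by norm_num
    exact le_of_pow_le_pow_left₀ (by norm_num) (by norm_num) h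
  have h2 : Real.exp 1 = Real.exp (9 / 5) * Real.exp (-(4 / 5)) := by
    rw [← Real.exp_add]
    norm_num
  have h3 : z * (ε + ε ^ 2) ≤ 5 / 192 := by
    have : z * (ε + ε ^ 2) = z * ε * (1 + ε) := by ring
    rw [this]
    calc z * ε * (1 + ε) ≤ 1 / 48 * (1 + ε) := mul_le_mul_of_nonneg_right hzε (by linarith)
      _ ≤ _ := by linarith
  have hpi := Real.pi_lt_d4
  have hpi0 := Real.pi_pos
  calc z * (2 * Real.pi * ((ε + ε ^ 2) * Real.exp 1))
      = z * (ε + ε ^ 2) * (2 * Real.pi * Real.exp (9 / 5)) * Real.exp (-(4 / 5)) := by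
        rw [h2]; ring
    _ ≤ 5 / 192 * (2 * 3.1416 * (611 / 100)) * Real.exp (-(4 / 5)) := by gcongr
    _ ≤ 1 * Real.exp (-(4 / 5)) := by gcongr; norm_num
    _ = _ := one_mul _

theorem window_bound {n q : ℝ} (hn : 200 ≤ n) (hq : 0 ≤ q) (hq' : q ≤ Real.exp (-(4 / 5))) :
    q ^ ⌈41 / 10 * Real.log n⌉₊ * (2 * (n - 1) + 1) ^ 2 ≤ 1 / n := by
  have hn0 : 0 < n := by linarith
  have h5 := five_le_log hn
  set ℓ := ⌈41 / 10 * Real.log n⌉₊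
  have hℓ : 41 / 10 * Real.log n ≤ ℓ := Nat.le_ceil _
  have h1 : q ^ ℓ ≤ Real.exp (-(328 / 100 * Real.log n)) := by
    refine (pow_le_pow_left₀ hq hq' ℓ).trans ?_
    rw [← Real.exp_nat_mul]
    exact Real.exp_le_exp.2 (by linarith)
  have h2 : (2 * (n - 1) + 1) ^ 2 ≤ 4 * n ^ 2 := by nlinarith
  have h3 : 4 * n ^ 3 ≤ Real.exp (328 / 100 * Real.log n) := by
    rw [← Real.log_le_iff_le_exp (by positivity), Real.log_mul (by norm_num) (by positivity),
      Real.log_pow, show (4 : ℝ) = 2 ^ 2 by norm_num, Real.log_pow]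
    push_cast
    linarith [Real.log_two_lt_d9]
  rw [le_div_iff₀ hn0]
  calc q ^ ℓ * (2 * (n - 1) + 1) ^ 2 * n
      ≤ Real.exp (-(328 / 100 * Real.log n)) * (4 * n ^ 2) * n := by gcongr
    _ = Real.exp (-(328 / 100 * Real.log n)) * (4 * n ^ 3) := by ring
    _ ≤ Real.exp (-(328 / 100 * Real.log n)) * Real.exp (328 / 100 * Real.log n) := by gcongr
    _ = 1 := by rw [← Real.exp_add]; simp

end Numerics

section Parameters

theorem seven_fifths_le_log {n : ℝ} (hn : 200 ≤ n) :
    7 / 5 ≤ Real.log ((n - 1) / innerRadius n) := by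
  linarith [half_log_sub_le hn, five_le_log hn]

theorem sqrt_log_div_le {n : ℝ} (hn : 200 ≤ n) :
    17 / 10 * √(Real.log n) / Real.log ((n - 1) / innerRadius n) ≤ innerRadius n / 10 := by
  have h1 := seven_fifths_le_log hn
  have h2 := half_log_sub_le hn
  have h3 := forty_le_innerRadius hn
  have h5 := five_le_log hn
  have h4 : 2 ≤ √(Real.log n) := Real.le_sqrt_of_sq_le (by linarith)
  have h6 : √(Real.log n) * √(Real.log n) = Real.log n := Real.mul_self_sqrt (by linarith)
  rw [div_le_iff₀ (by linarith)]
  nlinarith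

theorem energy_bound {n : ℝ} (hn : 200 ≤ n) (δ : ℝ) :
    101 / 100 * (17 / 10 * δ * √(Real.log n) / Real.log ((n - 1) / innerRadius n)) ^ 2 *
      (8 * (1 / 2 + (Real.log ((n - 1) / (innerRadius n - 1 / 2)) +
        1 / (2 * (innerRadius n - 1 / 2))))) ≤ 120 * δ ^ 2 := by
  have hU := seven_fifths_le_log hn
  have h2 := half_log_sub_le hn
  have hr := forty_le_innerRadius hn
  have hL := five_le_log hn
  set r := innerRadius n
  set U := Real.log ((n - 1) / r) with hUdef
  set L := Real.log n
  have h3 : Real.log ((n - 1) / (r - 1 / 2)) ≤ U + 13 / 1000 := by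
    have h4 : (n - 1) / (r - 1 / 2) = (n - 1) / r * (r / (r - 1 / 2)) := by
      have : r - 1 / 2 ≠ 0 := by linarith
      have : r ≠ 0 := by linarith
      field_simp
    rw [h4, Real.log_mul (div_pos (by linarith) (by linarith)).ne'
      (div_pos (by linarith) (by linarith)).ne']
    have h5 := Real.log_le_sub_one_of_pos (show 0 < r / (r - 1 / 2) from
      div_pos (by linarith) (by linarith))
    have h6 : r / (r - 1 / 2) ≤ 1013 / 1000 := by
      rw [div_le_iff₀ (by linarith)]
      linarith
    linarith
  have h4 : 1 / (2 * (r - 1 / 2)) ≤ 13 / 1000 := by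
    rw [div_le_iff₀ (by linarith)]
    linarith
  have h5 : (17 / 10 * δ * √L / U) ^ 2 = 289 / 100 * δ ^ 2 * (L / U ^ 2) := by
    rw [div_pow, mul_pow, mul_pow, Real.sq_sqrt (by linarith)]
    ring
  have h6 : L / U ^ 2 * (U + 526 / 1000) ≤ 513 / 100 := by
    rw [div_mul_eq_mul_div, div_le_iff₀ (by positivity)]
    nlinarith
  rw [h5]
  have hLU : 0 ≤ L / U ^ 2 := by positivity
  calc _ ≤ 101 / 100 * (289 / 100 * δ ^ 2 * (L / U ^ 2)) * (8 * (U + 526 / 1000)) := 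
        mul_le_mul_of_nonneg_left (by linarith) (by positivity)
    _ = 101 / 100 * (289 / 100) * 8 * δ ^ 2 * (L / U ^ 2 * (U + 526 / 1000)) := by ring
    _ ≤ 101 / 100 * (289 / 100) * 8 * δ ^ 2 * (513 / 100) := by gcongr
    _ ≤ 120 * δ ^ 2 := by nlinarith [sq_nonneg δ]

/-- The parameters of the profile in the box `Λ_n`. -/
def params {n δ ε : ℝ} (hn : 200 ≤ n) (hδ : 0 < δ) (hδ' : δ ≤ 1 / 2) (hε : 0 < ε)
    (hε' : ε ≤ 1 / 4) : LogParams where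
  r := innerRadius n
  R := n - 1
  c := δ * ε * √(Real.log n) / Real.log ((n - 1) / innerRadius n)
  σ := 17 / 10 * δ * √(Real.log n) / Real.log ((n - 1) / innerRadius n)
  one_le_r := by linarith [forty_le_innerRadius hn]
  r_lt_R := by
    have h1 := sqrt_div_three_le hn
    have h2 := forty_le_innerRadius hn
    rw [le_div_iff₀ (by linarith)] at h1
    nlinarith [le_sqrt hn]
  c_pos := by
    have h1 := seven_fifths_le_log hn
    have h2 := five_le_log hn
    positivity
  c_le := by
    have h1 := seven_fifths_le_log hn
    have h2 : δ * ε ≤ 17 / 10 * δ := by nlinarith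
    gcongr
  σ_le := by
    have h1 := sqrt_log_div_le hn
    have h2 := forty_le_innerRadius hn
    rw [mul_right_comm, mul_div_right_comm]
    nlinarith

end Parameters

end HardDisk
end

theorem theorem1 (z δ : ℝ) (hz : 0 < z) (hδ : 0 < δ) (hδ' : δ ≤ 1 / 2) (n : ℕ) (hn : 200 ≤ n) :
    ∃ (t : HardDisk.Config → HardDisk.Plane → ℝ)
      (T Tbar : HardDisk.Config → HardDisk.Config)
      (G : Set HardDisk.Config) (φ φbar : HardDisk.Config → ℝ),
      -- the form of the two transformations, and measurability
      (∀ X x, 0 ≤ t X x) ∧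
      (∀ X, (T X).carrier = (fun x => x + t X x • HardDisk.e₁) '' X.carrier) ∧
      (∀ X, (Tbar X).carrier = (fun x => x - t X x • HardDisk.e₁) '' X.carrier) ∧
      Measurable T ∧ Measurable Tbar ∧ MeasurableSet G ∧
      -- (1)
      (∀ X, ∀ x ∉ HardDisk.box n, t X x = 0) ∧
      -- (2)
      (∀ X ∈ G, ∀ x ∈ X.carrier ∩ HardDisk.box (Real.sqrt n),
        t X x = δ * min (1 / (48 * z)) (1 / 4) * Real.sqrt (Real.log n)) ∧
      -- (3)
      (∀ X : HardDisk.Config, ∀ x ∈ X.carrier, ∀ y ∈ X.carrier,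
        |t X x - t X y| ≤ δ * dist x y) ∧
      -- (4)
      (∀ Y ∈ HardDisk.hardCore,
        HardDisk.gibbs z (HardDisk.box n) Y Gᶜ ≤ ENNReal.ofReal (1 / n)) ∧
      -- (5), for both transformations
      (Function.Bijective T ∧ T '' HardDisk.hardCore = HardDisk.hardCore) ∧
      (Function.Bijective Tbar ∧ Tbar '' HardDisk.hardCore = HardDisk.hardCore) ∧
      -- (6), for both transformations
      (∀ Y ∈ HardDisk.hardCore,
        HardDisk.IsImageDensity (HardDisk.gibbs z (HardDisk.box n) Y) T φ ∧
        HardDisk.IsImageDensity (HardDisk.gibbs z (HardDisk.box n) Y) Tbar φbar) ∧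
      -- (7); positivity is needed because `Real.log 0 = 0` in Lean
      (∀ Y ∈ HardDisk.hardCore,
        (∀ᵐ X ∂(HardDisk.gibbs z (HardDisk.box n) Y), 0 < φ X * φbar X) ∧
        MeasureTheory.Integrable (fun X => Real.log (φ X * φbar X))
          (HardDisk.gibbs z (HardDisk.box n) Y) ∧
        ∫ X, |Real.log (φ X * φbar X)| ∂(HardDisk.gibbs z (HardDisk.box n) Y)
          ≤ 120 * δ ^ 2) := by
  have hn' : (200 : ℝ) ≤ n := by exact_mod_cast hn
  set ε : ℝ := min (1 / (48 * z)) (1 / 4) with hεdef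
  have hε : 0 < ε := by positivity
  have hε' : ε ≤ 1 / 4 := min_le_right _ _
  have hzε : z * ε ≤ 1 / 48 := by
    calc z * ε ≤ z * (1 / (48 * z)) := mul_le_mul_of_nonneg_left (min_le_left _ _) hz.le
      _ = 1 / 48 := by field_simp
  have hU := HardDisk.seven_fifths_le_log hn'
  have hr := HardDisk.forty_le_innerRadius hn'
  have hL := HardDisk.five_le_log hn'
  let p := HardDisk.params hn' hδ hδ' hε hε'
  have hp : p.R + 1 ≤ n := by
    change (n : ℝ) - 1 + 1 ≤ n
    linarith
  let P := p.profile n hp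
  have he : ‖HardDisk.e₁‖ = 1 := by simp [HardDisk.e₁]
  have he' : ‖-HardDisk.e₁‖ = 1 := by rw [norm_neg, he]
  have hσ : p.σ = δ * (17 / 10 * √(Real.log n) /
      Real.log ((n - 1) / HardDisk.innerRadius n)) := by
    change 17 / 10 * δ * √(Real.log n) / Real.log ((n - 1) / HardDisk.innerRadius n) = _
    ring
  have hσr := HardDisk.sqrt_log_div_le hn'
  have hpr : p.r = HardDisk.innerRadius n := rfl
  have htop : p.c * Real.log (p.R / p.r) = δ * ε * √(Real.log n) := by
    change δ * ε * √(Real.log n) / Real.log ((n - 1) / HardDisk.innerRadius n) *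
      Real.log ((n - 1) / HardDisk.innerRadius n) = _
    field_simp
  have hc : p.σ = 17 / 10 / ε * p.c := by
    change 17 / 10 * δ * √(Real.log n) / Real.log ((n - 1) / HardDisk.innerRadius n) =
      17 / 10 / ε * (δ * ε * √(Real.log n) / Real.log ((n - 1) / HardDisk.innerRadius n))
    field_simp
  have hsmooth := p.smoothOff n hp
  refine ⟨P.time, P.move HardDisk.e₁, P.move (-HardDisk.e₁), p.goodSet hp √n,
    P.jacobian HardDisk.e₁, P.jacobian (-HardDisk.e₁), P.time_nonneg, fun X => rfl, fun X => ?_,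
    P.measurable_move he, P.measurable_move he', p.measurableSet_goodSet hp _,
    fun X x hx => HardDisk.shiftTime_of_notMem _ _ _ X hx, fun X hX x hx => (hX x hx).trans htop,
    fun X x hx y hy => ?_, fun Y _ => ?_, ⟨P.bijective_move he, P.image_hardCore he⟩,
    ⟨P.bijective_move he', P.image_hardCore he'⟩,
    fun Y _ => ⟨P.isImageDensity hsmooth he Y z, P.isImageDensity hsmooth he' Y z⟩,
    fun Y _ => ⟨Filter.Eventually.of_forall fun X =>
      mul_pos (P.jacobian_pos _ _) (P.jacobian_pos _ _), ?_⟩⟩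
  · change HardDisk.shiftPoint _ _ _ _ X '' X.carrier = _
    refine image_congr fun x _ => ?_
    rw [HardDisk.shiftPoint, smul_neg, sub_eq_add_neg]
  · refine (P.abs_time_sub_le X hx hy).trans (mul_le_mul_of_nonneg_right ?_ dist_nonneg)
    change p.σ / p.r ≤ δ
    rw [div_le_iff₀ p.r_pos, hσ, hpr]
    exact mul_le_mul_of_nonneg_left (by linarith) hδ.le
  · have hK1 : 1 < 17 / 10 / ε := by
      rw [one_lt_div hε]
      linarith
    have hq : 0 ≤ z * (2 * Real.pi * ((ε + ε ^ 2) * Real.exp 1)) := by positivity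
    refine (p.gibbs_compl_goodSet_le z hp hK1 hc (ℓ := ⌈41 / 10 * Real.log n⌉₊)
      (Nat.ceil_pos.2 (by linarith))
      (fun w hw => HardDisk.log_one_add_window_le hn' hε hε' hw) hε ?_ Y).trans ?_
    · have h1 := (Nat.ceil_lt_add_one (show 0 ≤ 41 / 10 * Real.log n by positivity)).le
      rw [hpr, HardDisk.innerRadius]
      linarith
    · rw [← ENNReal.ofReal_mul hz.le, ← ENNReal.ofReal_pow hq,
        ← ENNReal.ofReal_mul (pow_nonneg hq _)]
      exact ENNReal.ofReal_le_ofReal (HardDisk.window_bound hn' hq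
        (HardDisk.gap_factor_le hε hε' hzε))
  · have hσ20 : p.σ ≤ p.r / 20 := by
      rw [hσ, hpr]
      nlinarith
    obtain ⟨h1, h2⟩ := p.integral_abs_log_jacobian_le hp hσ20 he z Y
    exact ⟨h1, h2.trans (HardDisk.energy_bound hn' δ)⟩
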